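/- **Setting.** A multigraph is finite and may have parallel edges and self-loops; a self-loop at $v$ contributes two to the degree of $v$. Every edge consists of two half-edges, one at each of its endpoints (both at $v$ for a self-loop at $v$). In the $\mathsf{LOCAL}$ model on an $n$-node multigraph, each node initially knows $n$, its degree (its incident half-edges are numbered by port numbers $0,\dots,d(v)-1$, in an arbitrary way) and a unique $O(\log n)$-bit identifier, that is, an identifier in $\{0,\dots,n^k-1\}$ for an arbitrary fixed constant $k$. In each synchronous round every node sends one message of arbitrary size along each incident half-edge and receives one along each; local computation is unbounded. At the end every node labels its incident half-edges (with "outgoing"/"incoming", or with "red"/"black"). In a randomized algorithm each node also has private, independent, fair random bits, and for every constant $c$ there has to be an algorithm whose output is correct with probability at least $1-n^{-c}$. The hidden constants may depend on $k$ (and on $c$ in the randomized case). In a 5-regular multigraph, a *decomposition with half-paths of length at most* $\ell$ is a coloring of the half-edges red and black such that exactly two half-edges at each node are red, and the red half-edges form paths (never cycles), each of at most $\ell$ half-edges; here two red half-edges are consecutive if they are the two red half-edges of one node or the two halves of one edge. **Lemma.** Each of the following three problems can be solved in $O(\log n)$ rounds by deterministic algorithms and in $O(\log\log n)$ rounds by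 randomized algorithms: 1. Given any multigraph, find an orientation of its edges such that every node of degree at least $5$ has outdegree at least $2$. 2. Given a $5$-regular multigraph, find an orientation of its edges such that every node has outdegree at least $2$. 3. Given a $5$-regular multigraph, find a decomposition with half-paths of length at most $8$. -/

import Mathlib

namespace LocalModel

open Filter Asymptotics

/-- A multigraph on the node set `V`, with a port numbering. Node `v` has degree `deg v`, and its
incident half-edges are its ports `0, …, deg v - 1`. The involution `opp` sends each half-edge to
the other half of its edge, so an edge is a pair `{p, opp p}` of distinct ports. Parallel edges and
self-loops are allowed; a self-loop at `v` occupies two ports of `v` and so adds two to `deg v`. -/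
structure Network (V : Type) where
  deg : V → ℕ
  opp : (Σ v, Fin (deg v)) → Σ v, Fin (deg v)
  opp_opp : ∀ p, opp (opp p) = p
  opp_ne : ∀ p, opp p ≠ p

/-- The half-edges (ports) of a network; `p.1` is the node of the half-edge `p`. -/
abbrev Network.Port {V : Type} (N : Network V) : Type := Σ v, Fin (N.deg v)

/-- A multigraph is `d`-regular if all its nodes have degree `d`. -/
def Network.IsRegular {V : Type} (N : Network V) (d : ℕ) : Prop := ∀ v, N.deg v = d

/-- The number of half-edges at `v` that carry the label `true`. -/
def Network.count {V : Type} (N : Network V) (x : N.Port → Bool) (v : V) : ℕ :=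
  (Finset.univ.filter fun i : Fin (N.deg v) => x ⟨v, i⟩ = true).card

/-- An orientation of the edges, recorded at the half-edges: `x p = true` says that the edge of `p`
is outgoing at the half `p` (it leaves the node `p.1`), and then it is incoming at the other half.
-/
def Network.IsOrientation {V : Type} (N : Network V) (x : N.Port → Bool) : Prop :=
  ∀ p, x (N.opp p) = !(x p)

/-- The outdegree of `v` in the orientation `x`. -/
def Network.outdeg {V : Type} (N : Network V) (x : N.Port → Bool) (v : V) : ℕ := N.count x v

/-- `h 0, …, h (m - 1)` is a walk along `m` red half-edges: consecutive half-edges are alternately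
the two halves of one edge, and two different half-edges at one node
(either kind may come first). -/
def Network.IsRedWalk {V : Type} (N : Network V) (red : N.Port → Bool) (m : ℕ) (h : ℕ → N.Port) :
    Prop :=
  (∀ i, i < m → red (h i) = true) ∧
  ∃ s : ℕ, ∀ i, i + 1 < m →
    if Even (i + s) then h (i + 1) = N.opp (h i)
    else (h (i + 1)).1 = (h i).1 ∧ h (i + 1) ≠ h i

/-- A decomposition with half-paths of length `k`: exactly two half-edges at each node are red
(all others are black), and the red half-edges form paths, never cycles, of at most `k` half-edges
each. A cycle is excluded by demanding that no walk along red half-edges comes back to a half-edge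
that it has already used. -/
structure Network.IsHalfPathDecomposition {V : Type} (N : Network V) (k : ℕ)
    (red : N.Port → Bool) : Prop where
  two_red : ∀ v, N.count red v = 2
  no_cycle : ∀ m h, N.IsRedWalk red m h → Set.InjOn h (Set.Iio m)
  length_le : ∀ m h, N.IsRedWalk red m h → m ≤ k

/-- A synchronous message-passing algorithm of the LOCAL model. `S n` is the type of the private
random strings in networks with `n` nodes. A node starts with the knowledge of `n`, of its
identifier, of its degree and of its random string. In every round it sends one message through
each port, receives one through each port, and updates its state; local computation and message
size are unbounded. At the end it labels each of its half-edges. -/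
structure Algorithm (S : ℕ → Type) (Out : Type) where
  State : Type
  Msg : Type
  init : (n ident d : ℕ) → S n → State
  send : (d : ℕ) → State → Fin d → Msg
  update : (d : ℕ) → State → (Fin d → Msg) → State
  output : (d : ℕ) → State → Fin d → Out

namespace Algorithm

variable {S : ℕ → Type} {Out V : Type}

/-- One round: the message that arrives at a port is the one sent through the opposite port. -/
def round (A : Algorithm S Out) (N : Network V) (σ : V → A.State) : V → A.State :=
  fun v => A.update (N.deg v) (σ v) fun i =>
    A.send (N.deg (N.opp ⟨v, i⟩).1) (σ (N.opp ⟨v, i⟩).1) (N.opp ⟨v, i⟩).2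

/-- The states of all nodes after `t` rounds. -/
def stateAfter (A : Algorithm S Out) [Fintype V] (N : Network V) (ident : V → ℕ)
    (ω : V → S (Fintype.card V)) : ℕ → V → A.State
  | 0 => fun v => A.init (Fintype.card V) (ident v) (N.deg v) (ω v)
  | t + 1 => A.round N (A.stateAfter N ident ω t)

/-- The labels of the half-edges that the algorithm outputs after `t` rounds. -/
def run (A : Algorithm S Out) [Fintype V] (N : Network V) (ident : V → ℕ)
    (ω : V → S (Fintype.card V)) (t : ℕ) : N.Port → Out :=
  fun p => A.output (N.deg p.1) (A.stateAfter N ident ω t p.1) p.2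

end Algorithm

/-- A labelling problem: which labellings of the half-edges of a network are solutions. -/
abbrev Problem (Out : Type) : Type 1 := ∀ (V : Type) (N : Network V), (N.Port → Out) → Prop

/-- Unique identifiers of `O(log n)` bits: pairwise different numbers below `n ^ k`. -/
def IsIdentifiers {V : Type} [Fintype V] (k : ℕ) (ident : V → ℕ) : Prop :=
  Function.Injective ident ∧ ∀ v, ident v < Fintype.card V ^ k

/-- `P` is solved by deterministic LOCAL algorithms in `O(f n)` rounds, `n` the number of nodes. -/
def DetSolvable {Out : Type} (P : Problem Out) (f : ℕ → ℝ) : Prop :=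
  ∀ k : ℕ, ∃ (A : Algorithm (fun _ => Unit) Out) (T : ℕ → ℕ),
    (fun n => (T n : ℝ)) =O[atTop] f ∧
    ∀ (V : Type) [Fintype V] (N : Network V) (ident : V → ℕ), IsIdentifiers k ident →
      P V N (A.run N ident (fun _ => ()) (T (Fintype.card V)))

/-- The probability that `E` fails for a uniformly random element of a finite type. -/
noncomputable def failureProb {Ω : Type} (E : Ω → Prop) : ℝ :=
  (Nat.card {ω // ¬ E ω} : ℝ) / Nat.card Ω

/-- `P` is solved with high probability by randomized LOCAL algorithms in `O(f n)` rounds: for every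
constant `c` there is an algorithm with failure probability at most `1 / n ^ c`. Each node has
`b n` private, independent and fair random bits. -/
def RandSolvable {Out : Type} (P : Problem Out) (f : ℕ → ℝ) : Prop :=
  ∀ k c : ℕ, ∃ (b : ℕ → ℕ) (A : Algorithm (fun n => Fin (b n) → Bool) Out) (T : ℕ → ℕ),
    (fun n => (T n : ℝ)) =O[atTop] f ∧
    ∀ (V : Type) [Fintype V] (N : Network V) (ident : V → ℕ), IsIdentifiers k ident →
      failureProb (fun ω : V → Fin (b (Fintype.card V)) → Bool =>
        P V N (A.run N ident ω (T (Fintype.card V)))) ≤ 1 / (Fintype.card V : ℝ) ^ c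

/-- In any multigraph, orient the edges so that all nodes of degree at least 5 have outdegree at
least 2. -/
def outdegreeTwo : Problem Bool := fun _ N x =>
  N.IsOrientation x ∧ ∀ v, 5 ≤ N.deg v → 2 ≤ N.outdeg x v

/-- In a 5-regular multigraph, orient the edges so that all nodes have outdegree at least 2. -/
def outdegreeTwoRegular : Problem Bool := fun _ N x =>
  N.IsRegular 5 → N.IsOrientation x ∧ ∀ v, 2 ≤ N.outdeg x v

/-- In a 5-regular multigraph, find a decomposition with half-paths of length at most 8. -/
def halfPathEight : Problem Bool := fun _ N red =>
  N.IsRegular 5 → N.IsHalfPathDecomposition 8 red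

end LocalModel

/-! Everything is reduced to sinkless orientation of cubic graphs: every node needs one outgoing
half-edge out of three. At a node of degree at least 5, pair the ports 0, 1 and the ports 2, 3. If
one pair is traversed (one port out, one in) and one of the remaining three ports among 0, …, 4 is
outgoing, the outdegree is at least 2. Contracting the chains that run through the traversed pairs
leaves a cubic graph (`Network.chainGraph`), in which a sinkless orientation supplies the other
outgoing port (`Inst.good_expand`).

The contracted chains must have bounded length. Which pair is traversed is therefore decided by an
earlier sinkless orientation (`Network.trailGraph`): its nodes are triples of consecutive pairs
around the centres given by a ruling set along the trails, and each network node is an edge between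
its two pairs. The orientation leaves exactly one pair of each network node untraversed and puts an
untraversed pair into every triple, so long chains are cut (`Network.short_pairing`), except for
tiny closed ones, which are oriented directly.

Sinkless orientation is solved by closed sets of nodes with consistent choices of outgoing
half-edges. Any closed set in a ball extends to one that contains the centre (`HG.Closed.extend`);
overlapping proposals are reconciled by taking at each node the one with the smallest centre
(`not_chosen_both`). If a ball has no closed set, it is a tree in which every node has two children,
which is impossible beyond radius about `2 log n`. This is the deterministic bound.

For the randomized bound, a ruling set of the cubic graph proposes sparse special edges, each
directed by a coin; a node with an outward special half-edge is a closed set on its own. After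
deletion of the special edges, a ball without closed sets still doubles every two levels
(`HG.two_pow_le_levelSet`), and special edges are dense in it, so radius `O(log log n)` already
forces order of `log n` coins (`HG.two_pow_le_card_touched`). This has polynomially small
probability (`card_mul_two_pow_le`), and a union bound finishes. The second stage uses fresh coins,
because its graph depends on the coins of the first. Ruling sets come from Cole–Vishkin colour
reduction in `O(log log n)` rounds.

The half-path decomposition colours two outgoing half-edges of every node red. Then no edge has two
red halves, so a red path has at most two half-edges. -/

namespace LocalModel

/-! ### Views, and a calculus of locally determined functions -/

/-- A network together with identifiers and random strings. -/
structure Inst (S : ℕ → Type) (k : ℕ) where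
  V : Type
  fin : Fintype V
  N : Network V
  ident : V → ℕ
  hid : IsIdentifiers k ident
  rnd : V → S (Fintype.card V)

attribute [instance] Inst.fin

/-- The unfolded neighbourhood of a node, as gathered by message passing. -/
inductive View (S : ℕ → Type) : Type
  | leaf (n ident d : ℕ) (s : S n) : View S
  | node (prev : View S) (port : ℕ → ℕ) (child : ℕ → View S) : View S

/-- The mate of the `i`-th port of `v`, if there is such a port. -/
def Network.nbr {V : Type} (N : Network V) (v : V) (i : ℕ) : V × ℕ :=
  if h : i < N.deg v then ((N.opp ⟨v, ⟨i, h⟩⟩).1, (N.opp ⟨v, ⟨i, h⟩⟩).2.val) else (v, 0)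

/-- `u` can be reached from `v` in at most `k` steps. -/
def Network.Within {V : Type} (N : Network V) : ℕ → V → V → Prop
  | 0, v, u => u = v
  | k + 1, v, u => N.Within k v u ∨ ∃ i, i < N.deg v ∧ N.Within k (N.nbr v i).1 u

namespace Network
variable {V : Type} {N : Network V}

theorem Within.refl (k : ℕ) (v : V) : N.Within k v v := by
  induction k with
  | zero => rfl
  | succ k ih => exact Or.inl ih

theorem Within.mono {k l : ℕ} (h : k ≤ l) {v u : V} (H : N.Within k v u) : N.Within l v u := by
  induction l, h using Nat.le_induction with
  | base => exact H
  | succ l _ ih => exact Or.inl ih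

theorem Within.trans {k l : ℕ} {v u w : V} (h₁ : N.Within k v u) (h₂ : N.Within l u w) :
    N.Within (k + l) v w := by
  induction k generalizing v with
  | zero => cases h₁; simpa using h₂
  | succ k ih =>
    rw [Nat.succ_add]
    rcases h₁ with h | ⟨i, hi, h⟩
    · exact Or.inl (ih h)
    · exact Or.inr ⟨i, hi, ih h⟩

theorem nbr_back (v : V) (i : ℕ) (hi : i < N.deg v) :
    (N.nbr v i).2 < N.deg (N.nbr v i).1 ∧ N.nbr (N.nbr v i).1 (N.nbr v i).2 = (v, i) := by
  have h1 : N.nbr v i = ((N.opp ⟨v, ⟨i, hi⟩⟩).1, (N.opp ⟨v, ⟨i, hi⟩⟩).2.val) := by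
    simp [nbr, hi]
  have h2 := N.opp_opp ⟨v, ⟨i, hi⟩⟩
  rw [h1]
  refine ⟨(N.opp ⟨v, ⟨i, hi⟩⟩).2.2, ?_⟩
  have h3 : N.opp ⟨(N.opp ⟨v, ⟨i, hi⟩⟩).1, ⟨(N.opp ⟨v, ⟨i, hi⟩⟩).2.val,
    (N.opp ⟨v, ⟨i, hi⟩⟩).2.2⟩⟩ = ⟨v, ⟨i, hi⟩⟩ := h2
  have h4 := congrArg (fun p : Σ v, Fin (N.deg v) => ((p.1, p.2.val) : V × ℕ)) h3
  simpa only [nbr, Fin.is_lt, dif_pos] using h4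

theorem Within.symm {k : ℕ} {v u : V} (h : N.Within k v u) : N.Within k u v := by
  induction k generalizing v with
  | zero => cases h; rfl
  | succ k ih =>
    rcases h with h | ⟨i, hi, h⟩
    · exact Or.inl (ih h)
    · refine (ih h).trans (l := 1) ?_
      have := nbr_back (N := N) v i hi
      exact Or.inr ⟨_, this.1, by rw [this.2]; rfl⟩

theorem within_nbr (v : V) (i : ℕ) : N.Within 1 v (N.nbr v i).1 := by
  by_cases hi : i < N.deg v
  · exact Or.inr ⟨i, hi, rfl⟩
  · left; simp [nbr, hi, Within]

end Network

namespace Inst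
variable {S : ℕ → Type} {k : ℕ}

/-- The number of nodes. -/
def size (I : Inst S k) : ℕ := Fintype.card I.V

/-- The view of a node after `t` rounds of gathering. -/
def view (I : Inst S k) : ℕ → I.V → View S
  | 0, v => View.leaf I.size (I.ident v) (I.N.deg v) (I.rnd v)
  | t + 1, v => View.node (I.view t v)
      (fun i => if i < I.N.deg v then (I.N.nbr v i).2 else 0)
      (fun i => if i < I.N.deg v then I.view t (I.N.nbr v i).1 else I.view t v)

/-- The identifier of an object hosted at a node. -/
def tag (I : Inst S k) (x : I.V × ℕ) : ℕ × ℕ := (I.ident x.1, x.2)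

theorem tag_inj (I : Inst S k) {x y : I.V × ℕ} : I.tag x = I.tag y ↔ x = y := by
  constructor
  · intro h
    simp only [tag, Prod.mk.injEq] at h
    exact Prod.ext (I.hid.1 h.1) h.2
  · rintro rfl; rfl

end Inst

/-- The data at the leaf of a view. -/
def View.root {S : ℕ → Type} : View S → ℕ × ℕ × ℕ × (Σ n, S n)
  | leaf n i d s => (n, i, d, ⟨n, s⟩)
  | node p _ _ => p.root

section
variable {S : ℕ → Type} {k : ℕ} {I J : Inst S k}

theorem view_root (t : ℕ) (v : I.V) :
    (I.view t v).root = (I.size, I.ident v, I.N.deg v, ⟨I.size, I.rnd v⟩) := by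
  induction t with
  | zero => rfl
  | succ t ih => exact ih

theorem view_mono {t t' : ℕ} (h : t ≤ t') {v : I.V} {w : J.V} (H : I.view t' v = J.view t' w) :
    I.view t v = J.view t w := by
  induction t', h using Nat.le_induction with
  | base => exact H
  | succ t' _ ih =>
    simp only [Inst.view, View.node.injEq] at H
    exact ih H.1

theorem view_size {t t' : ℕ} {v : I.V} {w : J.V} (H : I.view t v = J.view t' w) :
    I.size = J.size := by
  have := congrArg View.root H
  rw [view_root, view_root] at this
  exact congrArg Prod.fst this

theorem view_ident {t t' : ℕ} {v : I.V} {w : J.V} (H : I.view t v = J.view t' w) :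
    I.ident v = J.ident w := by
  have := congrArg View.root H
  rw [view_root, view_root] at this
  exact congrArg (fun x => x.2.1) this

theorem view_deg {t t' : ℕ} {v : I.V} {w : J.V} (H : I.view t v = J.view t' w) :
    I.N.deg v = J.N.deg w := by
  have := congrArg View.root H
  rw [view_root, view_root] at this
  exact congrArg (fun x => x.2.2.1) this

theorem view_rnd {t t' : ℕ} {v : I.V} {w : J.V} (H : I.view t v = J.view t' w) :
    (⟨I.size, I.rnd v⟩ : Σ n, S n) = ⟨J.size, J.rnd w⟩ := by
  have := congrArg View.root H
  rw [view_root, view_root] at this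
  exact congrArg (fun x => x.2.2.2) this

theorem view_nbr {t i : ℕ} {v : I.V} {w : J.V} (H : I.view (t + 1) v = J.view (t + 1) w) :
    I.view t (I.N.nbr v i).1 = J.view t (J.N.nbr w i).1 ∧
      (I.N.nbr v i).2 = (J.N.nbr w i).2 := by
  have hd := view_deg H
  simp only [Inst.view, View.node.injEq] at H
  have h2 := congrFun H.2.1 i
  have h3 := congrFun H.2.2 i
  by_cases hi : i < I.N.deg v
  · have hi' : i < J.N.deg w := hd ▸ hi
    rw [if_pos hi, if_pos hi'] at h2 h3
    exact ⟨h3, h2⟩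
  · have hi' : ¬ i < J.N.deg w := hd ▸ hi
    simp [Network.nbr, hi, hi', H.1]

/-- Equal views have equal port structure, so a walk of length `l` in one instance can be copied
port by port in the other, at the cost of `l` in the radius. -/
theorem view_within {t l : ℕ} {v : I.V} {w : J.V} (H : I.view (t + l) v = J.view (t + l) w)
    {u : I.V} (hu : I.N.Within l v u) : ∃ u', J.N.Within l w u' ∧ I.view t u = J.view t u' := by
  induction l generalizing v w with
  | zero => cases hu; exact ⟨w, rfl, H⟩
  | succ l ih =>
    rcases hu with hu | ⟨i, hi, hu⟩
    · obtain ⟨u', h1, h2⟩ := ih (view_mono (by omega) H) hu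
      exact ⟨u', Or.inl h1, h2⟩
    · obtain ⟨u', h1, h2⟩ := ih (view_nbr (i := i) (t := t + l) H).1 hu
      exact ⟨u', Or.inr ⟨i, by rw [← view_deg H]; exact hi, h1⟩, h2⟩
end

section
variable {S : ℕ → Type} {k : ℕ} {α β γ : Type*}

/-- `a` is determined by the views of radius `T n`. -/
def LocR (T : ℕ → ℕ) (a : ∀ I : Inst S k, I.V × ℕ → α) : Prop :=
  ∀ (I J : Inst S k) (x : I.V × ℕ) (y : J.V × ℕ), I.size = J.size → x.2 = y.2 →
    I.view (T I.size) x.1 = J.view (T I.size) y.1 → a I x = a J y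

/-- `a` is determined by the views of radius `O(g n)`. -/
def LocF (g : ℕ → ℕ) (a : ∀ I : Inst S k, I.V × ℕ → α) : Prop :=
  ∃ C, LocR (fun n => C * g n) a

variable {g : ℕ → ℕ} {a : ∀ I : Inst S k, I.V × ℕ → α} {b : ∀ I : Inst S k, I.V × ℕ → β}
  {c : ∀ I : Inst S k, I.V × ℕ → γ}

theorem LocR.mono {T T' : ℕ → ℕ} (h : ∀ n, T n ≤ T' n) (H : LocR T a) : LocR T' a :=
  fun I J x y hs hi hv => H I J x y hs hi (view_mono (h _) hv)

theorem LocF.of1 (ha : LocF g a)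
    (H : ∀ (I J : Inst S k) (x : I.V × ℕ) (y : J.V × ℕ), I.size = J.size → x.2 = y.2 →
      a I x = a J y → c I x = c J y) : LocF g c := by
  obtain ⟨C, hC⟩ := ha
  exact ⟨C, fun I J x y hs hi hv => H I J x y hs hi (hC I J x y hs hi hv)⟩

theorem LocF.prod (ha : LocF g a) (hb : LocF g b) : LocF g (fun I x => (a I x, b I x)) := by
  obtain ⟨C, hC⟩ := ha
  obtain ⟨D, hD⟩ := hb
  refine ⟨max C D, fun I J x y hs hi hv => Prod.ext ?_ ?_⟩
  · exact hC I J x y hs hi (view_mono (Nat.mul_le_mul_right _ (le_max_left _ _)) hv)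
  · exact hD I J x y hs hi (view_mono (Nat.mul_le_mul_right _ (le_max_right _ _)) hv)

theorem LocF.of2 (ha : LocF g a) (hb : LocF g b)
    (H : ∀ (I J : Inst S k) (x : I.V × ℕ) (y : J.V × ℕ), I.size = J.size → x.2 = y.2 →
      a I x = a J y → b I x = b J y → c I x = c J y) : LocF g c :=
  (ha.prod hb).of1 fun I J x y hs hi h => H I J x y hs hi (Prod.ext_iff.1 h).1 (Prod.ext_iff.1 h).2

theorem LocF.map (F : α → β) (ha : LocF g a) : LocF g (fun I x => F (a I x)) :=
  ha.of1 fun _ _ _ _ _ _ h => by rw [h]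

theorem LocF.map2 (F : α → β → γ) (ha : LocF g a) (hb : LocF g b) :
    LocF g (fun I x => F (a I x) (b I x)) :=
  ha.of2 hb fun _ _ _ _ _ _ h h' => by rw [h, h']

theorem LocF.const (y : α) : LocF g (fun (_ : Inst S k) _ => y) := ⟨0, fun _ _ _ _ _ _ _ => rfl⟩

theorem LocF.idx : LocF g (fun (I : Inst S k) (x : I.V × ℕ) => x.2) := ⟨0, fun _ _ _ _ _ h _ => h⟩

theorem LocF.deg : LocF g (fun (I : Inst S k) (x : I.V × ℕ) => I.N.deg x.1) :=
  ⟨0, fun _ _ _ _ _ _ h => view_deg h⟩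

theorem LocF.ident : LocF g (fun (I : Inst S k) (x : I.V × ℕ) => I.ident x.1) :=
  ⟨0, fun _ _ _ _ _ _ h => view_ident h⟩

theorem LocF.tag : LocF g (fun (I : Inst S k) (x : I.V × ℕ) => I.tag x) :=
  ⟨0, fun _ _ _ _ _ h' h => Prod.ext (view_ident h) h'⟩

theorem LocF.rnd :
    LocF g (fun (I : Inst S k) (x : I.V × ℕ) => (⟨I.size, I.rnd x.1⟩ : Σ n, S n)) :=
  ⟨0, fun _ _ _ _ _ _ h => view_rnd h⟩

theorem LocF.pi {κ : Type*} [Finite κ] {a : κ → ∀ I : Inst S k, I.V × ℕ → α}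
    (h : ∀ i, LocF g (a i)) : LocF g (fun I x i => a i I x) := by
  choose C hC using h
  obtain ⟨D, hD⟩ := (Set.finite_range C).bddAbove
  refine ⟨D, fun I J x y hs hi hv => funext fun i => hC i I J x y hs hi (view_mono ?_ hv)⟩
  exact Nat.mul_le_mul_right _ (hD ⟨i, rfl⟩)

theorem LocF.forall {κ : Type*} [Finite κ] {a : κ → ∀ I : Inst S k, I.V × ℕ → Prop}
    (h : ∀ i, LocF g (a i)) : LocF g (fun I x => ∀ i, a i I x) :=
  (LocF.pi h).map fun p => ∀ i, p i

theorem LocF.not {a : ∀ I : Inst S k, I.V × ℕ → Prop} (h : LocF g a) :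
    LocF g (fun I x => ¬ a I x) := h.map _

theorem LocF.and {a b : ∀ I : Inst S k, I.V × ℕ → Prop} (h : LocF g a) (h' : LocF g b) :
    LocF g (fun I x => a I x ∧ b I x) := h.map2 And h'

theorem LocF.or {a b : ∀ I : Inst S k, I.V × ℕ → Prop} (h : LocF g a) (h' : LocF g b) :
    LocF g (fun I x => a I x ∨ b I x) := h.map2 Or h'

theorem LocF.imp {a b : ∀ I : Inst S k, I.V × ℕ → Prop} (h : LocF g a) (h' : LocF g b) :
    LocF g (fun I x => a I x → b I x) := h.map2 (fun p q => p → q) h'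

theorem LocF.ite {p : ∀ I : Inst S k, I.V × ℕ → Prop} {inst : ∀ I x, Decidable (p I x)}
    {a b : ∀ I : Inst S k, I.V × ℕ → α}
    (h : LocF g p) (ha : LocF g a) (hb : LocF g b) :
    LocF g (fun I x => if p I x then a I x else b I x) :=
  (h.prod ha).of2 hb fun _ _ _ _ _ _ h h' => by
    obtain ⟨h1, h2⟩ := Prod.ext_iff.1 h
    dsimp at h1 h2
    simp only [h1, h2, h']

/-- A map of objects that moves by a bounded distance and is determined by the views of radius
`O(g n)`. -/
def LocM (g : ℕ → ℕ) (f : ∀ I : Inst S k, I.V × ℕ → I.V × ℕ) : Prop :=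
  (∃ K, ∀ (I : Inst S k) x, I.N.Within K x.1 (f I x).1) ∧ LocF g (fun I x => I.tag (f I x))

variable {f f' : ∀ I : Inst S k, I.V × ℕ → I.V × ℕ}

theorem LocM.id : LocM g (fun (I : Inst S k) (x : I.V × ℕ) => x) :=
  ⟨⟨0, fun _ _ => rfl⟩, LocF.tag⟩

/-- The node of `f I x` lies in a ball around `x`, so some node near `y` has the same view.
Uniqueness of identifiers forces that node to be the one of `f J y`. -/
theorem LocR.read {T : ℕ → ℕ} {K : ℕ} (hf : ∀ (I : Inst S k) x, I.N.Within K x.1 (f I x).1)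
    (hf' : LocR T (fun I x => I.tag (f I x))) {T' : ℕ → ℕ} (ha : LocR T' a) :
    LocR (fun n => max (T n) (T' n + K)) (fun I x => a I (f I x)) := by
  intro I J x y hs hi hv
  obtain ⟨u', h1, h2⟩ := view_within (t := T' I.size) (l := K)
    (view_mono (le_max_right _ _) hv) (hf I x)
  have h3 := hf' I J x y hs hi (view_mono (le_max_left _ _) hv)
  simp only [Inst.tag, Prod.mk.injEq] at h3
  have h4 : u' = (f J y).1 := J.hid.1 ((view_ident h2).symm.trans h3.1)
  subst h4
  exact ha I J _ _ hs h3.2 h2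

theorem LocF.read (hg : ∀ n, 1 ≤ g n) (hf : LocM g f) (ha : LocF g a) :
    LocF g (fun I x => a I (f I x)) := by
  obtain ⟨⟨K, hK⟩, C, hC⟩ := hf
  obtain ⟨C', hC'⟩ := ha
  -- The additive distance `K` is absorbed into `K * g n`, because `1 ≤ g n`.
  refine ⟨C + C' + K, (LocR.read hK hC hC').mono fun n => ?_⟩
  have := hg n
  have h2 := Nat.mul_le_mul_left K this
  rw [add_mul, add_mul]
  omega

theorem LocM.comp (hg : ∀ n, 1 ≤ g n) (hf : LocM g f) (hf' : LocM g f') :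
    LocM g (fun I x => f' I (f I x)) := by
  refine ⟨?_, LocF.read (a := fun I x => I.tag (f' I x)) hg hf hf'.2⟩
  obtain ⟨⟨K, hK⟩, -⟩ := hf
  obtain ⟨⟨K', hK'⟩, -⟩ := hf'
  exact ⟨K + K', fun I x => (hK I x).trans (hK' I _)⟩

theorem LocM.ite {p : ∀ I : Inst S k, I.V × ℕ → Prop} {inst : ∀ I x, Decidable (p I x)}
    (hp : LocF g p) (hf : LocM g f)
    (hf' : LocM g f') : LocM g (fun I x => if p I x then f I x else f' I x) := by
  constructor
  · obtain ⟨⟨K, hK⟩, -⟩ := hf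
    obtain ⟨⟨K', hK'⟩, -⟩ := hf'
    refine ⟨max K K', fun I x => ?_⟩
    dsimp only
    split_ifs
    · exact (hK I x).mono (le_max_left _ _)
    · exact (hK' I x).mono (le_max_right _ _)
  · refine (hp.ite (inst := inst) hf.2 hf'.2).of1 fun I J x y hs hi h => ?_
    by_cases h1 : p I x <;> by_cases h2 : p J y <;> simpa [h1, h2] using h

theorem LocM.eq (hf : LocM g f) (hf' : LocM g f') : LocF g (fun I x => f I x = f' I x) :=
  hf.2.of2 hf'.2 fun I J x y _ _ h h' => by
    rw [← I.tag_inj, ← J.tag_inj, h, h']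

/-- The map that changes only the index of an object. -/
theorem LocM.reindex (F : ℕ → ℕ) : LocM g (fun (I : Inst S k) (x : I.V × ℕ) => (x.1, F x.2)) :=
  ⟨⟨0, fun _ _ => rfl⟩, LocF.tag.map fun p => (p.1, F p.2)⟩

theorem LocM.nbr (hg : ∀ n, 1 ≤ g n) :
    LocM g (fun (I : Inst S k) (x : I.V × ℕ) => I.N.nbr x.1 x.2) := by
  refine ⟨⟨1, fun I x => Network.within_nbr _ _⟩, 1, fun I J x y hs hi hv => ?_⟩
  have hv' : I.view (0 + 1) x.1 = J.view (0 + 1) y.1 :=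
    view_mono (by simpa using hg I.size) hv
  obtain ⟨h1, h2⟩ := view_nbr (i := x.2) hv'
  dsimp only [Inst.tag]
  rw [← hi]
  exact Prod.ext (view_ident h1) h2

/-- The values in a ball of radius `O(g n)`. -/
theorem LocF.ball (ha : LocF g a) (C : ℕ) :
    LocF g (fun I x => {z | ∃ u j, I.N.Within (C * g I.size) x.1 u ∧ z = a I (u, j)}) := by
  obtain ⟨D, hD⟩ := ha
  have key : ∀ (I J : Inst S k) (x : I.V × ℕ) (y : J.V × ℕ), I.size = J.size →
      I.view (D * g I.size + C * g I.size) x.1 = J.view (D * g I.size + C * g I.size) y.1 →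
      ∀ z, (∃ u j, I.N.Within (C * g I.size) x.1 u ∧ z = a I (u, j)) →
        ∃ u j, J.N.Within (C * g J.size) y.1 u ∧ z = a J (u, j) := by
    rintro I J x y hs hv z ⟨u, j, hu, rfl⟩
    obtain ⟨u', h1, h2⟩ := view_within hv hu
    exact ⟨u', j, hs ▸ h1, hD I J (u, j) (u', j) hs rfl h2⟩
  refine ⟨D + C, fun I J x y hs hi hv => ?_⟩
  simp only [add_mul] at hv
  ext z
  exact ⟨key I J x y hs hv z, key J I y x hs.symm (by rw [← hs]; exact hv.symm) z⟩

/-- Iterating a rule for `O(g n)` rounds, where in each round an object looks at the values at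
itself and at its image under a fixed map. -/
theorem LocF.iterate {c : ℕ → ∀ I : Inst S k, I.V × ℕ → α} (h0 : LocF g (c 0))
    (hf : LocM g f) (hb : LocF g b)
    (hc : ∀ (s : ℕ) (I J : Inst S k) (x : I.V × ℕ) (y : J.V × ℕ), b I x = b J y →
      c s I x = c s J y → c s I (f I x) = c s J (f J y) → c (s + 1) I x = c (s + 1) J y)
    (σ : ℕ → ℕ) (C : ℕ) (hσ : ∀ n, σ n ≤ C * g n) : LocF g (fun I => c (σ I.size) I) := by
  obtain ⟨⟨K, hK⟩, C₁, h1⟩ := hf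
  obtain ⟨C₂, h2⟩ := hb
  obtain ⟨C₃, h3⟩ := h0
  have key : ∀ s, LocR (fun n => (C₁ + C₂ + C₃) * g n + s * K) (c s) := by
    intro s
    induction s with
    | zero =>
      refine h3.mono fun n => ?_
      rw [add_mul]; omega
    | succ s ih =>
      intro I J x y hs hi hv
      refine hc s I J x y (h2 I J x y hs hi (view_mono ?_ hv)) (ih I J x y hs hi (view_mono ?_ hv))
        (LocR.read hK h1 ih I J x y hs hi (view_mono ?_ hv))
      · dsimp only; rw [add_mul, add_mul]; omega
      · dsimp only; rw [add_mul s]; omega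
      · dsimp only; rw [add_mul s, add_mul, add_mul]; apply max_le <;> omega
  refine ⟨C₁ + C₂ + C₃ + C * K, fun I J x y hs hi hv => ?_⟩
  dsimp only
  rw [← hs]
  refine key _ I J x y hs hi (view_mono ?_ hv)
  have h4 := Nat.mul_le_mul_right K (hσ I.size)
  dsimp only
  rw [add_mul _ (C * K)]
  have : C * g I.size * K = C * K * g I.size := by ring
  omega

end

/-! ### Local rules as message-passing algorithms -/

/-- Full-information gathering, followed by an arbitrary computation on the view. -/
def gather {S : ℕ → Type} (out : View S → ℕ → Bool) : Algorithm S Bool where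
  State := View S
  Msg := ℕ × View S
  init := View.leaf
  send := fun _ st i => (i, st)
  update := fun d st m => View.node st (fun i => if h : i < d then (m ⟨i, h⟩).1 else 0)
    (fun i => if h : i < d then (m ⟨i, h⟩).2 else st)
  output := fun _ st i => out st i

theorem gather_state {S : ℕ → Type} {k : ℕ} (out : View S → ℕ → Bool) (I : Inst S k) (t : ℕ) :
    (gather out).stateAfter I.N I.ident I.rnd t = I.view t := by
  induction t with
  | zero => rfl
  | succ t ih =>
    funext v
    simp only [Algorithm.stateAfter, Algorithm.round, ih, Inst.view]
    simp only [gather]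
    congr 1
    · funext i
      by_cases h : i < I.N.deg v <;> simp [h, Network.nbr]
    · funext i
      by_cases h : i < I.N.deg v <;> simp [h, Network.nbr]

/-- The output rule picks any instance and node with the gathered view and evaluates `a` there.
Locality makes the choice irrelevant. -/
theorem realize {S : ℕ → Type} {k : ℕ} {g : ℕ → ℕ} {a : ∀ I : Inst S k, I.V × ℕ → Bool}
    (h : LocF g a) : ∃ (A : Algorithm S Bool) (C : ℕ), ∀ I : Inst S k,
      A.run I.N I.ident I.rnd (C * g I.size) = fun p => a I (p.1, p.2) := by
  classical
  obtain ⟨C, hC⟩ := h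
  refine ⟨gather fun st i => if h : ∃ (I : Inst S k) (v : I.V), I.view (C * g I.size) v = st then
    a h.choose (h.choose_spec.choose, i) else false, C, fun I => ?_⟩
  funext p
  simp only [Algorithm.run, gather_state]
  have hex : ∃ (J : Inst S k) (v : J.V), J.view (C * g J.size) v = I.view (C * g I.size) p.1 :=
    ⟨I, p.1, rfl⟩
  have h1 := hex.choose_spec.choose_spec
  have h2 := view_size h1
  change (if h : ∃ (J : Inst S k) (v : J.V), J.view (C * g J.size) v = I.view (C * g I.size) p.1 then
    a h.choose (h.choose_spec.choose, p.2.val) else false) = _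
  rw [dif_pos hex]
  exact hC _ _ _ _ h2 rfl (h1.trans (by rw [h2]))

end LocalModel

/-! ### Colour reduction and ruling sets -/

namespace LocalModel

section Coloring
variable {O : Type*}

/-- The lowest bit where two numbers differ. -/
noncomputable def firstDiff (a b : ℕ) : ℕ := by
  classical exact if h : ∃ i, a.testBit i ≠ b.testBit i then Nat.find h else 0

theorem testBit_firstDiff {a b : ℕ} (h : a ≠ b) :
    a.testBit (firstDiff a b) ≠ b.testBit (firstDiff a b) := by
  classical
  have h' : ∃ i, a.testBit i ≠ b.testBit i := by
    by_contra! H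
    exact h (Nat.eq_of_testBit_eq H)
  rw [firstDiff, dif_pos h']
  exact Nat.find_spec h'

theorem firstDiff_lt {a b l : ℕ} (hl : 1 ≤ l) (ha : a < 2 ^ l) (hb : b < 2 ^ l) :
    firstDiff a b < l := by
  classical
  rw [firstDiff]
  split_ifs with h
  · rw [Nat.find_lt_iff]
    obtain ⟨i, hi⟩ := h
    refine ⟨i, ?_, hi⟩
    by_contra! hli
    have h2 : 2 ^ l ≤ 2 ^ i := Nat.pow_le_pow_right (by norm_num) hli
    rw [Nat.testBit_lt_two_pow (ha.trans_le h2), Nat.testBit_lt_two_pow (hb.trans_le h2)] at hi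
    exact hi rfl
  · omega

/-- One round of Cole–Vishkin colour reduction along the map `f`. -/
noncomputable def cvStep (f : O → O) (c : O → ℕ) (x : O) : ℕ :=
  2 * firstDiff (c x) (c (f x)) + (if (c x).testBit (firstDiff (c x) (c (f x))) then 1 else 0)

/-- The new colour encodes a bit position and the bit found there. If the new colours of `x` and `f
x` agreed, both would name the same position and bit; but at this position the old colours differ.
-/
theorem cvStep_ne {f : O → O} {c : O → ℕ} {x : O} (h : c x ≠ c (f x)) :
    cvStep f c x ≠ cvStep f c (f x) := by
  intro H
  have h1 := testBit_firstDiff h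
  simp only [cvStep] at H
  have h2 : firstDiff (c x) (c (f x)) = firstDiff (c (f x)) (c (f (f x))) := by
    split_ifs at H <;> omega
  rw [← h2] at H
  cases ha : (c x).testBit (firstDiff (c x) (c (f x))) <;>
    cases hb : (c (f x)).testBit (firstDiff (c x) (c (f x))) <;> simp_all

theorem cvStep_lt {f : O → O} {c : O → ℕ} {l : ℕ} (hl : 1 ≤ l) (h : ∀ x, c x < 2 ^ l) (x : O) :
    cvStep f c x < 2 * l := by
  have := firstDiff_lt hl (h x) (h (f x))
  simp only [cvStep]
  split_ifs <;> omega

theorem four_mul_le_two_pow {b : ℕ} (h : 6 ≤ b) : 4 * b ≤ 2 ^ (b - 1) := by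
  induction b, h using Nat.le_induction with
  | base => norm_num
  | succ b hb ih =>
    have : 2 ^ (b + 1 - 1) = 2 * 2 ^ (b - 1) := by
      rw [← pow_succ']; congr 1; omega
    omega

/-- With `b` the bit length of the bound `M`, new colours are below `2 * b`. This is at most 64 if
`b ≤ 32`, and otherwise `4 * b ≤ 2 ^ (b - 1) < M`. Mere halving is much less than the step achieves,
but it suffices for `O(log log n)` rounds. -/
theorem cvStep_lt_max {f : O → O} {c : O → ℕ} {K : ℕ} (h : ∀ x, c x < max 64 K) (x : O) :
    cvStep f c x < max 64 (K / 2) := by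
  set M := max 64 K with hM
  have hb := Nat.le_pow_clog (b := 2) (by norm_num) M
  have h1 : 1 ≤ Nat.clog 2 M := Nat.clog_pos (by norm_num) (by omega)
  have h2 := cvStep_lt (f := f) h1 (fun x => (h x).trans_le hb) x
  by_cases h3 : Nat.clog 2 M ≤ 32
  · omega
  · have h4 := four_mul_le_two_pow (b := Nat.clog 2 M) (by omega)
    have h5 : 2 ^ (Nat.clog 2 M - 1) < M := Nat.pow_pred_clog_lt_self (by norm_num) (by omega)
    omega

/-- Iterated colour reduction. -/
noncomputable def cvColor (f : O → O) (c : O → ℕ) : ℕ → O → ℕ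
  | 0 => c
  | s + 1 => cvStep f (cvColor f c s)

theorem cvColor_ne {f : O → O} {c : O → ℕ} {x : O} (h : c x ≠ c (f x)) (s : ℕ) :
    cvColor f c s x ≠ cvColor f c s (f x) := by
  induction s with
  | zero => exact h
  | succ s ih => exact cvStep_ne ih

theorem cvColor_lt {f : O → O} {c : O → ℕ} {l : ℕ} (hl : 1 ≤ l) (h : ∀ x, c x < 2 ^ l) (s : ℕ)
    (x : O) : cvColor f c (s + 1) x < max 64 (2 * l / 2 ^ s) := by
  induction s generalizing x with
  | zero =>
    have := cvStep_lt (f := f) hl h x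
    simp only [cvColor, pow_zero, Nat.div_one]
    omega
  | succ s ih =>
    rw [pow_succ, ← Nat.div_div_eq_div_mul]
    exact cvStep_lt_max ih x

/-- The first round replaces colours of about `k * log n` bits by numbers linear in this length. The
other `γ + k + 4` rounds halve the bound, and `2 ^ γ` exceeds `log n`. -/
theorem cvColor_lt_const {f : O → O} {c : O → ℕ} {n k γ : ℕ} (hg : Nat.log 2 n + 1 ≤ 2 ^ γ)
    (h : ∀ x, c x < 2 * n ^ k) (x : O) : cvColor f c (γ + k + 5) x < 64 := by
  have h1 : ∀ x, c x < 2 ^ (k * (Nat.log 2 n + 1) + 1) := fun x => (h x).trans_le <| by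
    rw [pow_succ', mul_comm k, pow_mul]
    exact Nat.mul_le_mul_left _ (Nat.pow_le_pow_left (Nat.lt_pow_succ_log_self (by norm_num) n).le _)
  have h2 := cvColor_lt (f := f) (by omega) h1 (γ + k + 4) x
  have h3 : 2 * (k * (Nat.log 2 n + 1) + 1) / 2 ^ (γ + k + 4) = 0 := by
    apply Nat.div_eq_of_lt
    have h4 : k < 2 ^ k := Nat.lt_two_pow_self
    have h5 : 1 ≤ 2 ^ γ := Nat.one_le_two_pow
    have h6 : k * (Nat.log 2 n + 1) ≤ 2 ^ k * 2 ^ γ := Nat.mul_le_mul h4.le hg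
    have h7 : 1 ≤ 2 ^ k * 2 ^ γ := Nat.one_le_iff_ne_zero.2 (by positivity)
    have h8 : 2 ^ (γ + k + 4) = 16 * (2 ^ k * 2 ^ γ) := by ring
    omega
  rw [h3] at h2
  simpa using h2

end Coloring

section Ruling
variable {O ι : Type*}

/-- `y` can be reached from `x` in at most `n` of the given steps. -/
def StepReach (st : ι → O → O) : ℕ → O → O → Prop
  | 0, x, y => y = x
  | n + 1, x, y => StepReach st n x y ∨ ∃ i, StepReach st n (st i x) y

variable {st : ι → O → O}

theorem StepReach.refl (n : ℕ) (x : O) : StepReach st n x x := by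
  induction n with
  | zero => rfl
  | succ n ih => exact Or.inl ih

theorem StepReach.mono {n m : ℕ} (h : n ≤ m) {x y : O} (H : StepReach st n x y) :
    StepReach st m x y := by
  induction m, h using Nat.le_induction with
  | base => exact H
  | succ m _ ih => exact Or.inl ih

theorem StepReach.trans {n m : ℕ} {x y z : O} (h : StepReach st n x y) (h' : StepReach st m y z) :
    StepReach st (n + m) x z := by
  induction n generalizing x with
  | zero => cases h; simpa using h'
  | succ n ih =>
    rw [Nat.succ_add]
    rcases h with h | ⟨i, h⟩
    · exact Or.inl (ih h)
    · exact Or.inr ⟨i, ih h⟩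

/-- Every step that moves can be undone by a step. -/
def StepSymm (st : ι → O → O) : Prop := ∀ i x, st i x ≠ x → ∃ j, st j (st i x) = x

theorem StepReach.symm (hs : StepSymm st) {n : ℕ} {x y : O} (h : StepReach st n x y) :
    StepReach st n y x := by
  induction n generalizing x with
  | zero => cases h; rfl
  | succ n ih =>
    rcases h with h | ⟨i, h⟩
    · exact Or.inl (ih h)
    · by_cases hi : st i x = x
      · rw [hi] at h; exact Or.inl (ih h)
      · obtain ⟨j, hj⟩ := hs i x hi
        exact (ih h).trans (m := 1) (Or.inr ⟨j, hj.symm⟩)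

/-- A step or no step. -/
def optStep (st : ι → O → O) : Option ι → O → O
  | none, x => x
  | some i, x => st i x

/-- Three optional steps. -/
def word (st : ι → O → O) (κ : Fin 3 → Option ι) (x : O) : O :=
  optStep st (κ 2) (optStep st (κ 1) (optStep st (κ 0) x))

theorem optStep_reach (o : Option ι) (x : O) : StepReach st 1 x (optStep st o x) := by
  cases o with
  | none => exact StepReach.refl _ _
  | some i => exact Or.inr ⟨i, rfl⟩

theorem word_reach (κ : Fin 3 → Option ι) (x : O) : StepReach st 3 x (word st κ x) :=
  ((optStep_reach _ _).trans (m := 1) (optStep_reach _ _)).trans (m := 1) (optStep_reach _ _)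

theorem StepReach.one {x y : O} (h : StepReach st 1 x y) : ∃ o, optStep st o x = y := by
  rcases h with h | ⟨i, h⟩
  · exact ⟨none, Eq.symm h⟩
  · exact ⟨some i, Eq.symm h⟩

theorem StepReach.succ {n : ℕ} {x y : O} (h : StepReach st (n + 1) x y) :
    ∃ o, StepReach st n (optStep st o x) y := by
  rcases h with h | ⟨i, h⟩
  · exact ⟨none, h⟩
  · exact ⟨some i, h⟩

theorem StepReach.word {x y : O} (h : StepReach st 3 x y) : ∃ κ, word st κ x = y := by
  obtain ⟨a, h⟩ := h.succ
  obtain ⟨b, h⟩ := h.succ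
  obtain ⟨c, h⟩ := h.one
  exact ⟨![a, b, c], h⟩

variable [Fintype ι]

open Classical in
theorem exists_numColors (ι : Type*) [Fintype ι] :
    ∃ n, n = Fintype.card ((Fin 3 → Option ι) → Fin 64) := ⟨_, rfl⟩

/-- The number of colours; the choice prevents that this large number is evaluated. -/
noncomputable def numColors (ι : Type*) [Fintype ι] : ℕ := (exists_numColors ι).choose

open Classical in
/-- The product of the colours of the words of length three. -/
noncomputable def wordColor (st : ι → O → O) (c : O → ℕ) (s : ℕ) (x : O) : ℕ :=
  Fintype.equivFin ((Fin 3 → Option ι) → Fin 64)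
    fun κ => Fin.ofNat 64 (cvColor (word st κ) c s x)

theorem wordColor_lt (c : O → ℕ) (s : ℕ) (x : O) : wordColor st c s x < numColors ι := by
  rw [numColors, (exists_numColors ι).choose_spec]
  exact Fin.is_lt _

theorem wordColor_ne {c : O → ℕ} {s : ℕ} (h : ∀ κ x, cvColor (word st κ) c s x < 64)
    {κ : Fin 3 → Option ι} {x : O} (hx : c x ≠ c (word st κ x)) :
    wordColor st c s x ≠ wordColor st c s (word st κ x) := by
  intro H
  simp only [wordColor, Fin.val_inj, EmbeddingLike.apply_eq_iff_eq] at H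
  have h1 := congrArg Fin.val (congrFun H κ)
  simp only [Fin.val_ofNat, Nat.mod_eq_of_lt (h _ _)] at h1
  exact cvColor_ne hx s h1

/-- The objects whose colour is smaller than the colours of all objects at distance at most
three. -/
def Ruling (st : ι → O → O) (c : O → ℕ) (s : ℕ) (x : O) : Prop :=
  ∀ κ, word st κ x ≠ x → wordColor st c s x < wordColor st c s (word st κ x)

/-- Each of two distinct selected objects at distance at most three would have the strictly smaller
colour. -/
theorem Ruling.sep (hs : StepSymm st) {c : O → ℕ} {s : ℕ} {x y : O} (hx : Ruling st c s x)
    (hy : Ruling st c s y) (h : StepReach st 3 x y) : x = y := by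
  by_contra hne
  obtain ⟨κ, rfl⟩ := h.word
  obtain ⟨κ', h'⟩ := (h.symm hs).word
  have h1 := hx κ (Ne.symm hne)
  have h2 := hy κ' (by rw [h']; exact hne)
  rw [h'] at h2
  omega

/-- An object that is not selected has another one within distance three whose colour is not larger,
hence strictly smaller because the colouring is proper at that distance. Iterating lowers the
colour, so at most `numColors ι` moves of length three are made. -/
theorem Ruling.dom {c : O → ℕ} {s : ℕ} (h : ∀ κ x, cvColor (word st κ) c s x < 64)
    (hc : ∀ κ x, word st κ x ≠ x → c x ≠ c (word st κ x)) (x : O) :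
    ∃ m, Ruling st c s m ∧ StepReach st (3 * numColors ι) x m := by
  suffices H : ∀ q x, wordColor st c s x < q → ∃ m, Ruling st c s m ∧ StepReach st (3 * q) x m from
    H _ x (wordColor_lt c s x)
  intro q
  induction q with
  | zero => intro x hx; omega
  | succ q ih =>
    intro x hx
    by_cases hM : Ruling st c s x
    · exact ⟨x, hM, StepReach.refl _ _⟩
    · simp only [Ruling, not_forall, not_lt] at hM
      obtain ⟨κ, hκ, hle⟩ := hM
      have h1 := wordColor_ne h (hc κ x hκ)
      obtain ⟨m, hm, hr⟩ := ih (word st κ x) (by omega)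
      refine ⟨m, hm, ?_⟩
      have := (word_reach κ x).trans hr
      exact this.mono (by omega)

end Ruling

section LocalRuling
variable {ι : Type}

/-- The initial colour of an object. -/
def idColor {V : Type} (ident : V → ℕ) (x : V × ℕ) : ℕ := 2 * ident x.1 + x.2 % 2

theorem idColor_lt {V : Type} [Fintype V] {k : ℕ} {ident : V → ℕ} (h : IsIdentifiers k ident)
    (x : V × ℕ) : idColor ident x < 2 * Fintype.card V ^ k := by
  have := h.2 x.1
  simp only [idColor]
  omega

/-- All steps that move go between objects of index less than two. -/
def StepSmall {V : Type} (st : ι → V × ℕ → V × ℕ) : Prop :=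
  ∀ i x, st i x ≠ x → x.2 < 2 ∧ (st i x).2 < 2

theorem idColor_ne {V : Type} [Fintype V] {k : ℕ} {ident : V → ℕ} (h : IsIdentifiers k ident)
    {x y : V × ℕ} (hx : x.2 < 2) (hy : y.2 < 2) (hxy : x ≠ y) :
    idColor ident x ≠ idColor ident y := by
  intro H
  simp only [idColor] at H
  exact hxy (Prod.ext (h.1 (by omega)) (by omega))

theorem StepSmall.reach {V : Type} {st : ι → V × ℕ → V × ℕ} (hst : StepSmall st) {n : ℕ}
    {x y : V × ℕ} (h : StepReach st n x y) (hxy : y ≠ x) : x.2 < 2 ∧ y.2 < 2 := by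
  induction n generalizing x with
  | zero => exact absurd h hxy
  | succ n ih =>
    rcases h with h | ⟨i, h⟩
    · exact ih h hxy
    · by_cases h1 : st i x = x
      · rw [h1] at h; exact ih h hxy
      · by_cases h2 : y = st i x
        · rw [h2]; exact hst i x h1
        · exact ⟨(hst i x h1).1, (ih h h2).2⟩

theorem ruling_dom [Fintype ι] {V : Type} [Fintype V] {k γ : ℕ} {ident : V → ℕ}
    (h : IsIdentifiers k ident) (hg : Nat.log 2 (Fintype.card V) + 1 ≤ 2 ^ γ) {st : ι → V × ℕ → V × ℕ} (hst : StepSmall st)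
    (x : V × ℕ) : ∃ m, Ruling st (idColor ident) (γ + k + 5) m ∧
      StepReach st (3 * numColors ι) x m := by
  refine Ruling.dom (fun κ x => cvColor_lt_const hg (idColor_lt h) x) (fun κ x hx => ?_) x
  have := hst.reach (word_reach κ x) hx
  exact idColor_ne h this.1 this.2 (Ne.symm hx)

variable {S : ℕ → Type} {k : ℕ} {g : ℕ → ℕ}

theorem LocM.word (hg : ∀ n, 1 ≤ g n) {st : ∀ I : Inst S k, ι → I.V × ℕ → I.V × ℕ}
    (h : ∀ i, LocM g (fun I => st I i)) (κ : Fin 3 → Option ι) :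
    LocM g (fun I => word (st I) κ) := by
  have h1 : ∀ o, LocM g (fun I => optStep (st I) o) := by
    intro o
    cases o with
    | none => exact LocM.id
    | some i => exact h i
  exact LocM.comp (f := fun I x => optStep (st I) (κ 1) (optStep (st I) (κ 0) x))
    (f' := fun I => optStep (st I) (κ 2)) hg
    (LocM.comp (f := fun I x => (optStep (st I) (κ 0) x)) (f' := fun I => optStep (st I) (κ 1)) hg
      (h1 _) (h1 _)) (h1 _)

theorem LocF.ruling [Fintype ι] (hg : ∀ n, 1 ≤ g n) {st : ∀ I : Inst S k, ι → I.V × ℕ → I.V × ℕ}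
    (h : ∀ i, LocM g (fun I => st I i)) :
    LocF g (fun I => Ruling (st I) (idColor I.ident) (g I.size + k + 5)) := by
  have h1 : ∀ κ, LocF g (fun I =>
      cvColor (LocalModel.word (st I) κ) (idColor I.ident) (g I.size + k + 5)) := by
    intro κ
    refine LocF.iterate (c := fun s I => cvColor (LocalModel.word (st I) κ) (idColor I.ident) s)
      (f := fun I => LocalModel.word (st I) κ) (b := fun _ _ => ()) ?_ (LocM.word hg h κ)
      (LocF.const ()) ?_ (fun n => g n + k + 5) (k + 6) ?_
    · exact LocF.tag.map fun p => 2 * p.1 + p.2 % 2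
    · intro s I J x y _ h1 h2
      simp only [cvColor, cvStep, h1, h2]
    · intro n
      have := hg n
      nlinarith
  have h2 : LocF g (fun I => wordColor (st I) (idColor I.ident) (g I.size + k + 5)) := by
    refine (LocF.pi h1).of1 fun I J x y _ _ h => ?_
    simp only [wordColor]
    congr 3
    funext κ
    rw [congrFun h κ]
  refine LocF.forall fun κ => ?_
  have h3 := LocM.word hg h κ
  exact (LocM.eq h3 LocM.id).not.imp (h2.map2 (· < ·) (LocF.read hg h3 h2))

end LocalRuling
end LocalModel

/-! ### Sinkless orientation: closed sets and growth of balls -/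

namespace LocalModel

section Ball
variable {O ι : Type*} [Fintype ι]

open Classical in
/-- The objects reachable in at most `n` steps. -/
noncomputable def reachFinset (st : ι → O → O) : ℕ → O → Finset O
  | 0, x => {x}
  | n + 1, x => reachFinset st n x ∪ Finset.univ.biUnion fun i => reachFinset st n (st i x)

theorem mem_reachFinset {st : ι → O → O} {n : ℕ} {x y : O} :
    y ∈ reachFinset st n x ↔ StepReach st n x y := by
  induction n generalizing x with
  | zero => simp [reachFinset, StepReach]
  | succ n ih => simp [reachFinset, StepReach, ih]

theorem card_reachFinset_le {st : ι → O → O} {n : ℕ} {x : O} :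
    (reachFinset st n x).card ≤ (Fintype.card ι + 1) ^ n := by
  classical
  induction n generalizing x with
  | zero => simp [reachFinset]
  | succ n ih =>
    rw [reachFinset]
    refine (Finset.card_union_le _ _).trans ?_
    have := Finset.card_biUnion_le_card_mul Finset.univ (fun i => reachFinset st n (st i x)) _
      (fun i _ => ih (x := st i x))
    rw [Finset.card_univ] at this
    rw [pow_succ']
    have := ih (x := x)
    linarith

end Ball

/-- Data of a graph in terms of half-edges: `inv` maps a half-edge to the other half, `dem h` says
that `h` belongs to a node with a demand, and then `nd h` is this node; `pt i w` are the three
half-edges of the node `w`. -/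
structure HG (O : Type*) where
  inv : O → O
  dem : O → Prop
  nd : O → O
  isN : O → Prop
  pt : Fin 3 → O → O

/-- The nodes with a demand have exactly three half-edges. -/
structure HG.Cubic {O : Type*} (G : HG O) : Prop where
  inv_inv : ∀ h, G.inv (G.inv h) = h
  inv_ne : ∀ h, G.inv h ≠ h
  pt_inj : ∀ w, G.isN w → Function.Injective fun i => G.pt i w
  dem_pt : ∀ w i, G.isN w → G.dem (G.pt i w)
  nd_pt : ∀ w i, G.isN w → G.nd (G.pt i w) = w
  isN_nd : ∀ h, G.dem h → G.isN (G.nd h)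
  pt_nd : ∀ h, G.dem h → ∃ i, G.pt i (G.nd h) = h

namespace HG
variable {O : Type*}

/-- A half-edge that leads to no demand, or a special half-edge that is directed outwards. -/
def Terminal (G : HG O) (sp out : O → Prop) (h : O) : Prop :=
  (¬ sp h ∧ ¬ G.dem (G.inv h)) ∨ (sp h ∧ out h)

/-- `o` chooses an outgoing half-edge for each node of `T` so that the choices do not collide and
lead to no node outside of `T`. -/
def Closed (G : HG O) (sp out : O → Prop) (T : Set O) (o : O → O) : Prop :=
  ∀ u ∈ T, G.dem (o u) ∧ G.nd (o u) = u ∧ (G.Terminal sp out (o u) ∨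
    (¬ sp (o u) ∧ G.dem (G.inv (o u)) ∧ G.nd (G.inv (o u)) ∈ T ∧
      o (G.nd (G.inv (o u))) ≠ G.inv (o u)))

/-- `u` and `w` are joined by an edge that is not special. -/
def Radj (G : HG O) (sp : O → Prop) (u w : O) : Prop :=
  ∃ h, G.dem h ∧ G.nd h = u ∧ ¬ sp h ∧ G.dem (G.inv h) ∧ G.nd (G.inv h) = w

/-- The ball around `c` after removal of the special edges. -/
def RB (G : HG O) (sp : O → Prop) (c : O) : ℕ → Set O
  | 0 => {c}
  | i + 1 => {w | w ∈ G.RB sp c i ∨ ∃ u ∈ G.RB sp c i, G.Radj sp u w}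

open Classical in
/-- The distance from `c` after removal of the special edges. -/
noncomputable def lv (G : HG O) (sp : O → Prop) (c w : O) : ℕ :=
  if h : ∃ i, w ∈ G.RB sp c i then Nat.find h else 0

/-- `h` leads from `w` to a node that is closer to `c`. -/
def IsPar (G : HG O) (sp : O → Prop) (c w h : O) : Prop :=
  G.dem h ∧ G.nd h = w ∧ ¬ sp h ∧ G.dem (G.inv h) ∧ (∃ i, G.nd (G.inv h) ∈ G.RB sp c i) ∧
    G.lv sp c (G.nd (G.inv h)) + 1 = G.lv sp c w

open Classical in
/-- A half-edge that leads towards `c`. -/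
noncomputable def par (G : HG O) (sp : O → Prop) (c w : O) : O :=
  if h : ∃ h, G.IsPar sp c w h then h.choose else w

/-- The parent of a node. -/
noncomputable def pa (G : HG O) (sp : O → Prop) (c w : O) : O := G.nd (G.inv (G.par sp c w))

/-- A node with a special half-edge. -/
def SpN (G : HG O) (sp : O → Prop) (w : O) : Prop := ∃ h, G.dem h ∧ G.nd h = w ∧ sp h

open Classical in
/-- The step from a node along its `i`-th half-edge. -/
noncomputable def step (G : HG O) (i : Fin 3) (w : O) : O :=
  if G.isN w ∧ G.dem (G.inv (G.pt i w)) then G.nd (G.inv (G.pt i w)) else w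

variable {G : HG O} {sp out : O → Prop} {c : O}

theorem step_symm (hG : G.Cubic) : StepSymm G.step := by
  intro i w hw
  have h : G.isN w ∧ G.dem (G.inv (G.pt i w)) := by
    by_contra h
    exact hw (by rw [step, if_neg h])
  have h1 : G.step i w = G.nd (G.inv (G.pt i w)) := by rw [step, if_pos h]
  obtain ⟨j, hj⟩ := hG.pt_nd _ h.2
  refine ⟨j, ?_⟩
  rw [h1, step, hj, hG.inv_inv, if_pos ⟨hG.isN_nd _ h.2, hG.dem_pt _ _ h.1⟩, hG.nd_pt _ _ h.1]

theorem RB_mono {i j : ℕ} (h : i ≤ j) : G.RB sp c i ⊆ G.RB sp c j := by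
  induction j, h using Nat.le_induction with
  | base => exact subset_rfl
  | succ j _ ih => exact fun w hw => Or.inl (ih hw)

theorem isN_of_mem_RB (hG : G.Cubic) (hc : G.isN c) {i : ℕ} {w : O} (h : w ∈ G.RB sp c i) :
    G.isN w := by
  induction i generalizing w with
  | zero => cases h; exact hc
  | succ i ih =>
    rcases h with h | ⟨u, -, e, -, -, -, h1, rfl⟩
    · exact ih h
    · exact hG.isN_nd _ h1

theorem mem_RB_lv {i : ℕ} {w : O} (h : w ∈ G.RB sp c i) : w ∈ G.RB sp c (G.lv sp c w) := by
  classical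
  have h' : ∃ i, w ∈ G.RB sp c i := ⟨i, h⟩
  rw [lv, dif_pos h']
  exact Nat.find_spec h'

theorem lv_le {i : ℕ} {w : O} (h : w ∈ G.RB sp c i) : G.lv sp c w ≤ i := by
  classical
  have h' : ∃ i, w ∈ G.RB sp c i := ⟨i, h⟩
  rw [lv, dif_pos h']
  exact Nat.find_le h

theorem lv_self : G.lv sp c c = 0 := Nat.le_zero.1 (lv_le (i := 0) rfl)

theorem eq_of_lv_eq_zero {i : ℕ} {w : O} (h : w ∈ G.RB sp c i) (h0 : G.lv sp c w = 0) : w = c := by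
  have := mem_RB_lv h
  rw [h0] at this
  exact this

theorem par_spec (hG : G.Cubic) (hsp : ∀ h, sp (G.inv h) ↔ sp h) {i : ℕ} {w : O}
    (h : w ∈ G.RB sp c i) (hw : w ≠ c) : G.IsPar sp c w (G.par sp c w) := by
  classical
  have hex : ∃ h, G.IsPar sp c w h := by
    have h1 := mem_RB_lv h
    have h2 : G.lv sp c w ≠ 0 := fun h0 => hw (eq_of_lv_eq_zero h h0)
    obtain ⟨l, hl⟩ := Nat.exists_eq_succ_of_ne_zero h2
    rw [hl] at h1
    rcases h1 with h1 | ⟨u, hu, e, he1, he2, he3, he4, he5⟩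
    · have := lv_le h1; omega
    · have h3 : G.nd (G.inv (G.inv e)) = u := by rw [hG.inv_inv, he2]
      refine ⟨G.inv e, he4, he5, by rwa [hsp], by rwa [hG.inv_inv], ⟨l, by rwa [h3]⟩, ?_⟩
      rw [h3]
      have h4 := lv_le hu
      have h5 : w ∈ G.RB sp c (G.lv sp c u + 1) := Or.inr ⟨u, mem_RB_lv hu, e, he1, he2, he3, he4, he5⟩
      have h6 := lv_le h5
      omega
  rw [par, dif_pos hex]
  exact hex.choose_spec

section Tree
variable (hG : G.Cubic) (hsp : ∀ h, sp (G.inv h) ↔ sp h)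
include hG hsp

theorem pa_spec {i : ℕ} {w : O} (h : w ∈ G.RB sp c i) (hw : w ≠ c) :
    G.pa sp c w ∈ G.RB sp c i ∧ G.lv sp c (G.pa sp c w) + 1 = G.lv sp c w := by
  obtain ⟨-, -, -, -, ⟨j, hj⟩, h1⟩ := par_spec hG hsp h hw
  change G.lv sp c (G.pa sp c w) + 1 = _ at h1
  have hm : G.pa sp c w ∈ _ := mem_RB_lv hj
  refine ⟨RB_mono ?_ hm, h1⟩
  have := lv_le h
  change G.lv sp c (G.pa sp c w) ≤ _
  omega

/-- Climb the breadth-first tree from `u` to `c`. A parent that is not yet in the set is added with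
the half-edge that leads down to its child. This does not collide with `o u`: a choice of the parent
half-edge by `u` would be neither terminal nor lead into `T`. -/
theorem Closed.extend {T : Set O} {o : O → O} (hT : G.Closed sp out T o) {R : ℕ}
    (hR : T ⊆ G.RB sp c R) {u : O} (hu : u ∈ T) :
    ∃ T' o', G.Closed sp out T' o' ∧ T' ⊆ G.RB sp c R ∧ c ∈ T' := by
  classical
  induction hl : G.lv sp c u generalizing T o u with
  | zero => exact ⟨T, o, hT, hR, eq_of_lv_eq_zero (hR hu) hl ▸ hu⟩
  | succ l ih =>
    have huc : u ≠ c := by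
      rintro rfl
      rw [lv_self] at hl; omega
    obtain ⟨p1, p2, p3, p4, -, p5⟩ := par_spec hG hsp (hR hu) huc
    obtain ⟨q1, q2⟩ := pa_spec hG hsp (hR hu) huc
    by_cases hp : G.pa sp c u ∈ T
    · exact ih hT hR hp (by omega)
    · have hne : o u ≠ G.par sp c u := by
        intro h
        have h1 := (hT u hu).2.2
        rw [h] at h1
        rcases h1 with (h1 | h1) | h1
        · exact h1.2 p4
        · exact p3 h1.1
        · exact hp h1.2.2.1
      refine ih (T := insert (G.pa sp c u) T)
        (o := Function.update o (G.pa sp c u) (G.inv (G.par sp c u))) ?_ ?_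
        (Set.mem_insert _ _) (by omega)
      · have hup : ∀ v ∈ T, Function.update o (G.pa sp c u) (G.inv (G.par sp c u)) v = o v :=
          fun v hv => Function.update_of_ne (fun h => hp (by rw [← h]; exact hv)) _ _
        rintro v (rfl | hv)
        · rw [Function.update_self, hG.inv_inv, p2]
          refine ⟨p4, rfl, Or.inr ⟨by rwa [hsp], p1, Set.mem_insert_of_mem _ hu, ?_⟩⟩
          rw [hup u hu]; exact hne
        · rw [hup v hv]
          obtain ⟨h1, h2, h3⟩ := hT v hv
          refine ⟨h1, h2, h3.imp_right fun h3 => ⟨h3.1, h3.2.1, Set.mem_insert_of_mem _ h3.2.2.1, ?_⟩⟩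
          rw [hup _ h3.2.2.1]; exact h3.2.2.2
      · exact Set.insert_subset q1 hR

/-- `u` is on the path from `w` to `c`. -/
theorem iterate_pa_spec {R : ℕ} {w : O} (h : w ∈ G.RB sp c R) {i : ℕ} (hi : i ≤ G.lv sp c w) :
    (G.pa sp c)^[i] w ∈ G.RB sp c R ∧ G.lv sp c ((G.pa sp c)^[i] w) + i = G.lv sp c w := by
  induction i with
  | zero => exact ⟨h, rfl⟩
  | succ i ih =>
    obtain ⟨h1, h2⟩ := ih (by omega)
    have hne : (G.pa sp c)^[i] w ≠ c := by
      intro h3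
      rw [h3, lv_self] at h2; omega
    have := pa_spec hG hsp h1 hne
    rw [Function.iterate_succ_apply']
    exact ⟨this.1, by omega⟩

omit hG hsp in
/-- The path from `w` to `c`. -/
def Anc (G : HG O) (sp : O → Prop) (c w : O) : Set O :=
  {u | ∃ i ≤ G.lv sp c w, (G.pa sp c)^[i] w = u}

theorem anc_root {R : ℕ} {w : O} (h : w ∈ G.RB sp c R) : c ∈ G.Anc sp c w := by
  refine ⟨_, le_rfl, ?_⟩
  have := iterate_pa_spec hG hsp h le_rfl
  exact eq_of_lv_eq_zero this.1 (by omega)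

theorem anc_pa {R : ℕ} {w u : O} (h : w ∈ G.RB sp c R) (hu : u ∈ G.Anc sp c w) (huc : u ≠ c) :
    G.pa sp c u ∈ G.Anc sp c w := by
  obtain ⟨i, hi, rfl⟩ := hu
  have h1 := iterate_pa_spec hG hsp h hi
  have h2 := (pa_spec hG hsp h1.1 huc).2
  exact ⟨i + 1, by omega, Function.iterate_succ_apply' _ _ _⟩

theorem anc_child {R : ℕ} {w u : O} (h : w ∈ G.RB sp c R) (hu : u ∈ G.Anc sp c w) (huw : u ≠ w) :
    ∃ a ∈ G.Anc sp c w, a ≠ c ∧ G.pa sp c a = u := by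
  obtain ⟨i, hi, rfl⟩ := hu
  cases i with
  | zero => exact absurd rfl huw
  | succ i =>
    refine ⟨(G.pa sp c)^[i] w, ⟨i, by omega, rfl⟩, ?_, (Function.iterate_succ_apply' _ _ _).symm⟩
    intro h3
    have h1 := iterate_pa_spec hG hsp h (show i ≤ _ by omega)
    rw [h3, lv_self] at h1; omega

theorem anc_mem {R : ℕ} {w u : O} (h : w ∈ G.RB sp c R) (hu : u ∈ G.Anc sp c w) :
    u ∈ G.RB sp c R := by
  obtain ⟨i, hi, rfl⟩ := hu
  exact (iterate_pa_spec hG hsp h hi).1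

/-- An edge outside of the breadth-first search tree closes a cycle. -/
theorem exists_closed_of_cycle {R : ℕ} {h w w' : O} (hw : w ∈ G.RB sp c R) (hw' : w' ∈ G.RB sp c R)
    (h1 : G.dem h) (h2 : G.nd h = w) (h3 : ¬ sp h) (h4 : G.dem (G.inv h)) (h5 : G.nd (G.inv h) = w')
    (h6 : w ≠ c → h ≠ G.par sp c w) (h7 : w' ≠ c → G.inv h ≠ G.par sp c w') :
    ∃ T o, G.Closed sp out T o ∧ T ⊆ G.RB sp c R ∧ w ∈ T := by
  classical
  have hch : ∀ u, ∃ a, u ∈ G.Anc sp c w' → u ≠ w' → a ∈ G.Anc sp c w' ∧ a ≠ c ∧ G.pa sp c a = u := by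
    intro u
    by_cases hu : u ∈ G.Anc sp c w' ∧ u ≠ w'
    · obtain ⟨a, ha⟩ := anc_child hG hsp hw' hu.1 hu.2
      exact ⟨a, fun _ _ => ha⟩
    · exact ⟨u, fun h h' => absurd ⟨h, h'⟩ hu⟩
  choose ch hch using hch
  have hself : ∀ x, x ∈ G.Anc sp c x := fun x => ⟨0, Nat.zero_le _, rfl⟩
  have hmem : ∀ u, u ∈ G.Anc sp c w ∨ u ∈ G.Anc sp c w' → u ∈ G.RB sp c R := by
    rintro u (hu | hu)
    · exact anc_mem hG hsp hw hu
    · exact anc_mem hG hsp hw' hu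
  -- The choices run around the cycle: `w'` crosses the extra edge to `w`, the ancestors of `w` that
  -- are not ancestors of `w'` point up towards `c`, and the proper ancestors of `w'` point down
  -- towards `w'`. The common ancestors above the cycle form a tail that leads into it.
  set o : O → O := fun u => if u = w' then G.inv h else
    if u ∈ G.Anc sp c w' then G.inv (G.par sp c (ch u)) else G.par sp c u with ho
  have o1 : o w' = G.inv h := by simp [ho]
  have o2 : ∀ u, u ≠ w' → u ∈ G.Anc sp c w' → o u = G.inv (G.par sp c (ch u)) := by
    intro u h h'; simp [ho, h, h']
  have o3 : ∀ u, u ∉ G.Anc sp c w' → o u = G.par sp c u := by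
    intro u h'
    have : u ≠ w' := by rintro rfl; exact h' (hself _)
    simp [ho, this, h']
  have croot := anc_root hG hsp hw'
  refine ⟨{u | u ∈ G.Anc sp c w ∨ u ∈ G.Anc sp c w'}, o, ?_, hmem, Or.inl (hself w)⟩
  intro u hu
  by_cases huw : u = w'
  · subst huw
    rw [o1, hG.inv_inv, h2]
    refine ⟨h4, h5, Or.inr ⟨by rwa [hsp], h1, Or.inl (hself w), ?_⟩⟩
    by_cases e1 : w = u
    · rw [e1, o1]; exact hG.inv_ne h
    by_cases e2 : w ∈ G.Anc sp c u
    · rw [o2 w e1 e2]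
      intro e3
      obtain ⟨a1, a2, a3⟩ := hch w e2 e1
      have a4 := par_spec hG hsp (hmem _ (Or.inr a1)) a2
      have e4 : G.par sp c (ch w) = G.inv h := by rw [← e3, hG.inv_inv]
      have e5 : ch w = u := by rw [← a4.2.1, e4, h5]
      rw [e5] at e4 a2
      exact h7 a2 e4.symm
    · rw [o3 w e2]
      exact (h6 fun e3 => e2 (e3 ▸ croot)).symm
  by_cases hua : u ∈ G.Anc sp c w'
  · rw [o2 u huw hua]
    obtain ⟨a1, a2, a3⟩ := hch u hua huw
    have a4 := par_spec hG hsp (hmem _ (Or.inr a1)) a2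
    have a5 := (pa_spec hG hsp (hmem _ (Or.inr a1)) a2).2
    rw [hG.inv_inv, a4.2.1]
    refine ⟨a4.2.2.2.1, a3, Or.inr ⟨by rw [hsp]; exact a4.2.2.1, a4.1, Or.inr a1, ?_⟩⟩
    by_cases e1 : ch u = w'
    · rw [e1, o1]; exact h7 (e1 ▸ a2)
    · rw [o2 _ e1 a1]
      intro e2
      obtain ⟨b1, b2, b3⟩ := hch _ a1 e1
      have b4 := par_spec hG hsp (hmem _ (Or.inr b1)) b2
      have b5 := (pa_spec hG hsp (hmem _ (Or.inr b1)) b2).2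
      have e3 : G.pa sp c (ch u) = ch (ch u) := by rw [pa, ← e2, hG.inv_inv, b4.2.1]
      rw [b3] at b5
      rw [e3] at a5
      omega
  · have huw' : u ∈ G.Anc sp c w := hu.resolve_right hua
    have huc : u ≠ c := fun e => hua (e ▸ croot)
    have a4 := par_spec hG hsp (hmem _ hu) huc
    have a5 := (pa_spec hG hsp (hmem _ hu) huc).2
    rw [o3 u hua]
    refine ⟨a4.1, a4.2.1, Or.inr ⟨a4.2.2.1, a4.2.2.2.1, Or.inl (anc_pa hG hsp hw huw' huc), ?_⟩⟩
    change o (G.pa sp c u) ≠ _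
    by_cases e1 : G.pa sp c u = w'
    · rw [e1, o1]
      intro e2
      have e3 : h = G.par sp c u := by rw [← hG.inv_inv h, e2, hG.inv_inv]
      have e4 : u = w := by rw [← a4.2.1, ← e3, h2]
      rw [e4] at e3 huc
      exact h6 huc e3
    by_cases e2 : G.pa sp c u ∈ G.Anc sp c w'
    · rw [o2 _ e1 e2]
      intro e3
      obtain ⟨b1, b2, b3⟩ := hch _ e2 e1
      have b4 := par_spec hG hsp (hmem _ (Or.inr b1)) b2
      have e4 : G.par sp c (ch (G.pa sp c u)) = G.par sp c u := by
        rw [← hG.inv_inv (G.par sp c (ch _)), e3, hG.inv_inv]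
      have e5 : ch (G.pa sp c u) = u := by rw [← b4.2.1, e4, a4.2.1]
      exact hua (e5 ▸ b1)
    · rw [o3 _ e2]
      intro e3
      have b2 : G.pa sp c u ≠ c := fun e => e2 (by rw [e]; exact croot)
      have b5 := (pa_spec hG hsp (pa_spec hG hsp (hmem _ hu) huc).1 b2).2
      have e4 : G.pa sp c (G.pa sp c u) = u := by
        rw [pa, e3, hG.inv_inv, a4.2.1]
      rw [e4] at b5
      omega

end Tree

section Growth
variable (hG : G.Cubic) (hsp : ∀ h, sp (G.inv h) ↔ sp h) (hc : G.isN c) {R : ℕ}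
  (hU : ∀ T o, G.Closed sp out T o → T ⊆ G.RB sp c R → T = ∅)
include hG hsp hU

/-- If the far side had no demand, `{w}` would be closed; if the edge were not the tree edge of its
far end, it would close a cycle. Hence the ball is a tree, and every other half-edge goes down one
level. -/
theorem child_spec {w h : O} (hw : w ∈ G.RB sp c R) (hl : G.lv sp c w < R) (h1 : G.dem h)
    (h2 : G.nd h = w) (h3 : ¬ sp h) (h4 : w ≠ c → h ≠ G.par sp c w) :
    G.dem (G.inv h) ∧ G.nd (G.inv h) ∈ G.RB sp c R ∧ G.par sp c (G.nd (G.inv h)) = G.inv h ∧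
      G.lv sp c (G.nd (G.inv h)) = G.lv sp c w + 1 := by
  have hd : G.dem (G.inv h) := by
    by_contra hd
    have := hU {w} (fun _ => h) (by
      rintro u rfl
      exact ⟨h1, h2, Or.inl (Or.inl ⟨h3, hd⟩)⟩) (by simpa using hw)
    exact Set.singleton_ne_empty _ this
  have hm : G.nd (G.inv h) ∈ G.RB sp c R :=
    RB_mono (show G.lv sp c w + 1 ≤ R by omega)
      (Or.inr ⟨w, mem_RB_lv hw, h, h1, h2, h3, hd, rfl⟩)
  have hp : G.nd (G.inv h) ≠ c ∧ G.par sp c (G.nd (G.inv h)) = G.inv h := by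
    by_contra hp
    obtain ⟨T, o, hT, hT', hwT⟩ := exists_closed_of_cycle (out := out) hG hsp hw hm h1 h2 h3 hd rfl h4
      (fun e1 e2 => hp ⟨e1, e2.symm⟩)
    have := hU T o hT hT'
    rw [this] at hwT
    exact hwT
  refine ⟨hd, hm, hp.2, ?_⟩
  have := (pa_spec hG hsp hm hp.1).2
  rw [pa, hp.2, hG.inv_inv, h2] at this
  exact this.symm

variable {NS : Finset O} (hNS : ∀ w, G.isN w → w ∈ NS)

omit hG hsp hU in
open Classical in
/-- The nodes at distance `i` from `c`. -/
noncomputable def levelSet (G : HG O) (sp : O → Prop) (c : O) (NS : Finset O) (i : ℕ) : Finset O :=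
  NS.filter fun w => w ∈ G.RB sp c i ∧ G.lv sp c w = i

omit hG hsp hU in
open Classical in
/-- The half-edges of `w` that lead away from `c`. -/
noncomputable def children (G : HG O) (sp : O → Prop) (c w : O) : Finset O :=
  (Finset.univ.image fun i => G.pt i w).filter fun h => ¬ sp h ∧ (w ≠ c → h ≠ G.par sp c w)

/-- Each node has at most one special half-edge. -/
def SpUnique (G : HG O) (sp : O → Prop) : Prop :=
  ∀ h h', G.dem h → G.dem h' → G.nd h = G.nd h' → sp h → sp h' → h = h'

/-- No two neighbours have special half-edges, unless they are the halves of one edge. -/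
def SpSparse (G : HG O) (sp : O → Prop) : Prop :=
  ∀ h, G.dem h → G.dem (G.inv h) → ¬ sp h → G.nd h ≠ G.nd (G.inv h) →
    ¬ (G.SpN sp (G.nd h) ∧ G.SpN sp (G.nd (G.inv h)))

omit hG hsp hU in
theorem mem_children {G : HG O} (hG : G.Cubic) {w h : O} (hw : G.isN w) (hh : h ∈ G.children sp c w) :
    G.dem h ∧ G.nd h = w ∧ ¬ sp h ∧ (w ≠ c → h ≠ G.par sp c w) := by
  classical
  simp only [children, Finset.mem_filter, Finset.mem_image, Finset.mem_univ, true_and] at hh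
  obtain ⟨⟨i, rfl⟩, h1, h2⟩ := hh
  exact ⟨hG.dem_pt _ _ hw, hG.nd_pt _ _ hw, h1, h2⟩

-- Among three half-edges, at most one is special and at most one leads to the parent.
omit hG hsp hU in
open Classical in
theorem card_children {G : HG O} (hG : G.Cubic) (hS : G.SpUnique sp) {w : O} (hw : G.isN w) :
    2 ≤ (G.children sp c w).card + (if G.SpN sp w then 1 else 0) := by
  set A := Finset.univ.image fun i => G.pt i w with hA
  have hAc : A.card = 3 := by
    rw [hA, Finset.card_image_of_injective _ (hG.pt_inj w hw)]; simp
  have hAd : ∀ h ∈ A, G.dem h ∧ G.nd h = w := by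
    intro h hh
    simp only [hA, Finset.mem_image, Finset.mem_univ, true_and] at hh
    obtain ⟨i, rfl⟩ := hh
    exact ⟨hG.dem_pt _ _ hw, hG.nd_pt _ _ hw⟩
  have h1 : A ⊆ G.children sp c w ∪ A.filter sp ∪ {G.par sp c w} := by
    intro h hh
    simp only [children, Finset.mem_union, Finset.mem_filter, Finset.mem_singleton, ← hA]
    tauto
  have h2 : (A.filter sp).card ≤ if G.SpN sp w then 1 else 0 := by
    split_ifs with hs
    · rw [Finset.card_le_one]
      intro a ha b hb
      simp only [Finset.mem_filter] at ha hb
      have ha' := hAd a ha.1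
      have hb' := hAd b hb.1
      exact hS a b ha'.1 hb'.1 (ha'.2.trans hb'.2.symm) ha.2 hb.2
    · rw [Nat.le_zero, Finset.card_eq_zero, Finset.filter_eq_empty_iff]
      exact fun h hh hs' => hs ⟨h, (hAd h hh).1, (hAd h hh).2, hs'⟩
  have h3 := Finset.card_le_card h1
  have h4 := Finset.card_union_le (G.children sp c w ∪ A.filter sp) {G.par sp c w}
  have h5 := Finset.card_union_le (G.children sp c w) (A.filter sp)
  rw [Finset.card_singleton] at h4
  omega

include hNS hc in
theorem levelSet_child {i : ℕ} (hi : i < R) {w h : O} (hw : w ∈ G.levelSet sp c NS i)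
    (hh : h ∈ G.children sp c w) : G.nd (G.inv h) ∈ G.levelSet sp c NS (i + 1) ∧
      G.par sp c (G.nd (G.inv h)) = G.inv h := by
  classical
  simp only [levelSet, Finset.mem_filter] at hw ⊢
  obtain ⟨-, hw1, hw2⟩ := hw
  obtain ⟨h1, h2, h3, h4⟩ := mem_children hG (isN_of_mem_RB hG hc hw1) hh
  obtain ⟨c1, c2, c3, c4⟩ := child_spec hG hsp hU (RB_mono hi.le hw1) (by omega) h1 h2 h3 h4
  have c5 := mem_RB_lv c2
  rw [c4, hw2] at c5
  exact ⟨⟨hNS _ (isN_of_mem_RB hG hc c2), c5, by omega⟩, c3⟩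

-- The far end of a child half-edge determines it, as the mate of the parent half-edge of that end;
-- so different child half-edges have different ends.
include hNS hc in
open Classical in
theorem card_children_le {i : ℕ} (hi : i < R) {W : Finset O} (hW : W ⊆ G.levelSet sp c NS i)
    {L : Finset O} (hL : ∀ w ∈ W, ∀ h ∈ G.children sp c w, G.nd (G.inv h) ∈ L) :
    ∑ w ∈ W, (G.children sp c w).card ≤ L.card := by
  have hN : ∀ w ∈ W, G.isN w := fun w hw => by
    have := hW hw
    simp only [levelSet, Finset.mem_filter] at this
    exact isN_of_mem_RB hG hc this.2.1
  rw [← Finset.card_biUnion]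
  · refine Finset.card_le_card_of_injOn (fun h => G.nd (G.inv h)) ?_ ?_
    · intro h hh
      simp only [Finset.mem_coe, Finset.mem_biUnion] at hh
      obtain ⟨w, hw, hh⟩ := hh
      exact hL w hw h hh
    · intro h hh h' hh' heq
      simp only [Finset.mem_coe, Finset.mem_biUnion] at hh hh'
      obtain ⟨w, hw, hh⟩ := hh
      obtain ⟨w', hw', hh'⟩ := hh'
      have e1 := (levelSet_child hG hsp hc hU hNS hi (hW hw) hh).2
      have e2 := (levelSet_child hG hsp hc hU hNS hi (hW hw') hh').2
      dsimp only at heq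
      rw [heq, e2] at e1
      rw [← hG.inv_inv h, ← e1, hG.inv_inv]
  · intro w hw w' hw' hne
    rw [Function.onFun, Finset.disjoint_left]
    intro h hh hh'
    exact hne ((mem_children hG (hN w hw) hh).2.1.symm.trans (mem_children hG (hN w' hw') hh').2.1)

include hNS hc in
/-- Without closed sets, the ball grows exponentially. -/
theorem two_pow_le_levelSet (hS : G.SpUnique sp) (hS' : G.SpSparse sp) {j : ℕ} (hj : 2 * j ≤ R) :
    2 ^ j ≤ (G.levelSet sp c NS (2 * j)).card := by
  classical
  set n : ℕ → ℕ := fun i => (G.levelSet sp c NS i).card with hn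
  set s : ℕ → ℕ := fun i => ((G.levelSet sp c NS i).filter (G.SpN sp)).card with hs
  have hN : ∀ i, ∀ w ∈ G.levelSet sp c NS i, G.isN w := fun i w hw => by
    simp only [levelSet, Finset.mem_filter] at hw
    exact isN_of_mem_RB hG hc hw.2.1
  have a1 : ∀ i < R, 2 * n i ≤ n (i + 1) + s i := by
    intro i hi
    have h1 := card_children_le hG hsp hc hU hNS hi subset_rfl
      (fun w hw h hh => (levelSet_child hG hsp hc hU hNS hi hw hh).1)
    have h2 : ∑ w ∈ G.levelSet sp c NS i, 2 ≤ ∑ w ∈ G.levelSet sp c NS i,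
        ((G.children sp c w).card + (if G.SpN sp w then 1 else 0)) :=
      Finset.sum_le_sum fun w hw => card_children hG hS (hN i w hw)
    rw [Finset.sum_add_distrib, Finset.sum_const, smul_eq_mul, ← Finset.card_filter] at h2
    have h3 : n i * 2 ≤ (∑ w ∈ G.levelSet sp c NS i, (G.children sp c w).card) + s i := h2
    change _ ≤ n (i + 1) at h1
    omega
  -- Every special node keeps at least one child, and by sparsity its children are not special. So
  -- level `i + 1` has at least `s i` nodes that are not special.
  have a2 : ∀ i < R, s i + s (i + 1) ≤ n (i + 1) := by
    intro i hi
    have h1 := card_children_le hG hsp hc hU hNS hi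
      (W := (G.levelSet sp c NS i).filter (G.SpN sp)) (Finset.filter_subset _ _)
      (L := (G.levelSet sp c NS (i + 1)).filter fun w => ¬ G.SpN sp w) (by
        intro w hw h hh
        rw [Finset.mem_filter] at hw ⊢
        have e1 := levelSet_child hG hsp hc hU hNS hi hw.1 hh
        refine ⟨e1.1, fun e2 => ?_⟩
        obtain ⟨b1, b2, b3, b4⟩ := mem_children hG (hN i w hw.1) hh
        have e3 := e1.1
        have e4 := hw.1
        simp only [levelSet, Finset.mem_filter] at e3 e4
        have b5 := child_spec hG hsp hU (RB_mono hi.le e4.2.1) (by omega) b1 b2 b3 b4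
        refine hS' h b1 b5.1 b3 (fun e => ?_) ⟨b2 ▸ hw.2, e2⟩
        rw [b2] at e
        rw [← e] at e3
        omega)
    have h2 : ∑ w ∈ (G.levelSet sp c NS i).filter (G.SpN sp), 1 ≤
        ∑ w ∈ (G.levelSet sp c NS i).filter (G.SpN sp), (G.children sp c w).card :=
      Finset.sum_le_sum fun w hw => by
        rw [Finset.mem_filter] at hw
        have := card_children (c := c) hG hS (hN i w hw.1)
        rw [if_pos hw.2] at this
        omega
    rw [Finset.sum_const, smul_eq_mul, mul_one] at h2
    have h3 := Finset.card_filter_add_card_filter_not (s := G.levelSet sp c NS (i + 1)) (G.SpN sp)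
    simp only [hn, hs]
    omega
  induction j with
  | zero =>
    have : c ∈ G.levelSet sp c NS 0 := by
      simp only [levelSet, Finset.mem_filter]
      exact ⟨hNS c hc, rfl, lv_self⟩
    simpa using Finset.card_pos.2 ⟨c, this⟩
  | succ j ih =>
    -- With `i = 2 * j`: `n (i + 2) ≥ 2 * n (i + 1) - s (i + 1) ≥ n (i + 1) + s i ≥ 2 * n i`.
    have h0 := ih (by omega)
    have h1 := a1 (2 * j) (by omega)
    have h2 := a1 (2 * j + 1) (by omega)
    have h3 := a2 (2 * j) (by omega)
    change _ ≤ n (2 * j + 1 + 1)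
    change 2 ^ j ≤ n (2 * j) at h0
    rw [pow_succ]
    omega

/-- In every ball without closed sets there is a special edge. -/
theorem exists_special {M : O → Prop}
    (hM : ∀ m, G.isN m → M m →
      G.SpN sp m ∨ G.step 0 m = m ∨ ∃ i, i ≠ 0 ∧ G.step i m = G.step 0 m)
    {D i : ℕ} {w m : O} (hw : w ∈ G.RB sp c i) (hc : G.isN c) (hm : M m)
    (hr : StepReach G.step D w m) (hD : i + D < R) :
    ∃ u ∈ G.RB sp c R, G.SpN sp u ∧ StepReach G.step D w u := by
  classical
  have hstep : ∀ j w, G.isN w → ¬ sp (G.pt j w) → w ∈ G.RB sp c R →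
      G.dem (G.inv (G.pt j w)) := by
    intro j w hwN hns hw
    by_contra hd
    have := hU {w} (fun _ => G.pt j w) (by
      rintro u rfl
      exact ⟨hG.dem_pt _ _ hwN, hG.nd_pt _ _ hwN, Or.inl (Or.inl ⟨hns, hd⟩)⟩) (by simpa using hw)
    exact Set.singleton_ne_empty _ this
  induction D generalizing i w with
  | zero =>
    cases hr
    have hwN := isN_of_mem_RB hG hc hw
    have hwR : m ∈ G.RB sp c R := RB_mono (by omega) hw
    refine ⟨m, hwR, ?_, rfl⟩
    by_contra hns
    have hns' : ∀ j, ¬ sp (G.pt j m) :=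
      fun j hj => hns ⟨_, hG.dem_pt _ _ hwN, hG.nd_pt _ _ hwN, hj⟩
    have hd : ∀ j, G.dem (G.inv (G.pt j m)) := fun j => hstep j m hwN (hns' j) hwR
    have hst : ∀ j, G.step j m = G.nd (G.inv (G.pt j m)) := fun j => by
      rw [step, if_pos ⟨hwN, hd j⟩]
    have hl : G.lv sp c m < R := (lv_le hw).trans_lt (by omega)
    have hch := fun j (h4 : m ≠ c → G.pt j m ≠ G.par sp c m) =>
      child_spec hG hsp hU hwR hl (hG.dem_pt m j hwN) (hG.nd_pt m j hwN) (hns' j) h4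
    have hpar : ∀ j, m ≠ c → G.pt j m = G.par sp c m →
        G.lv sp c (G.nd (G.inv (G.pt j m))) + 1 = G.lv sp c m := by
      intro j hmc hj
      have := (pa_spec hG hsp hwR hmc).2
      rwa [pa, ← hj] at this
    -- A selected node without special half-edge has a zeroth step that stays put or coincides with
    -- another of its steps. A loop or a parallel edge contradicts the tree structure, as seen from
    -- levels or from uniqueness of parent half-edges.
    rcases (hM m hwN hm).resolve_left hns with h0 | ⟨j, hj, h0⟩
    · rw [hst] at h0
      by_cases h4 : m ≠ c → G.pt 0 m ≠ G.par sp c m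
      · have := (hch 0 h4).2.2.2
        rw [h0] at this; omega
      · push Not at h4
        have := hpar 0 h4.1 h4.2
        rw [h0] at this; omega
    · rw [hst, hst] at h0
      by_cases h4 : m ≠ c → G.pt 0 m ≠ G.par sp c m
      · by_cases h5 : m ≠ c → G.pt j m ≠ G.par sp c m
        · have e1 := (hch 0 h4).2.2.1
          have e2 := (hch j h5).2.2.1
          rw [h0, e1] at e2
          have e3 : G.pt 0 m = G.pt j m := by rw [← hG.inv_inv (G.pt 0 m), e2, hG.inv_inv]
          exact hj (hG.pt_inj m hwN e3).symm
        · push Not at h5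
          have e1 := hpar j h5.1 h5.2
          have e2 := (hch 0 h4).2.2.2
          rw [h0] at e1; omega
      · push Not at h4
        by_cases h5 : m ≠ c → G.pt j m ≠ G.par sp c m
        · have e1 := hpar 0 h4.1 h4.2
          have e2 := (hch j h5).2.2.2
          rw [h0] at e2; omega
        · push Not at h5
          exact hj (hG.pt_inj m hwN (h5.2.trans h4.2.symm))
  | succ D ih =>
    rcases hr with hr | ⟨j, hr⟩
    · obtain ⟨u, h1, h2, h3⟩ := ih hw hr (by omega)
      exact ⟨u, h1, h2, Or.inl h3⟩
    · by_cases hj : G.step j w = w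
      · rw [hj] at hr
        obtain ⟨u, h1, h2, h3⟩ := ih hw hr (by omega)
        exact ⟨u, h1, h2, Or.inl h3⟩
      · have hwN := isN_of_mem_RB hG hc hw
        have hd : G.dem (G.inv (G.pt j w)) := by
          by_contra hd
          exact hj (by rw [step, if_neg fun h => hd h.2])
        by_cases hs : sp (G.pt j w)
        -- The route to `m` leaves the ball only by crossing a special edge, and then its near end
        -- already serves.
        · exact ⟨w, RB_mono (by omega) hw, ⟨_, hG.dem_pt _ _ hwN, hG.nd_pt _ _ hwN, hs⟩,
            StepReach.refl _ _⟩
        · have hst : G.step j w = G.nd (G.inv (G.pt j w)) := by rw [step, if_pos ⟨hwN, hd⟩]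
          have : G.step j w ∈ G.RB sp c (i + 1) :=
            Or.inr ⟨w, hw, _, hG.dem_pt _ _ hwN, hG.nd_pt _ _ hwN, hs, hd, hst.symm⟩
          obtain ⟨u, h1, h2, h3⟩ := ih this hr (by omega)
          exact ⟨u, h1, h2, Or.inr ⟨j, h3⟩⟩

-- All nodes on level `2 * j` are within `D` steps of special nodes of the ball, and at most `4 ^ D`
-- nodes are that close to a given one: each step is one of three or none.
include hNS hc in
open Classical in
theorem two_pow_le_card_special (hS : G.SpUnique sp) (hS' : G.SpSparse sp) {M : O → Prop}
    (hM : ∀ m, G.isN m → M m →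
      G.SpN sp m ∨ G.step 0 m = m ∨ ∃ i, i ≠ 0 ∧ G.step i m = G.step 0 m)
    {D : ℕ} (hdom : ∀ w, ∃ m, M m ∧ StepReach G.step D w m) {j : ℕ} (hj : 2 * j + D < R) :
    2 ^ j ≤ 4 ^ D * (NS.filter fun u => u ∈ G.RB sp c R ∧ G.SpN sp u).card := by
  refine (two_pow_le_levelSet hG hsp hc hU hNS hS hS' (by omega)).trans ?_
  have h1 : G.levelSet sp c NS (2 * j) ⊆
      (NS.filter fun u => u ∈ G.RB sp c R ∧ G.SpN sp u).biUnion (reachFinset G.step D) := by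
    intro w hw
    simp only [levelSet, Finset.mem_filter] at hw
    obtain ⟨m, hm, hr⟩ := hdom w
    obtain ⟨u, hu1, hu2, hu3⟩ := exists_special hG hsp hU hM hw.2.1 hc hm hr hj
    simp only [Finset.mem_biUnion, Finset.mem_filter]
    exact ⟨u, ⟨hNS u (isN_of_mem_RB hG hc hu1), hu1, hu2⟩,
      mem_reachFinset.2 (hu3.symm (step_symm hG))⟩
  refine (Finset.card_le_card h1).trans ?_
  rw [mul_comm]
  refine Finset.card_biUnion_le_card_mul _ _ _ fun u _ => ?_
  simpa using card_reachFinset_le (st := G.step) (n := D) (x := u)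

end Growth
end HG
end LocalModel

/-! ### Special edges directed by coins -/

namespace LocalModel
namespace HG
variable {O : Type*}

/-- The node `m` is selected by `M` and proposes its zeroth half-edge as a special one. -/
def Spm (G : HG O) (M : O → Prop) (m : O) : Prop :=
  G.isN m ∧ M m ∧ G.step 0 m ≠ m ∧ ∀ i, i ≠ 0 → G.step i m ≠ G.step 0 m

/-- The half-edge that a selected node proposes. -/
def own (G : HG O) (M : O → Prop) (h : O) : Prop :=
  G.dem h ∧ G.Spm M (G.nd h) ∧ h = G.pt 0 (G.nd h)

/-- The special half-edges. -/
def spD (G : HG O) (M : O → Prop) (h : O) : Prop := G.own M h ∨ G.own M (G.inv h)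

/-- The special half-edges that the coins of the selected nodes direct outwards. -/
def outD (G : HG O) (M coin : O → Prop) (h : O) : Prop :=
  (G.own M h ∧ coin (G.nd h)) ∨ (¬ G.own M h ∧ ¬ coin (G.nd (G.inv h)))

variable {G : HG O} {M coin : O → Prop}

theorem own_step {h : O} (h1 : G.own M h) :
    G.dem (G.inv h) ∧ G.step 0 (G.nd h) = G.nd (G.inv h) ∧ G.nd (G.inv h) ≠ G.nd h := by
  obtain ⟨hd, ⟨hN, hM, hs, -⟩, hp⟩ := h1
  have hd' : G.dem (G.inv (G.pt 0 (G.nd h))) := by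
    by_contra hn
    exact hs (by rw [step, if_neg fun h => hn h.2])
  have : G.step 0 (G.nd h) = G.nd (G.inv h) := by
    rw [step, if_pos ⟨hN, hd'⟩, ← hp]
  rw [← hp] at hd'
  exact ⟨hd', this, this ▸ hs⟩

theorem spD_inv (hG : G.Cubic) (h : O) : G.spD M (G.inv h) ↔ G.spD M h := by
  rw [spD, spD, hG.inv_inv, or_comm]

theorem step_of_dart (hG : G.Cubic) {h : O} (h1 : G.dem h) (h2 : G.dem (G.inv h)) :
    ∃ i, G.pt i (G.nd h) = h ∧ G.step i (G.nd h) = G.nd (G.inv h) := by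
  obtain ⟨i, hi⟩ := hG.pt_nd h h1
  refine ⟨i, hi, ?_⟩
  rw [step, hi, if_pos ⟨hG.isN_nd h h1, h2⟩]

theorem reach_step (i : Fin 3) (w : O) : StepReach G.step 1 w (G.step i w) := Or.inr ⟨i, rfl⟩

section Sep
variable (hG : G.Cubic) (hsep : ∀ x y, M x → M y → StepReach G.step 3 x y → x = y)
include hG hsep

omit hG in
theorem not_own_inv {h : O} (h1 : G.own M h) : ¬ G.own M (G.inv h) := by
  intro h2
  obtain ⟨-, h4, h5⟩ := own_step h1
  exact h5 (hsep _ _ h1.2.1.2.1 h2.2.1.2.1 (by rw [← h4]; exact (reach_step _ _).mono (by omega))).symm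

/-- By separation exactly one half of a special edge is owned, and its owner's coin directs both
halves. -/
theorem outD_inv {h : O} (hs : G.spD M h) : G.outD M coin (G.inv h) ↔ ¬ G.outD M coin h := by
  have e := hG.inv_inv h
  rcases hs with hs | hs
  · have := not_own_inv hsep hs
    simp [outD, hs, this, e]
  · have := not_own_inv hsep hs
    rw [e] at this
    simp [outD, hs, this, e]

theorem spUnique_spD : G.SpUnique (G.spD M) := by
  intro h h' hd hd' hn hs hs'
  rcases hs with hs | hs <;> rcases hs' with hs' | hs'
  · rw [hs.2.2, hs'.2.2, hn]
  · obtain ⟨-, h4, h5⟩ := own_step hs'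
    rw [hG.inv_inv] at h4 h5
    exact absurd (hsep _ _ hs'.2.1.2.1 hs.2.1.2.1 (by
      rw [hn, ← h4]; exact (reach_step _ _).mono (by omega))) (by rw [hn]; exact h5.symm)
  · obtain ⟨-, h4, h5⟩ := own_step hs
    rw [hG.inv_inv] at h4 h5
    exact absurd (hsep _ _ hs.2.1.2.1 hs'.2.1.2.1 (by
      rw [← hn, ← h4]; exact (reach_step _ _).mono (by omega))) (by rw [← hn]; exact h5.symm)
  · obtain ⟨-, h4, -⟩ := own_step hs
    obtain ⟨-, h4', -⟩ := own_step hs'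
    rw [hG.inv_inv] at h4 h4'
    have h6 : StepReach G.step 1 (G.nd (G.inv h)) (G.nd h) := h4 ▸ reach_step _ _
    have h6' : StepReach G.step 1 (G.nd (G.inv h')) (G.nd h') := h4' ▸ reach_step _ _
    rw [← hn] at h6'
    have := hsep _ _ hs.2.1.2.1 hs'.2.1.2.1
      ((h6.trans (h6'.symm (step_symm hG))).mono (by omega))
    have h7 : G.inv h = G.inv h' := by rw [hs.2.2, hs'.2.2, this]
    rw [← hG.inv_inv h, h7, hG.inv_inv]

omit hsep in
theorem spN_owner {u : O} (h : G.SpN (G.spD M) u) :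
    ∃ m, G.Spm M m ∧ (u = m ∨ u = G.step 0 m) := by
  obtain ⟨e, hd, rfl, hs | hs⟩ := h
  · exact ⟨_, hs.2.1, Or.inl rfl⟩
  · refine ⟨_, hs.2.1, Or.inr ?_⟩
    rw [(own_step hs).2.1, hG.inv_inv]

/-- Both ends of the edge are within one step of the owner of their special edge, so the owners are
at distance at most three and coincide; this is what separation three is for. The edge then is a
loop, is the special edge itself or is parallel to it, and all of this is excluded. -/
theorem spSparse_spD : G.SpSparse (G.spD M) := by
  rintro h hd hd' hs hne ⟨hu, hw⟩
  obtain ⟨m, hm, hum⟩ := spN_owner hG hu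
  obtain ⟨m', hm', hwm⟩ := spN_owner hG hw
  obtain ⟨i, hi, hi'⟩ := step_of_dart hG hd hd'
  obtain ⟨j, hj, hj'⟩ := step_of_dart hG hd' (by rwa [hG.inv_inv])
  rw [hG.inv_inv] at hj'
  have r0 : ∀ m u : O, (u = m ∨ u = G.step 0 m) → StepReach G.step 1 m u := by
    rintro m u (rfl | rfl)
    · exact StepReach.refl _ _
    · exact reach_step _ _
  have r1 : StepReach G.step 1 (G.nd h) (G.nd (G.inv h)) := hi' ▸ reach_step _ _
  have e := hsep m m' hm.2.1 hm'.2.1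
    (((r0 m _ hum).trans r1).trans ((r0 m' _ hwm).symm (step_symm hG)))
  subst e
  rcases hum with e1 | e1 <;> rcases hwm with e2 | e2
  · exact hne (e1.trans e2.symm)
  · rw [← e1] at hm e2
    by_cases hi0 : i = 0
    · subst hi0
      exact hs (Or.inl ⟨hd, hm, hi.symm⟩)
    · exact hm.2.2.2 i hi0 (hi'.trans e2)
  · rw [← e2] at hm e1
    by_cases hj0 : j = 0
    · subst hj0
      exact hs (Or.inr ⟨hd', hm, hj.symm⟩)
    · exact hm.2.2.2 j hj0 (hj'.trans e1)
  · exact hne (e1.trans e2.symm)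

omit hsep in
theorem own_of_spm {m : O} (hm : G.Spm M m) : G.own M (G.pt 0 m) := by
  refine ⟨hG.dem_pt _ _ hm.1, ?_, ?_⟩ <;> rw [hG.nd_pt _ _ hm.1]
  exact hm

omit hsep in
theorem spN_or (m : O) (hN : G.isN m) (hm : M m) :
    G.SpN (G.spD M) m ∨ G.step 0 m = m ∨ ∃ i, i ≠ 0 ∧ G.step i m = G.step 0 m := by
  by_cases h : G.Spm M m
  · exact Or.inl ⟨_, hG.dem_pt _ _ hN, hG.nd_pt _ _ hN, Or.inl (own_of_spm hG h)⟩
  · by_contra! H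
    exact h ⟨hN, hm, H.2.1, H.2.2⟩

omit hG hsep in
open Classical in
/-- The selected nodes whose special edges touch the ball around `c`. -/
noncomputable def touched (G : HG O) (M : O → Prop) (NS : Finset O) (R : ℕ) (c : O) : Finset O :=
  NS.filter fun m => G.Spm M m ∧ (m ∈ G.RB (G.spD M) c R ∨ G.step 0 m ∈ G.RB (G.spD M) c R)

variable {c : O} {R : ℕ} {NS : Finset O} (hNS : ∀ w, G.isN w → w ∈ NS)
  (hU : ∀ T o, G.Closed (G.spD M) (G.outD M coin) T o → T ⊆ G.RB (G.spD M) c R → T = ∅)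

-- A node of the ball with a special half-edge directed outwards would be closed by itself. So every
-- special edge that touches the ball points into it; which coin value this means depends only on
-- the side on which the owner lies, not on the coins.
include hU in
theorem coin_of_mem_touched {m : O} (hm : m ∈ G.touched M NS R c) :
    coin m ↔ m ∉ G.RB (G.spD M) c R := by
  classical
  simp only [touched, Finset.mem_filter] at hm
  obtain ⟨-, hm, hR⟩ := hm
  have hout : ∀ h, G.dem h → G.nd h ∈ G.RB (G.spD M) c R → G.spD M h → ¬ G.outD M coin h := by
    intro h h1 h2 h3 h4
    have := hU {G.nd h} (fun _ => h) (by
      rintro u rfl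
      exact ⟨h1, rfl, Or.inl (Or.inr ⟨h3, h4⟩)⟩) (by simpa using h2)
    exact Set.singleton_ne_empty _ this
  have hown := own_of_spm hG hm
  have hnd := hG.nd_pt m 0 hm.1
  by_cases hmR : m ∈ G.RB (G.spD M) c R
  · have := hout _ (hG.dem_pt m 0 hm.1) (by rwa [hnd]) (Or.inl hown)
    simp only [hmR, not_true, iff_false]
    exact fun hc => this (Or.inl ⟨hown, by rwa [hnd]⟩)
  · simp only [hmR, not_false_iff, iff_true]
    obtain ⟨h1, h2, -⟩ := own_step hown
    have h3 := hR.resolve_left hmR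
    rw [hnd] at h2
    have := hout _ h1 (by rwa [← h2]) (Or.inr (by rwa [hG.inv_inv]))
    by_contra hc
    exact this (Or.inr ⟨not_own_inv hsep hown, by rwa [hG.inv_inv, hnd]⟩)

-- A special node is an owner or the far end of an owner's edge, which accounts for the factor 2.
include hNS hU in
theorem two_pow_le_card_touched (hc : G.isN c) {D : ℕ}
    (hdom : ∀ w, ∃ m, M m ∧ StepReach G.step D w m) {j : ℕ} (hj : 2 * j + D < R) :
    2 ^ j ≤ 4 ^ D * (2 * (G.touched M NS R c).card) := by
  classical
  refine (two_pow_le_card_special hG (spD_inv hG) hc hU hNS (spUnique_spD hG hsep)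
    (spSparse_spD hG hsep) (spN_or hG) hdom hj).trans (Nat.mul_le_mul_left _ ?_)
  have h1 : (NS.filter fun u => u ∈ G.RB (G.spD M) c R ∧ G.SpN (G.spD M) u) ⊆
      G.touched M NS R c ∪ (G.touched M NS R c).image (G.step 0) := by
    intro u hu
    simp only [Finset.mem_filter] at hu
    obtain ⟨m, hm, h2⟩ := spN_owner hG hu.2.2
    rw [Finset.mem_union, Finset.mem_image]
    rcases h2 with rfl | rfl
    · exact Or.inl (Finset.mem_filter.2 ⟨hu.1, hm, Or.inl hu.2.1⟩)
    · exact Or.inr ⟨m, Finset.mem_filter.2 ⟨hNS m hm.1, hm, Or.inr hu.2.1⟩, rfl⟩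
  have h2 := Finset.card_le_card h1
  have h3 := Finset.card_union_le (G.touched M NS R c) ((G.touched M NS R c).image (G.step 0))
  have h4 := Finset.card_image_le (s := G.touched M NS R c) (f := G.step 0)
  omega

end Sep

/-- Without special edges, the growth of a ball without closed sets would exceed the total number of
nodes. -/
theorem exists_closed_of_card (hG : G.Cubic) {out : O → Prop} {c : O} (hc : G.isN c)
    {NS : Finset O} (hNS : ∀ w, G.isN w → w ∈ NS) {j R : ℕ} (hj : 2 * j ≤ R)
    (hcard : NS.card < 2 ^ j) :
    ¬ ∀ T o, G.Closed (fun _ => False) out T o → T ⊆ G.RB (fun _ => False) c R → T = ∅ := by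
  classical
  intro hU
  have := two_pow_le_levelSet hG (sp := fun _ => False) (by simp) hc hU hNS
    (fun _ _ _ _ _ h => h.elim) (fun _ _ _ _ _ ⟨⟨_, _, _, h⟩, _⟩ => h) hj
  have h2 : (G.levelSet (fun _ => False) c NS (2 * j)).card ≤ NS.card :=
    Finset.card_le_card (Finset.filter_subset _ _)
  omega

theorem spD_false (G : HG O) : G.spD (fun _ => False) = fun _ => False := by
  funext h
  simp [spD, own, Spm]

/-- Every ball that contains a closed set at all contains one that covers the centre. -/
theorem exists_closed_cover (hG : G.Cubic) {sp out : O → Prop} (hsp : ∀ h, sp (G.inv h) ↔ sp h)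
    {c : O} {R : ℕ}
    (hU : ¬ ∀ T o, G.Closed sp out T o → T ⊆ G.RB sp c R → T = ∅) :
    ∃ T o, G.Closed sp out T o ∧ T ⊆ G.RB sp c R ∧ c ∈ T := by
  push Not at hU
  obtain ⟨T, o, h1, h2, u, hu⟩ := hU
  exact Closed.extend hG hsp h1 h2 hu

end HG
end LocalModel

/-! ### Reconciling the closed sets proposed by different centres -/

namespace LocalModel

/-- What is recorded about a half-edge `h`: its tag, its node, the same for the other half,
and its state. -/
structure DartRecord where
  id : ℕ × ℕ
  nd : ℕ × ℕ
  inv : ℕ × ℕ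
  ndi : ℕ × ℕ
  dem : Prop
  demi : Prop
  sp : Prop
  out : Prop

/-- The analogue of `HG.Closed` for records. -/
def RecClosed (D : Set DartRecord) (T : Set (ℕ × ℕ)) (o : ℕ × ℕ → ℕ × ℕ) : Prop :=
  ∀ u ∈ T, ∃ r ∈ D, r.dem ∧ r.id = o u ∧ r.nd = u ∧ (((¬ r.sp ∧ ¬ r.demi) ∨ (r.sp ∧ r.out)) ∨
    (¬ r.sp ∧ r.demi ∧ r.ndi ∈ T ∧ o r.ndi ≠ r.inv))

open Classical in
/-- A closed set that covers `t`, if there is one. -/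
noncomputable def pickClosed (D : Set DartRecord) (t : ℕ × ℕ) :
    Set (ℕ × ℕ) × (ℕ × ℕ → ℕ × ℕ) :=
  if h : ∃ p : Set (ℕ × ℕ) × (ℕ × ℕ → ℕ × ℕ), t ∈ p.1 ∧ RecClosed D p.1 p.2 then h.choose
  else (∅, fun _ => 0)

theorem pickClosed_closed (D : Set DartRecord) (t : ℕ × ℕ) :
    RecClosed D (pickClosed D t).1 (pickClosed D t).2 := by
  rw [pickClosed]
  split_ifs with h
  · exact h.choose_spec.2
  · simp [RecClosed]

theorem mem_pickClosed {D : Set DartRecord} {t : ℕ × ℕ} {T : Set (ℕ × ℕ)} {o : ℕ × ℕ → ℕ × ℕ}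
    (ht : t ∈ T) (h : RecClosed D T o) : t ∈ (pickClosed D t).1 := by
  have h : ∃ p : Set (ℕ × ℕ) × (ℕ × ℕ → ℕ × ℕ), t ∈ p.1 ∧ RecClosed D p.1 p.2 := ⟨(T, o), ht, h⟩
  rw [pickClosed, dif_pos h]
  exact h.choose_spec.1

/-- A linear order on tags. -/
def tagKey (t : ℕ × ℕ) : ℕ := Nat.pair t.1 t.2

theorem tagKey_inj {s t : ℕ × ℕ} : tagKey s = tagKey t ↔ s = t := by
  simp [tagKey, Nat.pair_eq_pair, Prod.ext_iff]

/-- A proposal: the tag of a centre with a closed set and its choice of half-edges. -/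
abbrev Proposal := (ℕ × ℕ) × (Set (ℕ × ℕ) × (ℕ × ℕ → ℕ × ℕ))

/-- `p` is the proposal for `t` whose centre is smallest. -/
def IsBest (P : Set Proposal) (t : ℕ × ℕ) (p : Proposal) : Prop :=
  p ∈ P ∧ t ∈ p.2.1 ∧ ∀ q ∈ P, t ∈ q.2.1 → tagKey p.1 ≤ tagKey q.1

theorem exists_isBest {P : Set Proposal} {t : ℕ × ℕ} {p : Proposal} (hp : p ∈ P) (ht : t ∈ p.2.1) :
    ∃ q, IsBest P t q := by
  obtain ⟨q, hq, hmin⟩ := (measure fun q : Proposal => tagKey q.1).wf.has_min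
    {q | q ∈ P ∧ t ∈ q.2.1} ⟨p, hp, ht⟩
  exact ⟨q, hq.1, hq.2, fun r hr hr' => not_lt.1 (hmin r ⟨hr, hr'⟩)⟩

section
variable {S : ℕ → Type} {k : ℕ}

/-- The record of `h`. -/
def HG.record (I : Inst S k) (G : HG (I.V × ℕ)) (sp out : I.V × ℕ → Prop) (h : I.V × ℕ) :
    DartRecord where
  id := I.tag h
  nd := I.tag (G.nd h)
  inv := I.tag (G.inv h)
  ndi := I.tag (G.nd (G.inv h))
  dem := G.dem h
  demi := G.dem (G.inv h)
  sp := sp h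
  out := out h

/-- The records of the half-edges hosted within distance `r`. -/
def HG.records (I : Inst S k) (G : HG (I.V × ℕ)) (sp out : I.V × ℕ → Prop) (r : ℕ)
    (c : I.V × ℕ) : Set DartRecord :=
  {z | ∃ u j, I.N.Within r c.1 u ∧ z = G.record I sp out (u, j)}

/-- The proposals of the centres within distance `r'`. -/
def HG.proposals (I : Inst S k) (G : HG (I.V × ℕ)) (sp out : I.V × ℕ → Prop) (r r' : ℕ)
    (w : I.V × ℕ) : Set Proposal :=
  {z | ∃ u j, I.N.Within r' w.1 u ∧
    z = (I.tag (u, j), pickClosed (G.records I sp out r (u, j)) (I.tag (u, j)))}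

/-- The best proposal for the node of `h` chooses `h`. -/
def HG.Chosen (I : Inst S k) (G : HG (I.V × ℕ)) (sp out : I.V × ℕ → Prop) (r r' : ℕ)
    (h : I.V × ℕ) : Prop :=
  G.dem h ∧ ∃ p, IsBest (G.proposals I sp out r r' (G.nd h)) (I.tag (G.nd h)) p ∧
    p.2.2 (I.tag (G.nd h)) = I.tag h

/-- The orientation: chosen half-edges are outgoing, the other edges are directed by tags. -/
def HG.sol (I : Inst S k) (G : HG (I.V × ℕ)) (sp out : I.V × ℕ → Prop) (r r' : ℕ)
    (h : I.V × ℕ) : Prop :=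
  G.Chosen I sp out r r' h ∨ (¬ G.Chosen I sp out r r' (G.inv h) ∧
    tagKey (I.tag h) < tagKey (I.tag (G.inv h)))

section
variable {I : Inst S k} {G : HG (I.V × ℕ)} {sp out : I.V × ℕ → Prop} {r r' K : ℕ}

/-- A set picked from records contains only nodes of recorded half-edges, hence only nodes near its
centre. So every node knows all proposals that cover it. -/
theorem proposal_mem (hnd : ∀ h, I.N.Within K h.1 (G.nd h).1) (hr : r + K ≤ r')
    {c w : I.V × ℕ} (h : I.tag w ∈ (pickClosed (G.records I sp out r c) (I.tag c)).1) :
    (I.tag c, pickClosed (G.records I sp out r c) (I.tag c)) ∈ G.proposals I sp out r r' w := by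
  obtain ⟨ρ, ⟨u, j, hu, rfl⟩, -, -, h3, -⟩ := pickClosed_closed _ _ _ h
  refine ⟨c.1, c.2, ?_, rfl⟩
  have h4 : G.nd (u, j) = w := I.tag_inj.1 h3
  have h5 := hnd (u, j)
  rw [h4] at h5
  exact ((hu.trans h5).symm).mono hr

/-- A terminal choice excludes a choice of the other half. If neither choice is terminal, each end
of the edge belongs to the closed set used by the other end; minimality of both centres makes them
equal, and within one closed set choices do not collide. -/
theorem not_chosen_both (hG : G.Cubic) (hnd : ∀ h, I.N.Within K h.1 (G.nd h).1) (hr : r + K ≤ r')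
    (hsp : ∀ h, sp (G.inv h) ↔ sp h) (hout : ∀ h, sp h → (out (G.inv h) ↔ ¬ out h)) {h : I.V × ℕ}
    (h1 : G.Chosen I sp out r r' h) : ¬ G.Chosen I sp out r r' (G.inv h) := by
  have key : ∀ h, G.Chosen I sp out r r' h → ∃ c,
      IsBest (G.proposals I sp out r r' (G.nd h)) (I.tag (G.nd h))
        (I.tag c, pickClosed (G.records I sp out r c) (I.tag c)) ∧
      (pickClosed (G.records I sp out r c) (I.tag c)).2 (I.tag (G.nd h)) = I.tag h ∧
      ((¬ sp h ∧ ¬ G.dem (G.inv h)) ∨ (sp h ∧ out h) ∨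
        (¬ sp h ∧ I.tag (G.nd (G.inv h)) ∈ (pickClosed (G.records I sp out r c) (I.tag c)).1 ∧
          (pickClosed (G.records I sp out r c) (I.tag c)).2 (I.tag (G.nd (G.inv h))) ≠
            I.tag (G.inv h))) := by
    rintro h ⟨-, p, hp, hp'⟩
    obtain ⟨u, j, -, rfl⟩ := hp.1
    refine ⟨(u, j), hp, hp', ?_⟩
    obtain ⟨ρ, ⟨u', j', -, rfl⟩, -, h2, -, h4⟩ := pickClosed_closed _ _ _ hp.2.1
    have h5 : I.tag (u', j') = I.tag h := h2.trans hp'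
    rw [I.tag_inj] at h5
    rw [h5] at h4
    rcases h4 with (h4 | h4) | h4
    · exact Or.inl h4
    · exact Or.inr (Or.inl h4)
    · exact Or.inr (Or.inr ⟨h4.1, h4.2.2⟩)
  intro h2
  have e := hG.inv_inv h
  obtain ⟨c, b1, b2, b3⟩ := key h h1
  obtain ⟨c', d1, d2, d3⟩ := key _ h2
  rw [e, hsp] at d3
  rcases b3 with b3 | b3 | b3
  · exact b3.2 h2.1
  · rcases d3 with d3 | d3 | d3
    · exact d3.1 b3.1
    · exact (hout h b3.1).1 d3.2 b3.2
    · exact d3.1 b3.1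
  · rcases d3 with d3 | d3 | d3
    · exact d3.2 h1.1
    · exact b3.1 d3.1
    · have i1 := d1.2.2 _ (proposal_mem hnd hr b3.2.1) b3.2.1
      have i2 := b1.2.2 _ (proposal_mem hnd hr d3.2.1) d3.2.1
      have i3 : c = c' := I.tag_inj.1 (tagKey_inj.1 (le_antisymm i2 i1))
      subst i3
      exact b3.2.2 d2

theorem sol_inv (hG : G.Cubic) (hnd : ∀ h, I.N.Within K h.1 (G.nd h).1) (hr : r + K ≤ r')
    (hsp : ∀ h, sp (G.inv h) ↔ sp h) (hout : ∀ h, sp h → (out (G.inv h) ↔ ¬ out h)) (h : I.V × ℕ) :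
    G.sol I sp out r r' (G.inv h) ↔ ¬ G.sol I sp out r r' h := by
  have h1 := not_chosen_both (h := h) hG hnd hr hsp hout
  have h2 : tagKey (I.tag h) ≠ tagKey (I.tag (G.inv h)) := by
    rw [Ne, tagKey_inj, I.tag_inj]
    exact (hG.inv_ne h).symm
  simp only [HG.sol, hG.inv_inv]
  by_cases c1 : G.Chosen I sp out r r' h
  · have := h1 c1
    simp [c1, this]
  · by_cases c2 : G.Chosen I sp out r r' (G.inv h)
    · simp [c1, c2]
    · simp only [c1, c2, false_or, not_false_iff, true_and]
      omega

/-- A closed set that covers `w` guarantees some proposal for `w`. The best proposal may be another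
one, but it is closed too and therefore chooses a half-edge of `w`. -/
theorem exists_sol (hG : G.Cubic) {w : I.V × ℕ} {T : Set (I.V × ℕ)} {o : I.V × ℕ → I.V × ℕ}
    (hT : G.Closed sp out T o) (hw : w ∈ T) (hor : ∀ u ∈ T, I.N.Within r w.1 (o u).1) :
    ∃ i, G.sol I sp out r r' (G.pt i w) := by
  have hinj : Function.Injective I.tag := fun x y => I.tag_inj.1
  have hT' : RecClosed (G.records I sp out r w) (I.tag '' T)
      (Function.extend I.tag (fun u => I.tag (o u)) fun _ => 0) := by
    rintro - ⟨u, hu, rfl⟩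
    obtain ⟨h1, h2, h3⟩ := hT u hu
    refine ⟨G.record I sp out (o u), ⟨_, _, hor u hu, rfl⟩, h1, ?_, congrArg I.tag h2, ?_⟩
    · rw [hinj.extend_apply]; rfl
    · refine h3.imp id fun h3 => ⟨h3.1, h3.2.1, ⟨_, h3.2.2.1, rfl⟩, ?_⟩
      change Function.extend _ _ _ (I.tag _) ≠ I.tag _
      rw [hinj.extend_apply, Ne, I.tag_inj]
      exact h3.2.2.2
  have h1 := mem_pickClosed (Set.mem_image_of_mem I.tag hw) hT'
  obtain ⟨p, hp⟩ := exists_isBest (P := G.proposals I sp out r r' w) (t := I.tag w)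
    ⟨w.1, w.2, Network.Within.refl _ _, rfl⟩ h1
  obtain ⟨u, j, -, rfl⟩ := hp.1
  obtain ⟨ρ, ⟨u', j', -, rfl⟩, h3, h4, h5, -⟩ := pickClosed_closed _ _ _ hp.2.1
  have h5' : G.nd (u', j') = w := I.tag_inj.1 h5
  obtain ⟨i, hi⟩ := hG.pt_nd _ h3
  rw [h5'] at hi
  rw [← hi] at h3 h4 h5'
  have h6 : (pickClosed (G.records I sp out r (u, j)) (I.tag (u, j))).2 (I.tag w) =
      I.tag (G.pt i w) := h4.symm
  exact ⟨i, Or.inl ⟨h3, _, by rw [h5']; exact hp, by rw [h5']; exact h6⟩⟩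

theorem within_RB {K : ℕ} (hnd : ∀ h, I.N.Within K h.1 (G.nd h).1)
    (hinv : ∀ h, I.N.Within K h.1 (G.inv h).1) {c : I.V × ℕ} {i : ℕ} {w : I.V × ℕ}
    (hw : w ∈ G.RB sp c i) : I.N.Within (3 * K * i) c.1 w.1 := by
  induction i generalizing w with
  | zero => cases hw; exact Network.Within.refl _ _
  | succ i ih =>
    rcases hw with hw | ⟨u, hu, e, -, rfl, -, -, rfl⟩
    · exact (ih hw).mono (Nat.mul_le_mul_left _ (Nat.le_succ _))
    · refine ((((ih hu).trans (hnd e).symm).trans (hinv e)).trans (hnd _)).mono ?_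
      rw [Nat.mul_succ]; omega

end

variable {g : ℕ → ℕ}

theorem LocF.sol (hg : ∀ n, 1 ≤ g n) {G : ∀ I : Inst S k, HG (I.V × ℕ)}
    {sp out : ∀ I : Inst S k, I.V × ℕ → Prop} (hinv : LocM g fun I => (G I).inv)
    (hnd : LocM g fun I => (G I).nd) (hdem : LocF g fun I => (G I).dem) (hsp : LocF g sp)
    (hout : LocF g out) (C C' : ℕ) :
    LocF g fun I => (G I).sol I (sp I) (out I) (C * g I.size) (C' * g I.size) := by
  have h1 : LocF g fun I => (G I).record I (sp I) (out I) := by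
    have h2 := LocF.tag.prod (hnd.2.prod (hinv.2.prod ((hinv.comp hg hnd).2.prod
      (hdem.prod ((hdem.read hg hinv).prod (hsp.prod hout))))))
    exact h2.map fun p => (⟨p.1, p.2.1, p.2.2.1, p.2.2.2.1, p.2.2.2.2.1, p.2.2.2.2.2.1,
      p.2.2.2.2.2.2.1, p.2.2.2.2.2.2.2⟩ : DartRecord)
  have h2 : LocF g fun I => (G I).proposals I (sp I) (out I) (C * g I.size) (C' * g I.size) :=
    ((LocF.tag (S := S) (k := k)).map2 (fun t D => ((t, pickClosed D t) : Proposal))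
      (h1.ball C)).ball C'
  have h3 : LocF g fun I => (G I).Chosen I (sp I) (out I) (C * g I.size) (C' * g I.size) :=
    (hdem.prod ((h2.read hg hnd).prod (hnd.2.prod LocF.tag))).map
      fun p : Prop × Set Proposal × (ℕ × ℕ) × (ℕ × ℕ) =>
        p.1 ∧ ∃ q, IsBest p.2.1 p.2.2.1 q ∧ q.2.2 p.2.2.1 = p.2.2.2
  exact h3.or ((h3.read hg hinv).not.and
    (LocF.map2 (fun s t => tagKey s < tagKey t) LocF.tag hinv.2))

end
end LocalModel

/-! ### Contraction of chains -/

namespace LocalModel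

open Classical in
/-- Follow `f` for at most `n` steps, as long as `p` holds. -/
noncomputable def walk {O : Type*} (f : O → O) (p : O → Prop) : ℕ → O → O
  | 0, y => y
  | n + 1, y => if p y then walk f p n (f y) else y

section Walk
variable {O : Type*} {f : O → O} {p : O → Prop}

theorem walk_of_not {y : O} (h : ¬ p y) (n : ℕ) : walk f p n y = y := by
  cases n with
  | zero => rfl
  | succ n => rw [walk, if_neg h]

theorem walk_spec (n : ℕ) (y : O) : ∃ m ≤ n, walk f p n y = f^[m] y ∧ (∀ i < m, p (f^[i] y)) ∧
    (p (walk f p n y) → m = n) := by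
  induction n generalizing y with
  | zero => exact ⟨0, le_rfl, rfl, by simp, fun _ => rfl⟩
  | succ n ih =>
    by_cases h : p y
    · obtain ⟨m, h1, h2, h3, h4⟩ := ih (f y)
      refine ⟨m + 1, by omega, ?_, ?_, ?_⟩
      · rw [walk, if_pos h, h2]; rfl
      · rintro (_ | i) hi
        · exact h
        · exact h3 i (by omega)
      · rw [walk, if_pos h]
        exact fun h5 => by rw [h4 h5]
    · refine ⟨0, by omega, ?_, by simp, ?_⟩
      · rw [walk, if_neg h]; rfl
      · rw [walk, if_neg h]
        exact fun h' => absurd h' h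

theorem walk_eq {n m : ℕ} {y : O} (h : ¬ p (walk f p n y)) (h1 : ∀ i < m, p (f^[i] y))
    (h2 : ¬ p (f^[m] y)) : walk f p n y = f^[m] y := by
  obtain ⟨l, -, h3, h4, -⟩ := walk_spec (f := f) (p := p) n y
  rcases lt_trichotomy l m with h5 | rfl | h5
  · rw [h3] at h
    exact absurd (h1 l h5) h
  · exact h3
  · exact absurd (h4 m h5) h2

end Walk

/-- Two involutions without fixed points, and a set of inner objects that is closed under the
second one. -/
structure Pairing (O : Type*) where
  mate : O → O
  twin : O → O
  inner : O → Prop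
  mate_mate : ∀ z, mate (mate z) = z
  mate_ne : ∀ z, mate z ≠ z
  twin_twin : ∀ z, twin (twin z) = z
  twin_ne : ∀ z, twin z ≠ z
  inner_twin : ∀ z, inner (twin z) ↔ inner z

namespace Pairing
variable {O : Type*} (A : Pairing O)

/-- One step along a chain of inner objects. -/
def next (z : O) : O := A.mate (A.twin z)

/-- The inner objects that form a closed chain of four. -/
def Tiny (z : O) : Prop :=
  A.inner z ∧ A.inner (A.mate z) ∧ A.mate (A.twin z) = A.twin (A.mate z)

/-- The end of the chain that starts with `mate z`. -/
noncomputable def far (L : ℕ) (z : O) : O := walk A.next A.inner (L + 1) (A.mate z)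

open Classical in
/-- The other half of the edge that arises by contracting chains. -/
noncomputable def inv (L : ℕ) (z : O) : O := if A.inner z then A.twin z else A.far L z

/-- Chains of `L + 1` inner objects are closed chains of four. -/
def Short (L : ℕ) : Prop :=
  ∀ y, (∀ i ≤ L, A.inner (A.next^[i] y)) → ∃ i ≤ L, A.Tiny (A.next^[i] y)

variable {A} {L : ℕ}

theorem tiny_twin {z : O} : A.Tiny (A.twin z) ↔ A.Tiny z := by
  have key : ∀ z, A.Tiny z → A.Tiny (A.twin z) := by
    rintro z ⟨h1, h2, h3⟩
    refine ⟨(A.inner_twin z).2 h1, by rw [h3, A.inner_twin]; exact h2, ?_⟩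
    rw [A.twin_twin, h3, A.twin_twin]
  exact ⟨fun h => by simpa only [A.twin_twin] using key _ h, key z⟩

theorem tiny_mate {z : O} : A.Tiny (A.mate z) ↔ A.Tiny z := by
  have key : ∀ z, A.Tiny z → A.Tiny (A.mate z) := by
    rintro z ⟨h1, h2, h3⟩
    refine ⟨h2, by rwa [A.mate_mate], ?_⟩
    rw [A.mate_mate, ← h3, A.mate_mate]
  exact ⟨fun h => by simpa only [A.mate_mate] using key _ h, key z⟩

theorem tiny_next_iterate {z : O} (n : ℕ) : A.Tiny (A.next^[n] z) ↔ A.Tiny z := by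
  induction n with
  | zero => rfl
  | succ n ih => rw [Function.iterate_succ_apply', next, tiny_mate, tiny_twin, ih]

theorem twin_mate_next (z : O) : A.twin (A.mate (A.next z)) = z := by
  rw [next, A.mate_mate, A.twin_twin]

/-- Turning around with `mate` and walking the same number of steps leads back to the start. -/
theorem next_mate_next_iterate (n : ℕ) (z : O) :
    A.next^[n] (A.mate (A.next^[n] (A.mate z))) = z := by
  induction n generalizing z with
  | zero => exact A.mate_mate z
  | succ n ih =>
    rw [Function.iterate_succ_apply' _ _ (A.mate z), Function.iterate_succ_apply]
    rw [next, next, A.mate_mate, A.twin_twin]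
    exact ih z

theorem inner_mate_next_iterate {n i : ℕ} {z : O} (h : ∀ i < n, A.inner (A.next^[i] (A.mate z)))
    (hi : i < n) : A.inner (A.next^[i] (A.mate (A.next^[n] (A.mate z)))) := by
  obtain ⟨l, rfl⟩ := Nat.exists_eq_add_of_lt hi
  have h1 : A.next^[i] (A.mate (A.next^[i + l + 1] (A.mate z))) =
      A.mate (A.next^[l + 1] (A.mate z)) := by
    have := next_mate_next_iterate (A := A) i (A.mate (A.next^[l + 1] (A.mate z)))
    rw [A.mate_mate, ← Function.iterate_add_apply] at this
    exact this
  rw [h1, Function.iterate_succ_apply', next, A.mate_mate, A.inner_twin]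
  exact h l (by omega)

/-- A walk that ended at its own start would be its own reversal. Removing one step at each end
shortens it by two, until its middle is a fixed point of `mate` or of `twin`. -/
theorem next_iterate_mate_ne (n : ℕ) (z : O) : A.next^[n] (A.mate z) ≠ z := by
  induction n using Nat.twoStepInduction generalizing z with
  | zero => exact A.mate_ne z
  | one =>
    intro h
    change A.mate (A.twin (A.mate z)) = z at h
    apply A.twin_ne (A.mate z)
    rw [← A.mate_mate (A.twin (A.mate z)), h]
  | more n ih _ =>
    intro h
    apply ih (A.twin (A.mate z))
    rw [Function.iterate_succ_apply', Function.iterate_succ_apply] at h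
    conv_rhs => rw [← h]
    rw [twin_mate_next]
    rfl

theorem far_not_inner (hS : A.Short L) {z : O} (hz : ¬ A.Tiny z) : ¬ A.inner (A.far L z) := by
  intro h
  obtain ⟨m, -, h2, h3, h4⟩ := walk_spec (f := A.next) (p := A.inner) (L + 1) (A.mate z)
  have := h4 h
  subst this
  obtain ⟨i, -, hi⟩ := hS (A.mate z) fun i hi => h3 i (by omega)
  rw [tiny_next_iterate, tiny_mate] at hi
  exact hz hi

theorem far_spec (hS : A.Short L) {z : O} (hz : ¬ A.Tiny z) :
    ∃ m, A.far L z = A.next^[m] (A.mate z) ∧ (∀ i < m, A.inner (A.next^[i] (A.mate z))) ∧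
      ¬ A.inner (A.next^[m] (A.mate z)) := by
  obtain ⟨m, -, h2, h3, -⟩ := walk_spec (f := A.next) (p := A.inner) (L + 1) (A.mate z)
  exact ⟨m, h2, h3, h2 ▸ far_not_inner hS hz⟩

theorem not_tiny_of_not_inner {z : O} (hz : ¬ A.inner z) : ¬ A.Tiny z := fun h => hz h.1

theorem far_mate {z : O} (hz : ¬ A.inner z) : A.far L (A.mate z) = z := by
  rw [far, A.mate_mate, walk_of_not hz]

/-- From the end of the chain, the walk first retraces it to `z` and then continues through `z`,
exactly as the walk that starts with `mate z` backwards. -/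
theorem far_far (hS : A.Short L) {z : O} (hz : ¬ A.Tiny z) :
    A.far L (A.far L z) = A.far L (A.mate z) := by
  obtain ⟨n, h1, h2, h3⟩ := far_spec hS hz
  obtain ⟨m, k1, k2, k3⟩ := far_spec hS (z := A.mate z) (by rwa [tiny_mate])
  rw [A.mate_mate] at k1 k2 k3
  have hn := far_not_inner hS (not_tiny_of_not_inner (far_not_inner hS hz))
  have hit : ∀ i, A.next^[n + i] (A.mate (A.far L z)) = A.next^[i] z := by
    intro i
    rw [add_comm, Function.iterate_add_apply, h1, next_mate_next_iterate]
  rw [k1, ← hit]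
  refine walk_eq hn ?_ (by rwa [hit])
  intro i hi
  by_cases hin : i < n
  · rw [h1]
    exact inner_mate_next_iterate h2 hin
  · obtain ⟨l, rfl⟩ := Nat.exists_eq_add_of_le (not_lt.1 hin)
    rw [hit]
    exact k2 l (by omega)

theorem far_far_self (hS : A.Short L) {z : O} (hz : ¬ A.inner z) : A.far L (A.far L z) = z := by
  rw [far_far hS (not_tiny_of_not_inner hz), far_mate hz]

/-- For inner `z`, leaving through `twin z` is the second step of the walk that enters at `z`. -/
theorem far_twin (hS : A.Short L) {z : O} (hz : A.inner z) (ht : ¬ A.Tiny z) :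
    A.far L (A.twin z) = A.far L (A.mate z) := by
  obtain ⟨m, h1, h2, h3⟩ := far_spec hS (z := A.twin z) (by rwa [tiny_twin])
  have hn := far_not_inner hS (z := A.mate z) (by rwa [tiny_mate])
  rw [h1]
  symm
  rw [far, A.mate_mate] at hn ⊢
  refine walk_eq (m := m + 1) hn ?_ h3
  rintro (_ | i) hi
  · exact hz
  · exact h2 i (by omega)

theorem far_ne (hS : A.Short L) {z : O} (hz : ¬ A.inner z) : A.far L z ≠ z := by
  obtain ⟨n, h1, -⟩ := far_spec hS (not_tiny_of_not_inner hz)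
  rw [h1]
  exact next_iterate_mate_ne n z

theorem inv_inv (hS : A.Short L) (z : O) : A.inv L (A.inv L z) = z := by
  by_cases h : A.inner z
  · simp [inv, h, A.inner_twin, A.twin_twin]
  · simp [inv, h, far_not_inner hS (not_tiny_of_not_inner h), far_far_self hS h]

theorem inv_ne (hS : A.Short L) (z : O) : A.inv L z ≠ z := by
  by_cases h : A.inner z
  · simp [inv, h, A.twin_ne]
  · simpa [inv, h] using far_ne hS h

/-- Extends an orientation `x` of the contracted edges to the chains; the closed chains of four are
oriented according to a key. -/
def expand (A : Pairing O) (L : ℕ) (x : O → Prop) (key : O → ℕ) (z : O) : Prop :=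
  (A.Tiny z ∧ min (key z) (key (A.twin (A.mate z))) < min (key (A.twin z)) (key (A.mate z))) ∨
    (¬ A.Tiny z ∧ ¬ x (A.far L z))

section Expand
variable {x : O → Prop} {key : O → ℕ}

theorem expand_of_not_tiny {z : O} (h : ¬ A.Tiny z) : A.expand L x key z ↔ ¬ x (A.far L z) := by
  simp [expand, h]

theorem expand_of_tiny {z : O} (h : A.Tiny z) : A.expand L x key z ↔
    min (key z) (key (A.twin (A.mate z))) < min (key (A.twin z)) (key (A.mate z)) := by
  simp [expand, h]

theorem min_key_ne (hk : Function.Injective key) {z : O} (h : A.Tiny z) :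
    min (key z) (key (A.twin (A.mate z))) ≠ min (key (A.twin z)) (key (A.mate z)) := by
  have e1 := hk.ne (A.twin_ne z)
  have e2 := hk.ne (A.mate_ne z)
  have e3 := hk.ne (A.twin_ne (A.mate z))
  have e4 : key (A.twin (A.mate z)) ≠ key (A.twin z) := by
    rw [← h.2.2]
    exact hk.ne (A.mate_ne _)
  omega

/-- On a chain with ends, `z` and `mate z` see the two opposite ends, where `x` takes opposite
values. On a tiny closed chain, the half-edges split into `z, twin (mate z)` and `twin z, mate z`,
and the class with the smallest key is outgoing. -/
theorem expand_mate (hS : A.Short L) (hx : ∀ z, x (A.inv L z) ↔ ¬ x z)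
    (hk : Function.Injective key) (z : O) :
    A.expand L x key (A.mate z) ↔ ¬ A.expand L x key z := by
  by_cases h : A.Tiny z
  · rw [expand_of_tiny h, expand_of_tiny (tiny_mate.2 h), A.mate_mate]
    have := min_key_ne hk h
    rw [min_comm (key (A.mate z)), min_comm (key (A.twin (A.mate z)))]
    omega
  · rw [expand_of_not_tiny h, expand_of_not_tiny (by rwa [tiny_mate]), ← far_far hS h]
    have := hx (A.far L z)
    rw [inv, if_neg (far_not_inner hS h)] at this
    rw [this]

theorem expand_twin (hS : A.Short L) (hx : ∀ z, x (A.inv L z) ↔ ¬ x z)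
    (hk : Function.Injective key) {z : O} (hz : A.inner z) :
    A.expand L x key (A.twin z) ↔ ¬ A.expand L x key z := by
  by_cases h : A.Tiny z
  · rw [expand_of_tiny h, expand_of_tiny (tiny_twin.2 h), A.twin_twin, h.2.2, A.twin_twin]
    have := min_key_ne hk h
    omega
  · rw [← expand_mate hS hx hk, expand_of_not_tiny (by rwa [tiny_twin]),
      expand_of_not_tiny (by rwa [tiny_mate]), far_twin hS hz h]

theorem expand_of_not_inner (hx : ∀ z, x (A.inv L z) ↔ ¬ x z) {z : O} (hz : ¬ A.inner z) :
    A.expand L x key z ↔ x z := by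
  have := hx z
  rw [inv, if_neg hz] at this
  rw [expand_of_not_tiny (not_tiny_of_not_inner hz), this, not_not]

end Expand

end Pairing
end LocalModel

/-! ### Trails through pairs of ports -/

namespace LocalModel

/-- Exchanges `2 * j` and `2 * j + 1`. -/
def flip (i : ℕ) : ℕ := if i % 2 = 0 then i + 1 else i - 1

theorem flip_flip (i : ℕ) : flip (flip i) = i := by
  unfold flip; split_ifs <;> omega

theorem flip_ne (i : ℕ) : flip i ≠ i := by
  unfold flip; split_ifs <;> omega

theorem flip_div (i : ℕ) : flip i / 2 = i / 2 := by
  unfold flip; split_ifs <;> omega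

theorem flip_lt_four {i : ℕ} : flip i < 4 ↔ i < 4 := by
  unfold flip; split_ifs <;> omega

theorem eq_or_eq_flip {i j : ℕ} (h : i / 2 = j / 2) : i = j ∨ i = flip j := by
  unfold flip; split_ifs <;> omega

namespace Network
variable {V : Type} (N : Network V)

open Classical in
/-- The mate of a half-edge; the indices that are not ports are paired at their node. -/
noncomputable def mate (z : V × ℕ) : V × ℕ :=
  if z.2 < N.deg z.1 then N.nbr z.1 z.2 else (z.1, N.deg z.1 + flip (z.2 - N.deg z.1))

/-- The other object in the pair of `z` at its node. -/
def twin (z : V × ℕ) : V × ℕ := (z.1, flip z.2)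

theorem mate_mate (z : V × ℕ) : N.mate (N.mate z) = z := by
  by_cases h : z.2 < N.deg z.1
  · have := nbr_back z.1 z.2 h
    simp only [mate, h, if_true, this]
  · have h1 : N.mate z = (z.1, N.deg z.1 + flip (z.2 - N.deg z.1)) := by simp [mate, h]
    rw [h1]
    simp only [mate, Nat.not_lt.2 (Nat.le_add_right _ _), if_false, Nat.add_sub_cancel_left, flip_flip]
    exact Prod.ext rfl (by dsimp only; omega)

theorem mate_ne (z : V × ℕ) : N.mate z ≠ z := by
  by_cases h : z.2 < N.deg z.1
  · obtain ⟨v, i⟩ := z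
    dsimp only at h
    intro h1
    have h2 := N.opp_ne ⟨v, ⟨i, h⟩⟩
    apply h2
    simp only [mate, nbr, h, if_true, dif_pos, Prod.mk.injEq] at h1
    generalize N.opp ⟨v, ⟨i, h⟩⟩ = q at h1
    obtain ⟨u, j⟩ := q
    obtain ⟨rfl, h3⟩ := h1
    exact congrArg (Sigma.mk u) (Fin.ext h3)
  · intro h1
    have h2 := congrArg Prod.snd h1
    have h3 := flip_ne (z.2 - N.deg z.1)
    simp only [mate, h, if_false] at h2
    omega

theorem twin_twin (z : V × ℕ) : twin (twin z) = z := Prod.ext rfl (flip_flip _)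

theorem twin_ne (z : V × ℕ) : twin z ≠ z := fun h => flip_ne _ (congrArg Prod.snd h)

/-- The nodes at which two outgoing edges are required. -/
def Active (v : V) : Prop := 5 ≤ N.deg v

open Classical in
/-- Pairs of ports `2 * j, 2 * j + 1` form trails; this is the step along a trail that leaves the
pair `(v, j)` through the port `2 * j + s`. -/
noncomputable def trail (s : Fin 2) (y : V × ℕ) : V × ℕ :=
  if N.Active y.1 ∧ y.2 < 2 ∧ N.Active (N.mate (y.1, 2 * y.2 + s)).1 ∧
      (N.mate (y.1, 2 * y.2 + s)).2 < 4 then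
    ((N.mate (y.1, 2 * y.2 + s)).1, (N.mate (y.1, 2 * y.2 + s)).2 / 2) else y

variable {N}

theorem trail_eq {z : V × ℕ} (h1 : N.Active z.1) (h2 : z.2 < 4) (h3 : N.Active (N.mate z).1)
    (h4 : (N.mate z).2 < 4) :
    ∃ s : Fin 2, s.val = z.2 % 2 ∧ N.trail s (z.1, z.2 / 2) = ((N.mate z).1, (N.mate z).2 / 2) := by
  refine ⟨⟨z.2 % 2, by omega⟩, rfl, ?_⟩
  have e : (z.1, 2 * (z.2 / 2) + z.2 % 2) = z := Prod.ext rfl (by dsimp only; omega)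
  rw [trail, if_pos]
  · dsimp only; rw [e]
  · dsimp only; rw [e]; exact ⟨h1, by omega, h3, h4⟩

theorem trail_of_ne {s : Fin 2} {y : V × ℕ} (h : N.trail s y ≠ y) :
    N.Active y.1 ∧ y.2 < 2 ∧ N.Active (N.mate (y.1, 2 * y.2 + s)).1 ∧
      (N.mate (y.1, 2 * y.2 + s)).2 < 4 := by
  by_contra h'
  exact h (by rw [trail, if_neg h'])

theorem trail_symm : StepSymm N.trail := by
  intro s y h
  obtain ⟨h1, h2, h3, h4⟩ := trail_of_ne h
  have hs := s.2
  obtain ⟨s', -, h5⟩ := trail_eq h3 h4 (by rw [mate_mate]; exact h1)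
    (by rw [mate_mate]; dsimp only; omega)
  refine ⟨s', ?_⟩
  rw [mate_mate] at h5
  have h6 : N.trail s y = ((N.mate (y.1, 2 * y.2 + s)).1, (N.mate (y.1, 2 * y.2 + s)).2 / 2) := by
    rw [trail, if_pos ⟨h1, h2, h3, h4⟩]
  rw [h6, h5]
  exact Prod.ext rfl (by dsimp only; omega)

theorem trail_small : StepSmall N.trail := by
  intro s y h
  obtain ⟨h1, h2, h3, h4⟩ := trail_of_ne h
  refine ⟨h2, ?_⟩
  rw [trail, if_pos ⟨h1, h2, h3, h4⟩]
  dsimp only; omega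

variable (N)

/-- The selected pairs that have two different neighbours along their trail. -/
def Center (M : V × ℕ → Prop) (m : V × ℕ) : Prop :=
  M m ∧ N.Active m.1 ∧ m.2 < 2 ∧ N.trail 0 m ≠ m ∧ N.trail 1 m ≠ m ∧ N.trail 0 m ≠ N.trail 1 m

open Classical in
/-- The graph with the nodes `{m, trail 0 m, trail 1 m}` for the centres `m`, and an edge between the
two pairs of each node of the network. -/
noncomputable def trailGraph (M : V × ℕ → Prop) : HG (V × ℕ) where
  inv := twin
  dem y := N.Center M y ∨ N.Center M (N.trail 0 y) ∨ N.Center M (N.trail 1 y)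
  nd y := if N.Center M y then y else
    if N.Center M (N.trail 0 y) then N.trail 0 y else N.trail 1 y
  isN := N.Center M
  pt i m := if i = 0 then m else if i = 1 then N.trail 0 m else N.trail 1 m

variable {N}

theorem reach_trail (s : Fin 2) (y : V × ℕ) : StepReach N.trail 1 y (N.trail s y) := Or.inr ⟨s, rfl⟩

/-- Separation of the selected pairs makes the triples around different centres disjoint, so a pair
has at most one centre near it. -/
theorem trailGraph_cubic {M : V × ℕ → Prop}
    (hM : ∀ x y, M x → M y → StepReach N.trail 3 x y → x = y) : (N.trailGraph M).Cubic where
  inv_inv := twin_twin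
  inv_ne := twin_ne
  pt_inj := by
    intro w ⟨_, _, _, h1, h2, h3⟩ i j hij
    simp only [trailGraph] at hij
    fin_cases i <;> fin_cases j <;> first | rfl | skip
    · exact absurd hij.symm h1
    · exact absurd hij.symm h2
    · exact absurd hij h1
    · exact absurd hij h3
    · exact absurd hij h2
    · exact absurd hij.symm h3
  dem_pt := by
    intro w i hw
    have key : ∀ s, N.trail s w ≠ w → N.Center M (N.trail 0 (N.trail s w)) ∨
        N.Center M (N.trail 1 (N.trail s w)) := by
      intro s hs
      obtain ⟨j, hj⟩ := trail_symm s w hs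
      fin_cases j
      · exact Or.inl (hj.symm ▸ hw)
      · exact Or.inr (hj.symm ▸ hw)
    fin_cases i
    · exact Or.inl hw
    · exact Or.inr (key 0 hw.2.2.2.1)
    · exact Or.inr (key 1 hw.2.2.2.2.1)
  nd_pt := by
    intro w i hw
    have key : ∀ s, N.trail s w ≠ w → (N.trailGraph M).nd (N.trail s w) = w := by
      intro s hs
      simp only [trailGraph]
      split_ifs with h1 h2
      · exact (hM _ _ hw.1 h1.1 ((reach_trail _ _).mono (by omega))).symm
      · exact (hM _ _ hw.1 h2.1 (((reach_trail _ _).trans (reach_trail _ _)).mono (by omega))).symm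
      · obtain ⟨j, hj⟩ := trail_symm s w hs
        fin_cases j
        · exact absurd (hj.symm ▸ hw) h2
        · exact hj
    fin_cases i
    · exact if_pos hw
    · exact key 0 hw.2.2.2.1
    · exact key 1 hw.2.2.2.2.1
  isN_nd := by
    intro h hd
    simp only [trailGraph] at hd ⊢
    split_ifs with h1 h2
    · exact h1
    · exact h2
    · exact (hd.resolve_left h1).resolve_left h2
  pt_nd := by
    intro h hd
    have key : ∀ s, ¬ N.Center M h → N.Center M (N.trail s h) →
        ∃ i, (N.trailGraph M).pt i (N.trail s h) = h := by
      intro s h1 h2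
      obtain ⟨j, hj⟩ := trail_symm s h (fun e => h1 (e ▸ h2))
      fin_cases j
      · exact ⟨1, hj⟩
      · exact ⟨2, hj⟩
    simp only [trailGraph] at hd key ⊢
    split_ifs with h1 h2
    · exact ⟨0, rfl⟩
    · exact key 0 h1 h2
    · exact key 1 h1 ((hd.resolve_left h1).resolve_left h2)

variable (N)

/-- The pairing of half-edges, where `X (v, j)` says that the pair `(v, j)` is not inner. -/
noncomputable def pairing (X : V × ℕ → Prop) : Pairing (V × ℕ) where
  mate := N.mate
  twin := twin
  inner z := N.Active z.1 ∧ z.2 < 4 ∧ ¬ X (z.1, z.2 / 2)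
  mate_mate := N.mate_mate
  mate_ne := N.mate_ne
  twin_twin := twin_twin
  twin_ne := twin_ne
  inner_twin z := by simp only [twin, flip_lt_four, flip_div]

variable {N} {X M : V × ℕ → Prop}

/-- The pair of a half-edge. -/
def half (z : V × ℕ) : V × ℕ := (z.1, z.2 / 2)

theorem half_twin (z : V × ℕ) : half (twin z) = half z := Prod.ext rfl (flip_div _)

theorem eq_of_half_eq {z z' : V × ℕ} (h : half z = half z') : z = z' ∨ z = twin z' := by
  obtain ⟨v, i⟩ := z
  obtain ⟨v', i'⟩ := z'
  simp only [half, Prod.mk.injEq] at h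
  obtain ⟨rfl, h⟩ := h
  rcases eq_or_eq_flip h with rfl | rfl
  · exact Or.inl rfl
  · exact Or.inr rfl

theorem trail_half {z : V × ℕ} (h1 : (N.pairing X).inner z) (h2 : (N.pairing X).inner (N.mate z)) :
    ∃ s : Fin 2, s.val = z.2 % 2 ∧ N.trail s (half z) = half (N.mate z) :=
  trail_eq h1.1 h1.2.1 h2.1 h2.2.1

/-- In the middle of a chain, the two steps along the trail follow the chain. -/
theorem trail_chain {y' y y'' : V × ℕ} (hy : (N.pairing X).inner y) (hy' : (N.pairing X).inner y')
    (hy'' : (N.pairing X).inner y'') (e : (N.pairing X).next y' = y)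
    (e' : (N.pairing X).next y = y'') :
    (N.trail 0 (half y) = half y' ∧ N.trail 1 (half y) = half y'') ∨
      (N.trail 0 (half y) = half y'' ∧ N.trail 1 (half y) = half y') := by
  have e1 : N.mate y = twin y' := by
    rw [← e]; exact N.mate_mate _
  have e2 : N.mate (twin y) = y'' := e'
  obtain ⟨s, hs, h1⟩ := trail_half hy (by rw [e1]; exact ((N.pairing X).inner_twin y').2 hy')
  obtain ⟨s', hs', h2⟩ := trail_half (((N.pairing X).inner_twin y).2 hy) (by
    change (N.pairing X).inner (N.mate (twin y)); rw [e2]; exact hy'')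
  change N.trail s' (half (twin y)) = half (N.mate (twin y)) at h2
  rw [half_twin, e2] at h2
  rw [e1, half_twin] at h1
  have hss : s'.val = (flip y.2) % 2 := hs'
  have : s'.val ≠ s.val := by
    rw [hs, hss]; unfold flip; split_ifs <;> omega
  have hc : (s = 0 ∧ s' = 1) ∨ (s = 1 ∧ s' = 0) := by omega
  rcases hc with ⟨rfl, rfl⟩ | ⟨rfl, rfl⟩
  · exact Or.inl ⟨h1, h2⟩
  · exact Or.inr ⟨h2, h1⟩

/-- If two of three consecutive pairs coincide, the chain closes up with a loop or a double edge;
every other coincidence would give a fixed point of `mate` or `twin`. -/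
theorem tiny_of_half_eq {y' y y'' : V × ℕ} (hy : (N.pairing X).inner y)
    (hy' : (N.pairing X).inner y')
    (e : (N.pairing X).next y' = y) (e' : (N.pairing X).next y = y'')
    (h : half y' = half y ∨ half y'' = half y ∨ half y' = half y'') : (N.pairing X).Tiny y := by
  have e1 : N.mate y = twin y' := by
    rw [← e]; exact N.mate_mate _
  have e2 : N.mate (twin y) = y'' := e'
  have key : (N.pairing X).inner (N.mate y) ∧ y' = y'' → (N.pairing X).Tiny y := by
    rintro ⟨h1, h2⟩
    refine ⟨hy, h1, ?_⟩
    change N.mate (twin y) = twin (N.mate y)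
    rw [e2, e1, twin_twin, h2]
  have hm : (N.pairing X).inner (N.mate y) := by
    rw [e1]; exact ((N.pairing X).inner_twin y').2 hy'
  refine key ⟨hm, ?_⟩
  rcases h with h | h | h
  · rcases eq_of_half_eq h with h | h
    · rw [h] at e1
      rw [← e1, N.mate_mate] at e2
      rw [h, e2]
    · rw [h, twin_twin] at e1
      exact absurd e1 (N.mate_ne y)
  · rcases eq_of_half_eq h with h | h
    · have h2 := N.mate_mate (twin y)
      rw [e2, h, e1] at h2
      rw [h, ← twin_twin y', h2, twin_twin]
    · rw [h] at e2
      exact absurd e2 (N.mate_ne _)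
  · rcases eq_of_half_eq h with h | h
    · exact h
    · rw [h, twin_twin, ← e2] at e1
      have := congrArg N.mate e1
      rw [N.mate_mate, N.mate_mate] at this
      exact absurd this.symm (twin_ne y)

/-- If every centre has an assigned pair in its group of three, then long chains are closed chains
of four. -/
theorem short_pairing {D : ℕ} (hdom : ∀ y, ∃ m, M m ∧ StepReach N.trail D y m)
    (hX : ∀ m, N.Center M m → X m ∨ X (N.trail 0 m) ∨ X (N.trail 1 m)) :
    (N.pairing X).Short (2 * D + 2) := by
  intro y hy
  set A := N.pairing X with hA
  have hnext : ∀ i, A.next (A.next^[i] y) = A.next^[i + 1] y :=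
    fun i => (Function.iterate_succ_apply' _ _ _).symm
  -- Trail steps from an interior index of the chain move to a neighbouring index. So `d` steps from
  -- an index at distance more than `d` from both ends stay in the interior; the middle index `D +
  -- 1` of a chain with last index `2 * D + 2` allows `d = D`.
  have hreach : ∀ d i m, d < i → i + d < 2 * D + 2 →
      StepReach N.trail d (half (A.next^[i] y)) m →
      ∃ l, 0 < l ∧ l < 2 * D + 2 ∧ m = half (A.next^[l] y) := by
    intro d
    induction d with
    | zero => intro i m h1 h2 h3; exact ⟨i, h1, h2, h3⟩
    | succ d ih =>
      intro i m h1 h2 h3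
      rcases h3 with h3 | ⟨s, h3⟩
      · exact ih i m (by omega) (by omega) h3
      · obtain ⟨i, rfl⟩ := Nat.exists_eq_succ_of_ne_zero (show i ≠ 0 by omega)
        have h4 := trail_chain (hy (i + 1) (by omega)) (hy i (by omega)) (hy (i + 2) (by omega))
          (hnext i) (hnext (i + 1))
        have h5 : N.trail s (half (A.next^[i + 1] y)) = half (A.next^[i] y) ∨
            N.trail s (half (A.next^[i + 1] y)) = half (A.next^[i + 2] y) := by
          fin_cases s
          · exact h4.imp And.left And.left
          · exact (h4.imp And.right And.right).symm
        rcases h5 with h5 | h5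
        · exact ih i m (by omega) (by omega) (h5 ▸ h3)
        · exact ih (i + 2) m (by omega) (by omega) (h5 ▸ h3)
  obtain ⟨m, hm, hr⟩ := hdom (half (A.next^[D + 1] y))
  obtain ⟨l, hl0, hl, rfl⟩ := hreach D (D + 1) m (by omega) (by omega) hr
  obtain ⟨l, rfl⟩ := Nat.exists_eq_succ_of_ne_zero hl0.ne'
  have i1 := hy (l + 1) (by omega)
  have i0 := hy l (by omega)
  have i2 := hy (l + 2) (by omega)
  have h4 := trail_chain i1 i0 i2 (hnext l) (hnext (l + 1))
  refine ⟨l + 1, by omega, tiny_of_half_eq i1 i0 (hnext l) (hnext (l + 1)) ?_⟩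
  -- If the three consecutive pairs were distinct, the selected one would be a centre, and `hX`
  -- would make one of the three not inner.
  by_contra! hne
  have hc : N.Center M (half (A.next^[l + 1] y)) := by
    refine ⟨hm, i1.1, ?_, ?_⟩
    · have := i1.2.1
      change _ / 2 < 2; omega
    · rcases h4 with ⟨a, b⟩ | ⟨a, b⟩ <;> rw [a, b]
      · exact ⟨hne.1, hne.2.1, hne.2.2⟩
      · exact ⟨hne.2.1, hne.1, hne.2.2.symm⟩
  have h5 : X (half (A.next^[l + 1] y)) ∨ X (half (A.next^[l] y)) ∨ X (half (A.next^[l + 2] y)) := by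
    have := hX _ hc
    rcases h4 with ⟨a, b⟩ | ⟨a, b⟩ <;> rw [a, b] at this <;> tauto
  rcases h5 with h5 | h5 | h5
  · exact i1.2.2 h5
  · exact i0.2.2 h5
  · exact i2.2.2 h5

variable (N)

open Classical in
/-- The graph whose edges are the contracted chains; each active node has its port `4` and the two
ports of the pair that is not inner. -/
noncomputable def chainGraph (X : V × ℕ → Prop) (L : ℕ) : HG (V × ℕ) where
  inv := (N.pairing X).inv L
  dem z := N.Active z.1 ∧ z.2 < 5 ∧ ¬ (N.pairing X).inner z
  nd z := (z.1, 0)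
  isN w := N.Active w.1 ∧ w.2 = 0
  pt i w := (w.1, if i = 0 then 4 else (if X (w.1, 0) then 0 else 2) + (i.val - 1))

variable {N}

/-- Exactly one of the two pairs of an active node is inner, so three of its ports `0, …, 4` are
left. -/
theorem chainGraph_cubic (hX : ∀ v, X (v, 1) ↔ ¬ X (v, 0)) {L : ℕ} (hS : (N.pairing X).Short L) :
    (N.chainGraph X L).Cubic where
  inv_inv := Pairing.inv_inv hS
  inv_ne := Pairing.inv_ne hS
  pt_inj := by
    intro w _ i j hij
    have h := congrArg Prod.snd hij
    simp only [chainGraph] at h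
    fin_cases i <;> fin_cases j <;> first | rfl | skip
    all_goals
      exfalso
      by_cases hx : X (w.1, 0) <;> simp [hx] at h
  dem_pt := by
    intro w i hw
    have := hX w.1
    refine ⟨hw.1, ?_, ?_⟩ <;> by_cases hx : X (w.1, 0) <;> fin_cases i <;>
      simp_all [chainGraph, pairing]
  nd_pt := by
    intro w i hw
    exact Prod.ext rfl hw.2.symm
  isN_nd h hd := ⟨hd.1, rfl⟩
  pt_nd := by
    rintro ⟨v, i⟩ ⟨h1, h2, h3⟩
    have := hX v
    dsimp only at h1 h2
    have h4 : i = 4 ∨ (X (v, 0) ∧ i = 0) ∨ (X (v, 0) ∧ i = 1) ∨ (¬ X (v, 0) ∧ i = 2) ∨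
        (¬ X (v, 0) ∧ i = 3) := by
      interval_cases i <;> simp_all [pairing]
    rcases h4 with rfl | ⟨hx, rfl⟩ | ⟨hx, rfl⟩ | ⟨hx, rfl⟩ | ⟨hx, rfl⟩
    · exact ⟨0, rfl⟩
    · exact ⟨1, by simp [chainGraph, hx]⟩
    · exact ⟨2, by simp [chainGraph, hx]⟩
    · exact ⟨1, by simp [chainGraph, hx]⟩
    · exact ⟨2, by simp [chainGraph, hx]⟩

end Network
end LocalModel

/-! ### Locality of the graphs and of the orientations -/

namespace LocalModel
section
variable {S : ℕ → Type} {k : ℕ} {g : ℕ → ℕ}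

theorem LocM.map_idx (F : ℕ → ℕ → ℕ) :
    LocM g (fun (I : Inst S k) (x : I.V × ℕ) => (x.1, F (I.N.deg x.1) x.2)) :=
  ⟨⟨0, fun _ _ => rfl⟩, (LocF.tag.prod LocF.deg).map fun p => (p.1.1, F p.2 p.1.2)⟩

theorem LocF.active : LocF g (fun (I : Inst S k) (x : I.V × ℕ) => I.N.Active x.1) :=
  LocF.deg.map fun d => 5 ≤ d

theorem LocF.idx_lt (m : ℕ) : LocF g (fun (I : Inst S k) (x : I.V × ℕ) => x.2 < m) :=
  LocF.idx.map fun i => i < m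

variable (hg : ∀ n, 1 ≤ g n)
include hg

theorem LocM.mate : LocM g (fun I : Inst S k => I.N.mate) :=
  LocM.ite (p := fun (I : Inst S k) x => x.2 < I.N.deg x.1) (LocF.idx.map2 (· < ·) LocF.deg)
    (LocM.nbr hg) (LocM.map_idx fun d i => d + flip (i - d))

omit hg in
theorem LocM.twin : LocM g (fun (I : Inst S k) => (Network.twin : I.V × ℕ → I.V × ℕ)) :=
  LocM.reindex flip

theorem LocM.trail (s : Fin 2) : LocM g (fun I : Inst S k => I.N.trail s) := by
  have h1 : LocM g (fun (I : Inst S k) (y : I.V × ℕ) => I.N.mate (y.1, 2 * y.2 + s)) :=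
    LocM.comp (f' := fun I => I.N.mate) hg (LocM.reindex fun i => 2 * i + s) (LocM.mate hg)
  exact LocM.ite (p := fun (I : Inst S k) (y : I.V × ℕ) => I.N.Active y.1 ∧ y.2 < 2 ∧
      I.N.Active (I.N.mate (y.1, 2 * y.2 + s)).1 ∧ (I.N.mate (y.1, 2 * y.2 + s)).2 < 4)
    (LocF.active.and ((LocF.idx_lt 2).and
      ((LocF.read hg h1 LocF.active).and (LocF.read hg h1 (LocF.idx_lt 4)))))
    (LocM.comp (f' := fun _ x => (x.1, x.2 / 2)) hg h1 (LocM.reindex fun i => i / 2)) LocM.id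

section Step
variable {G : ∀ I : Inst S k, HG (I.V × ℕ)}

theorem LocM.step (hinv : LocM g fun I => (G I).inv) (hnd : LocM g fun I => (G I).nd)
    (hdem : LocF g fun I => (G I).dem) (hN : LocF g fun I => (G I).isN)
    (hpt : ∀ i, LocM g fun I => (G I).pt i) (i : Fin 3) : LocM g (fun I => (G I).step i) := by
  have h1 : LocM g (fun I x => (G I).inv ((G I).pt i x)) := (hpt i).comp hg hinv
  exact LocM.ite (p := fun I w => (G I).isN w ∧ (G I).dem ((G I).inv ((G I).pt i w)))
    (hN.and (hdem.read hg h1)) (h1.comp hg hnd) LocM.id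

theorem LocF.own {M : ∀ I : Inst S k, I.V × ℕ → Prop} (hinv : LocM g fun I => (G I).inv)
    (hnd : LocM g fun I => (G I).nd)
    (hdem : LocF g fun I => (G I).dem) (hN : LocF g fun I => (G I).isN)
    (hpt : ∀ i, LocM g fun I => (G I).pt i) (hM : LocF g M) : LocF g (fun I => (G I).own (M I)) := by
  have h1 := LocM.step hg hinv hnd hdem hN hpt
  have h2 : LocF g (fun I => (G I).Spm (M I)) :=
    hN.and (hM.and (((h1 0).eq LocM.id).not.and
      (LocF.forall fun i => (LocF.const (i ≠ 0)).imp ((h1 i).eq (h1 0)).not)))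
  exact hdem.and ((h2.read hg hnd).and (LocM.id.eq (hnd.comp hg (hpt 0))))

theorem LocF.spD {M : ∀ I : Inst S k, I.V × ℕ → Prop} (hinv : LocM g fun I => (G I).inv)
    (hown : LocF g fun I => (G I).own (M I)) : LocF g (fun I => (G I).spD (M I)) :=
  hown.or (hown.read hg hinv)

theorem LocF.outD {M coin : ∀ I : Inst S k, I.V × ℕ → Prop} (hinv : LocM g fun I => (G I).inv)
    (hnd : LocM g fun I => (G I).nd) (hown : LocF g fun I => (G I).own (M I))
    (hcoin : LocF g coin) : LocF g (fun I => (G I).outD (M I) (coin I)) :=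
  (hown.and (hcoin.read hg hnd)).or (hown.not.and (hcoin.read hg (hinv.comp hg hnd)).not)

end Step

/-- All parts of a family of graphs are determined locally. -/
structure LocG (g : ℕ → ℕ) (G : ∀ I : Inst S k, HG (I.V × ℕ)) : Prop where
  inv : LocM g fun I => (G I).inv
  nd : LocM g fun I => (G I).nd
  dem : LocF g fun I => (G I).dem
  isN : LocF g fun I => (G I).isN
  pt : ∀ i, LocM g fun I => (G I).pt i

theorem LocG.trailGraph {M : ∀ I : Inst S k, I.V × ℕ → Prop} (hM : LocF g M) :
    LocG g (fun I => I.N.trailGraph (M I)) := by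
  have h0 := LocM.trail (S := S) (k := k) hg 0
  have h1 := LocM.trail (S := S) (k := k) hg 1
  have hc : LocF g (fun I => I.N.Center (M I)) :=
    hM.and (LocF.active.and ((LocF.idx_lt 2).and ((h0.eq LocM.id).not.and
      ((h1.eq LocM.id).not.and (h0.eq h1).not))))
  have hc0 := hc.read hg h0
  have hc1 := hc.read hg h1
  refine ⟨LocM.twin, ?_, hc.or (hc0.or hc1), hc, ?_⟩
  · exact LocM.ite (p := fun I y => I.N.Center (M I) y) hc LocM.id
      (LocM.ite (p := fun I y => I.N.Center (M I) (I.N.trail 0 y)) hc0 h0 h1)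
  · intro i
    fin_cases i
    · exact LocM.id
    · exact h0
    · exact h1

section Chain
variable {X : ∀ I : Inst S k, I.V × ℕ → Prop} (hX : LocF g X)
include hX

theorem LocF.inner : LocF g (fun I => (I.N.pairing (X I)).inner) :=
  LocF.active.and ((LocF.idx_lt 4).and
    (LocF.read (a := X) hg (LocM.reindex fun i => i / 2) hX).not)

theorem LocM.far (L : ℕ) : LocM g (fun I => (I.N.pairing (X I)).far L) := by
  have hn : LocM g (fun I => (I.N.pairing (X I)).next) :=
    LocM.comp (f' := fun I => I.N.mate) hg LocM.twin (LocM.mate hg)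
  have hw : ∀ n, LocM g (fun I => walk (I.N.pairing (X I)).next (I.N.pairing (X I)).inner n) := by
    intro n
    induction n with
    | zero => exact LocM.id
    | succ n ih =>
      exact LocM.ite (p := fun I y => (I.N.pairing (X I)).inner y) (LocF.inner hg hX)
        (hn.comp hg ih) LocM.id
  exact LocM.comp (f := fun I => I.N.mate) hg (LocM.mate hg) (hw _)

theorem LocF.expand {Y : ∀ I : Inst S k, I.V × ℕ → Prop} (hY : LocF g Y) (L : ℕ) :
    LocF g (fun I => (I.N.pairing (X I)).expand L (Y I) fun z => tagKey (I.tag z)) := by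
  have hi := LocF.inner hg hX
  have hm := LocM.mate (S := S) (k := k) hg
  have ht := LocM.twin (S := S) (k := k) (g := g)
  have h1 : LocF g (fun I => (I.N.pairing (X I)).Tiny) :=
    hi.and ((hi.read hg hm).and ((ht.comp hg hm).eq (hm.comp hg ht)))
  have h2 : LocF g (fun (I : Inst S k) x => tagKey (I.tag x)) := LocF.tag.map tagKey
  exact (h1.and (LocF.map2 (· < ·) (LocF.map2 min h2 (h2.read hg (hm.comp hg ht)))
    (LocF.map2 min (h2.read hg ht) (h2.read hg hm)))).or
    (h1.not.and (hY.read hg (LocM.far hg hX L)).not)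

theorem LocG.chainGraph (L : ℕ) : LocG g (fun I => I.N.chainGraph (X I) L) := by
  have hi := LocF.inner hg hX
  refine ⟨?_, LocM.reindex fun _ => 0, LocF.active.and ((LocF.idx_lt 5).and hi.not),
    LocF.active.and (LocF.idx.map fun i => i = 0), ?_⟩
  · exact LocM.ite (p := fun I z => (I.N.pairing (X I)).inner z) hi LocM.twin (LocM.far hg hX L)
  · intro i
    refine ⟨⟨0, fun _ _ => rfl⟩, ?_⟩
    have h1 : LocF g (fun I x => X I (x.1, 0)) := LocF.read (a := X) hg (LocM.reindex fun _ => 0) hX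
    have h2 : LocF g (fun (I : Inst S k) x =>
        @_root_.ite _ (X I (x.1, 0)) (Classical.propDecidable _) 0 2) :=
      LocF.ite h1 (LocF.const 0) (LocF.const 2)
    exact LocF.map (fun p : ℕ × ℕ => (p.1, if i = 0 then 4 else p.2 + (i.val - 1)))
      (LocF.ident.prod h2)

end Chain
end
end LocalModel

/-! ### Sinkless orientation by a local rule, and its failure events -/

namespace LocalModel
section
variable {S : ℕ → Type} {k : ℕ} {g : ℕ → ℕ}

/-- There is no closed set within distance `R` of `c`. -/
def HG.Blocked {O : Type*} (G : HG O) (sp out : O → Prop) (R : ℕ) (c : O) : Prop :=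
  ∀ T o, G.Closed sp out T o → T ⊆ G.RB sp c R → T = ∅

/-- The selection of nodes that propose special half-edges; it is switched off if `b` is false. -/
def HG.sel (I : Inst S k) (g : ℕ → ℕ) (b : Prop) (G : HG (I.V × ℕ)) (x : I.V × ℕ) : Prop :=
  b ∧ Ruling G.step (idColor I.ident) (g I.size + k + 5) x

theorem HG.sel_sep {I : Inst S k} {b : Prop} {G : HG (I.V × ℕ)} (hG : G.Cubic) {x y : I.V × ℕ}
    (hx : G.sel I g b x) (hy : G.sel I g b y) (h : StepReach G.step 3 x y) : x = y :=
  hx.2.sep (HG.step_symm hG) hy.2 h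

/-- The orientation of `G` that is computed from the coins. -/
def HG.orient (I : Inst S k) (g : ℕ → ℕ) (b : Prop) (C C' : ℕ) (G : HG (I.V × ℕ))
    (coin : I.V × ℕ → Prop) : I.V × ℕ → Prop :=
  G.sol I (G.spD (G.sel I g b)) (G.outD (G.sel I g b) coin) (C * g I.size) (C' * g I.size)

/-- The failure event at `c`. -/
def HG.Fails (I : Inst S k) (g : ℕ → ℕ) (b : Prop) (B : ℕ) (G : HG (I.V × ℕ))
    (coin : I.V × ℕ → Prop) (c : I.V × ℕ) : Prop :=
  G.isN c ∧ G.Blocked (G.spD (G.sel I g b)) (G.outD (G.sel I g b) coin) (B * g I.size) c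

theorem exists_orient (hg : ∀ n, 1 ≤ g n) (b : Prop) (B : ℕ) {G : ∀ I : Inst S k, HG (I.V × ℕ)}
    (hG : LocG g G) {coin : ∀ I : Inst S k, I.V × ℕ → Prop} (hcoin : LocF g coin) :
    ∃ C C', LocF g (fun I => (G I).orient I g b C C' (coin I)) ∧
      ∀ I : Inst S k, (G I).Cubic →
        (∀ h, (G I).orient I g b C C' (coin I) ((G I).inv h) ↔
          ¬ (G I).orient I g b C C' (coin I) h) ∧
        ∀ w, (G I).isN w → ¬ (G I).Fails I g b B (coin I) w →
          ∃ i, (G I).orient I g b C C' (coin I) ((G I).pt i w) := by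
  obtain ⟨⟨K₁, h1⟩, -⟩ := hG.inv
  obtain ⟨⟨K₂, h2⟩, -⟩ := hG.nd
  set K := max K₁ K₂ with hK
  have hinv : ∀ (I : Inst S k) h, I.N.Within K h.1 ((G I).inv h).1 :=
    fun I h => (h1 I h).mono (le_max_left _ _)
  have hnd : ∀ (I : Inst S k) h, I.N.Within K h.1 ((G I).nd h).1 :=
    fun I h => (h2 I h).mono (le_max_right _ _)
  have hM : LocF g (fun I => (G I).sel I g b) :=
    (LocF.const b).and (LocF.ruling hg (LocM.step hg hG.inv hG.nd hG.dem hG.isN hG.pt))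
  have hown := LocF.own hg hG.inv hG.nd hG.dem hG.isN hG.pt hM
  -- One edge of `G` spans at most `3 * K` steps of the network, so the first radius shows a centre
  -- all half-edges that a closed set in its ball can choose. The second radius adds the `K` that
  -- `proposal_mem` requires.
  refine ⟨3 * K * B + K, 3 * K * B + K + K, LocF.sol hg hG.inv hG.nd hG.dem
    (LocF.spD hg hG.inv hown) (LocF.outD hg hG.inv hG.nd hown hcoin) _ _, ?_⟩
  intro I hC
  have hKg : K ≤ K * g I.size := Nat.le_mul_of_pos_right _ (hg _)
  have hsep : ∀ x y, (G I).sel I g b x → (G I).sel I g b y → StepReach (G I).step 3 x y → x = y :=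
    fun x y => HG.sel_sep hC
  refine ⟨fun h => sol_inv hC (hnd I) ?_ (HG.spD_inv hC) (fun h => HG.outD_inv hC hsep) h, ?_⟩
  · simp only [add_mul]; omega
  · intro w hw hf
    obtain ⟨T, o, hT, hTR, hwT⟩ := HG.exists_closed_cover hC (HG.spD_inv hC)
      (fun h => hf ⟨hw, h⟩)
    refine exists_sol hC hT hwT fun u hu => ?_
    have h3 := within_RB (hnd I) (hinv I) (hTR hu)
    have h4 := (hnd I (o u)).symm
    rw [(hT u hu).2.1] at h4
    refine (h3.trans h4).mono ?_
    rw [add_mul, mul_assoc _ B]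
    omega

/-- The objects that can be nodes. -/
def Inst.small (I : Inst S k) : Finset (I.V × ℕ) := Finset.univ ×ˢ Finset.range 2

theorem Inst.card_small (I : Inst S k) : I.small.card = 2 * I.size := by
  rw [Inst.small, Finset.card_product, Finset.card_univ, Finset.card_range, mul_comm]; rfl

section
variable {I : Inst S k} {G : HG (I.V × ℕ)} (hG : G.Cubic) (hN : ∀ w, G.isN w → w.2 < 2)
include hG hN

omit hG in
theorem mem_small_of_isN {w : I.V × ℕ} (hw : G.isN w) : w ∈ I.small := by
  simp [Inst.small, hN w hw]

/-- The depth `2 * (log n + 2)` fits into `6 * g n`, and `2 ^ (log n + 2)` exceeds the number `2 *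
n` of possible nodes. -/
theorem not_fails_det {coin : I.V × ℕ → Prop} {B : ℕ} (hB : 6 ≤ B)
    (hg : Nat.log 2 I.size + 1 ≤ g I.size)
    (c : I.V × ℕ) : ¬ G.Fails I g False B coin c := by
  rintro ⟨hc, hf⟩
  have h1 : G.sel I g False = fun _ => False := by
    funext x
    simp [HG.sel]
  rw [h1, HG.spD_false] at hf
  refine HG.exists_closed_of_card hG hc (fun w hw => mem_small_of_isN hN hw)
    (j := Nat.log 2 I.size + 2) ?_ ?_ hf
  · have := Nat.mul_le_mul hB hg
    omega
  · have h3 := Nat.lt_pow_succ_log_self (b := 2) (by norm_num) I.size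
    rw [I.card_small, pow_succ]
    rw [Nat.succ_eq_add_one] at h3
    omega

theorem step_small : StepSmall G.step := by
  intro i w hw
  have h : G.isN w ∧ G.dem (G.inv (G.pt i w)) := by
    by_contra h
    exact hw (by rw [HG.step, if_neg h])
  refine ⟨hN _ h.1, hN _ ?_⟩
  rw [HG.step, if_pos h]
  exact hG.isN_nd _ h.2

/-- The number of coins that must have fallen in a certain way for a failure. -/
theorem card_touched_of_fails {coin : I.V × ℕ → Prop} {B : ℕ}
    (hgn : Nat.log 2 (Fintype.card I.V) + 1 ≤ 2 ^ g I.size) {e D : ℕ}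
    (hD : 3 * numColors (Fin 3) = D) (hB : 2 * (g I.size + e + 1 + 2 * D) + D < B * g I.size)
    {c : I.V × ℕ} (hf : G.Fails I g True B coin c) :
    e * 2 ^ g I.size ≤ (G.touched (G.sel I g True) I.small (B * g I.size) c).card := by
  have hdom : ∀ w, ∃ m, G.sel I g True m ∧ StepReach G.step D w m := fun w => by
    obtain ⟨m, hm, hr⟩ := ruling_dom I.hid hgn (step_small hG hN) w
    rw [hD] at hr
    exact ⟨m, ⟨trivial, hm⟩, hr⟩
  clear hD
  have h1 := HG.two_pow_le_card_touched (M := G.sel I g True) (coin := coin) (NS := I.small) hG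
    (fun x y => HG.sel_sep hG)
    (fun w hw => mem_small_of_isN hN hw) hf.2 hf.1 hdom hB
  -- The surplus `1 + 2 * D` in the exponent pays for the factors 2 and `4 ^ D` of the growth bound.
  have h2 : 2 ^ (g I.size + e + 1 + 2 * D) = 4 ^ D * (2 * (2 ^ e * 2 ^ g I.size)) := by
    rw [pow_add, pow_add, pow_add, pow_mul]; norm_num; ring
  rw [h2] at h1
  have h3 := Nat.le_of_mul_le_mul_left (Nat.le_of_mul_le_mul_left h1 (by positivity)) two_pos
  exact (Nat.mul_le_mul_right (2 ^ g I.size) (Nat.lt_two_pow_self (n := e)).le).trans h3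

end
end

section Counting
variable {V κ : Type} [Fintype (V → κ → Bool)]

open Classical in
/-- An event that prescribes `q` coins, depending on the other coins only, has probability at most
`2 ^ (-q)`. -/
theorem card_mul_two_pow_le (E : Finset (V → κ → Bool)) (J : Set (V × κ))
    (A : (V → κ → Bool) → Finset (V × κ)) (val : (V → κ → Bool) → V × κ → Bool) (q : ℕ)
    (hAJ : ∀ ω, ↑(A ω) ⊆ J)
    (hdep : ∀ ω ω', (∀ p, p ∉ J → ω p.1 p.2 = ω' p.1 p.2) → A ω = A ω' ∧ val ω = val ω')
    (hE : ∀ ω ∈ E, q ≤ (A ω).card ∧ ∀ p ∈ A ω, ω p.1 p.2 = val ω p) :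
    E.card * 2 ^ q ≤ Fintype.card (V → κ → Bool) := by
  -- `F` flips the coins in a subset `s` of `A ω`. Since `A` and `val` ignore the coins in `J`, they
  -- survive the flip, and `s` is recovered as the set of places where the result disagrees with
  -- `val`. So each outcome in `E` accounts for at least `2 ^ q` outcomes, without overlap.
  set F : (Σ _ : V → κ → Bool, Finset (V × κ)) → V → κ → Bool :=
    fun p v i => if (v, i) ∈ p.2 then !(p.1 v i) else p.1 v i with hF
  have h1 : (E.sigma fun ω => (A ω).powerset).card ≤ Fintype.card (V → κ → Bool) := by
    rw [← Finset.card_univ]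
    refine Finset.card_le_card_of_injOn F (fun _ _ => Finset.mem_univ _) ?_
    have key : ∀ p ∈ E.sigma fun ω => (A ω).powerset, A p.1 = A (F p) ∧ val p.1 = val (F p) ∧
        p.2 = (A (F p)).filter fun y => F p y.1 y.2 ≠ val (F p) y := by
      rintro ⟨ω, s⟩ hp
      simp only [Finset.mem_sigma, Finset.mem_powerset] at hp
      obtain ⟨e1, e2⟩ := hdep ω (F ⟨ω, s⟩) (fun y hy => by
        have : y ∉ s := fun h => hy (hAJ ω (hp.2 h))
        simp [hF, this])
      refine ⟨e1, e2, ?_⟩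
      rw [← e1, ← e2]
      ext y
      simp only [Finset.mem_filter, hF]
      constructor
      · intro hy
        refine ⟨hp.2 hy, ?_⟩
        rw [if_pos hy, (hE ω hp.1).2 y (hp.2 hy)]
        simp
      · rintro ⟨hy, hy'⟩
        by_contra hn
        rw [if_neg hn] at hy'
        exact hy' ((hE ω hp.1).2 y hy)
    rintro ⟨ω, s⟩ hp ⟨ω', s'⟩ hp' heq
    obtain ⟨-, -, k3⟩ := key _ hp
    obtain ⟨-, -, k3'⟩ := key _ hp'
    rw [heq, ← k3'] at k3
    dsimp only at k3
    subst k3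
    have : ω = ω' := by
      funext v i
      have := congrFun (congrFun heq v) i
      simp only [hF] at this
      split_ifs at this with h
      · simpa using this
      · exact this
    rw [this]
  refine le_trans ?_ h1
  rw [Finset.card_sigma, ← smul_eq_mul, ← Finset.sum_const]
  refine Finset.sum_le_sum fun ω hω => ?_
  rw [Finset.card_powerset]
  exact Nat.pow_le_pow_right (by norm_num) (hE ω hω).1

end Counting
end LocalModel

/-! ### The two stages combined -/

namespace LocalModel
section
variable {S : ℕ → Type} {k : ℕ} {g : ℕ → ℕ}

/-- The graph of the first stage: centres of trails. -/
noncomputable def Inst.trailGraph (I : Inst S k) (g : ℕ → ℕ) : HG (I.V × ℕ) :=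
  I.N.trailGraph (Ruling I.N.trail (idColor I.ident) (g I.size + k + 5))

/-- A bound for the length of the chains that remain after the first stage. -/
noncomputable def chainBound : ℕ := 2 * (3 * numColors (Fin 2)) + 2

/-- The graph of the second stage: contracted chains. -/
noncomputable def Inst.chainGraph (I : Inst S k) (X : I.V × ℕ → Prop) : HG (I.V × ℕ) :=
  I.N.chainGraph X chainBound

theorem Inst.trailGraph_cubic (I : Inst S k) : (I.trailGraph g).Cubic :=
  Network.trailGraph_cubic fun _ _ hx hy h => hx.sep Network.trail_symm hy h

/-- An orientation that gives each active node two outgoing ports. -/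
def Network.Good {V : Type} (N : Network V) (x : V × ℕ → Prop) : Prop :=
  (∀ z, x (N.mate z) ↔ ¬ x z) ∧
    ∀ v, N.Active v → ∃ i j, i ≠ j ∧ i < 5 ∧ j < 5 ∧ x (v, i) ∧ x (v, j)

theorem Inst.chainGraph_cubic (I : Inst S k)
    (hgn : Nat.log 2 (Fintype.card I.V) + 1 ≤ 2 ^ g I.size) {X : I.V × ℕ → Prop}
    (hX : ∀ y, X (Network.twin y) ↔ ¬ X y)
    (hX' : ∀ w, (I.trailGraph g).isN w → ∃ i, X ((I.trailGraph g).pt i w)) :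
    (I.N.pairing X).Short chainBound ∧ (I.chainGraph X).Cubic := by
  have h : (I.N.pairing X).Short chainBound := by
    refine Network.short_pairing (fun y => ruling_dom I.hid hgn Network.trail_small y) fun m hm => ?_
    obtain ⟨i, hi⟩ := hX' m hm
    fin_cases i
    · exact Or.inl hi
    · exact Or.inr (Or.inl hi)
    · exact Or.inr (Or.inr hi)
  exact ⟨h, Network.chainGraph_cubic (fun v => hX (v, 0)) h⟩

/-- The chain through the inner pair leaves the node through one of its two ports; the sinkless
orientation adds an outgoing port among the other three. -/
theorem Inst.good_expand (I : Inst S k) {X Y : I.V × ℕ → Prop}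
    (hX : ∀ y, X (Network.twin y) ↔ ¬ X y) (hS : (I.N.pairing X).Short chainBound)
    (hY : ∀ h, Y ((I.chainGraph X).inv h) ↔ ¬ Y h)
    (hY' : ∀ w, (I.chainGraph X).isN w → ∃ i, Y ((I.chainGraph X).pt i w)) :
    I.N.Good ((I.N.pairing X).expand chainBound Y fun z => tagKey (I.tag z)) := by
  have hk : Function.Injective fun z => tagKey (I.tag z) := fun x y h =>
    I.tag_inj.1 (tagKey_inj.1 h)
  refine ⟨Pairing.expand_mate hS hY hk, fun v hv => ?_⟩
  have hv' : (I.chainGraph X).isN (v, 0) := ⟨hv, rfl⟩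
  obtain ⟨i, hi⟩ := hY' _ hv'
  have hd := (Network.chainGraph_cubic (fun v => hX (v, 0)) hS).dem_pt (v, 0) i hv'
  set p := (I.N.chainGraph X chainBound).pt i (v, 0) with hp
  have hpv : p.1 = v := rfl
  have h1 : (I.N.pairing X).expand chainBound Y (fun z => tagKey (I.tag z)) p :=
    (Pairing.expand_of_not_inner hY hd.2.2).2 hi
  obtain ⟨t, ht, hti, hti'⟩ : ∃ t, t < 3 ∧ (I.N.pairing X).inner (v, t) ∧
      (I.N.pairing X).inner (v, flip t) := by
    have h2 : ∃ t < 3, (I.N.pairing X).inner (v, t) := by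
      have h3 := hX (v, 0)
      change X (v, 1) ↔ _ at h3
      by_cases hx : X (v, 0)
      · exact ⟨2, by norm_num, hv, by norm_num, by simpa [hx] using h3⟩
      · exact ⟨0, by norm_num, hv, by norm_num, by simpa using hx⟩
    obtain ⟨t, ht, hti⟩ := h2
    exact ⟨t, ht, hti, ((I.N.pairing X).inner_twin (v, t)).2 hti⟩
  have h2 := Pairing.expand_twin hS hY hk hti
  have h3 : ∃ j, (I.N.pairing X).inner (v, j) ∧
      (I.N.pairing X).expand chainBound Y (fun z => tagKey (I.tag z)) (v, j) := by
    by_cases h : (I.N.pairing X).expand chainBound Y (fun z => tagKey (I.tag z)) (v, t)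
    · exact ⟨t, hti, h⟩
    · exact ⟨flip t, hti', h2.2 h⟩
  obtain ⟨j, hj, hj'⟩ := h3
  refine ⟨p.2, j, ?_, hd.2.1, lt_trans hj.2.1 (by norm_num), h1, hj'⟩
  rintro rfl
  exact hd.2.2 hj

/-- The graph of the second stage is known to be cubic only when the first stage has not failed,
hence the nested form of the conclusion. -/
theorem exists_pipeline (hg : ∀ n, 1 ≤ g n) (b : Prop) (B : ℕ)
    {coin coin' : ∀ I : Inst S k, I.V × ℕ → Prop} (hc : LocF g coin) (hc' : LocF g coin') :
    ∃ (C C' : ℕ) (x : ∀ I : Inst S k, I.V × ℕ → Prop), LocF g x ∧ ∀ I : Inst S k,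
      Nat.log 2 (Fintype.card I.V) + 1 ≤ 2 ^ g I.size →
      (∀ c, ¬ (I.trailGraph g).Fails I g b B (coin I) c) →
      (I.chainGraph ((I.trailGraph g).orient I g b C C' (coin I))).Cubic ∧
      ((∀ c, ¬ (I.chainGraph ((I.trailGraph g).orient I g b C C' (coin I))).Fails I g b B
        (coin' I) c) → I.N.Good (x I)) := by
  have hG : LocG g (fun I : Inst S k => I.trailGraph g) :=
    LocG.trailGraph hg (LocF.ruling hg (LocM.trail hg))
  obtain ⟨C, C', h1, h2⟩ := exists_orient hg b B hG hc
  have hG' := LocG.chainGraph hg h1 chainBound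
  obtain ⟨D, D', h3, h4⟩ := exists_orient hg b B hG' hc'
  refine ⟨C, C', _, LocF.expand hg h1 h3 chainBound, fun I hI hf => ?_⟩
  obtain ⟨a1, a2⟩ := h2 I I.trailGraph_cubic
  obtain ⟨a3, a4⟩ := I.chainGraph_cubic hI a1 fun w hw => a2 w hw (hf w)
  refine ⟨a4, fun hf' => ?_⟩
  obtain ⟨a5, a6⟩ := h4 I a4
  exact I.good_expand a1 a3 a5 fun w hw => a6 w hw (hf' w)

theorem Inst.trailGraph_idx (I : Inst S k) {w : I.V × ℕ} (h : (I.trailGraph g).isN w) : w.2 < 2 :=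
  h.2.2.1

theorem Inst.chainGraph_idx (I : Inst S k) {X : I.V × ℕ → Prop} {w : I.V × ℕ}
    (h : (I.chainGraph X).isN w) : w.2 = 0 := h.2

/-- A deterministic local rule. -/
theorem exists_good_det (hg : ∀ n, Nat.log 2 n + 1 ≤ g n) :
    ∃ x : ∀ I : Inst S k, I.V × ℕ → Prop, LocF g x ∧ ∀ I : Inst S k, I.N.Good (x I) := by
  have hg' : ∀ n, 1 ≤ g n := fun n => le_trans (Nat.le_add_left _ _) (hg n)
  obtain ⟨C, C', x, h1, h2⟩ := exists_pipeline (S := S) (k := k) hg' False 6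
    (LocF.const True) (LocF.const True)
  refine ⟨x, h1, fun I => ?_⟩
  obtain ⟨h3, h4⟩ := h2 I ((hg I.size).trans Nat.lt_two_pow_self.le) fun c =>
    not_fails_det I.trailGraph_cubic (fun w => I.trailGraph_idx) le_rfl (hg _) c
  exact h4 fun c => not_fails_det h3 (fun w hw => by rw [I.chainGraph_idx hw]; norm_num) le_rfl
    (hg _) c

end

end LocalModel

/-! ### Failure probability and the union bound -/

namespace LocalModel
section Random
variable {k : ℕ} {g : ℕ → ℕ}

-- The coins in `J` belong to the current stage and the graph depends only on the others, so the
-- touched owners and their forced coin values are fixed by the others. `φ` gives the coin number of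
-- a node index and `ψ` recovers the index, so that distinct owners use distinct coins.
open Classical in
theorem card_fails_mul_le {S : ℕ → Type} (I : Inst S k) [Fintype (I.V → Fin 3 → Bool)]
    (G : (I.V → Fin 3 → Bool) → HG (I.V × ℕ))
    (hN : ∀ ω w, (G ω).isN w → w.2 < 2) (φ : ℕ → Fin 3) (ψ : Fin 3 → ℕ)
    (hφ : ∀ ω w, (G ω).isN w → ψ (φ w.2) = w.2) (J : Set (Fin 3)) (hJ : ∀ i, φ i ∈ J)
    (hdep : ∀ ω ω' : I.V → Fin 3 → Bool, (∀ v, ∀ i ∉ J, ω v i = ω' v i) → G ω = G ω')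
    (hgn : Nat.log 2 (Fintype.card I.V) + 1 ≤ 2 ^ g I.size) {B e D : ℕ}
    (hD : 3 * numColors (Fin 3) = D) (hB : 2 * (g I.size + e + 1 + 2 * D) + D < B * g I.size)
    (E : Finset (I.V → Fin 3 → Bool)) (c : I.V × ℕ)
    (hE : ∀ ω ∈ E, (G ω).Cubic ∧ (G ω).Fails I g True B (fun m => ω m.1 (φ m.2) = true) c) :
    E.card * 2 ^ (e * 2 ^ g I.size) ≤ Fintype.card (I.V → Fin 3 → Bool) := by
  set T : (I.V → Fin 3 → Bool) → Finset (I.V × ℕ) := fun ω =>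
    (G ω).touched ((G ω).sel I g True) I.small (B * g I.size) c with hT
  have hTN : ∀ ω, ∀ m ∈ T ω, (G ω).isN m := fun ω m hm => by
    simp only [hT, HG.touched, Finset.mem_filter] at hm
    exact hm.2.1.1
  refine card_mul_two_pow_le E {p | p.2 ∈ J} (fun ω => (T ω).image fun m => (m.1, φ m.2))
    (fun ω p => decide ((p.1, ψ p.2) ∉ (G ω).RB ((G ω).spD ((G ω).sel I g True)) c (B * g I.size)))
    _ ?_ ?_ ?_
  · intro ω p hp
    simp only [Finset.coe_image, Set.mem_image] at hp
    obtain ⟨m, -, rfl⟩ := hp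
    exact hJ _
  · intro ω ω' h
    have := hdep ω ω' fun v i hi => h (v, i) hi
    simp only [hT, this, and_self]
  · intro ω hω
    obtain ⟨h1, h2⟩ := hE ω hω
    constructor
    · rw [Finset.card_image_of_injOn]
      · exact card_touched_of_fails h1 (hN ω) hgn hD hB h2
      · intro m hm m' hm' heq
        simp only [Prod.mk.injEq] at heq
        refine Prod.ext heq.1 ?_
        rw [← hφ ω m (hTN ω m hm), heq.2, hφ ω m' (hTN ω m' hm')]
    · intro p hp
      simp only [Finset.mem_image] at hp
      obtain ⟨m, hm, rfl⟩ := hp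
      have h3 := HG.coin_of_mem_touched h1 (fun x y => HG.sel_sep h1) h2.2 hm
      rw [Bool.eq_iff_iff, decide_eq_true_iff]
      dsimp only
      rw [hφ ω m (hTN ω m hm)]
      exact h3

end Random
end LocalModel

namespace LocalModel
section Random
variable {k : ℕ} {g : ℕ → ℕ}

/-- The instance with other random strings. -/
abbrev Inst.withRnd {S : ℕ → Type} (I : Inst S k) (ω : I.V → S (Fintype.card I.V)) : Inst S k :=
  { I with rnd := ω }

/-- A randomized local rule, which fails with probability at most `1 / n ^ c`. -/
theorem exists_good_rand (hg : ∀ n, 1 ≤ g n) (hgn : ∀ n, Nat.log 2 n + 1 ≤ 2 ^ g n) (c : ℕ) :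
    ∃ x : ∀ I : Inst (fun _ => Fin 3 → Bool) k, I.V × ℕ → Prop, LocF g x ∧
      ∀ I : Inst (fun _ => Fin 3 → Bool) k,
        failureProb (fun ω : I.V → Fin 3 → Bool => I.N.Good (x (I.withRnd ω))) ≤
          1 / (Fintype.card I.V : ℝ) ^ c := by
  classical
  obtain ⟨D, hD⟩ : ∃ D, 3 * numColors (Fin 3) = D := ⟨_, rfl⟩
  -- A given failure has probability at most `M ^ (-e)` with `M = 2 ^ 2 ^ g n ≥ n`. Two factors `M`
  -- absorb the constant 4 and one absorbs the `n` of the union bound over two stages with `2 * n`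
  -- objects each.
  set e := c + 3 with he
  set B := 2 * (e + 2 + 2 * D) + D + 1 with hBdef
  have hB : ∀ n, 2 * (g n + e + 1 + 2 * D) + D < B * g n := by
    intro n
    have := Nat.mul_le_mul_left (2 * (e + 1 + 2 * D) + D + 1) (hg n)
    have h2 : B * g n = 2 * g n + (2 * (e + 1 + 2 * D) + D + 1) * g n := by rw [hBdef]; ring
    omega
  -- Coins 0 and 1 serve the two pairs of a node in the first stage; coin 2 is kept for the second.
  set φ : ℕ → Fin 3 := fun j => if j = 0 then 0 else 1 with hφ
  have hrnd : LocF g (fun (I : Inst (fun _ => Fin 3 → Bool) k) x => I.rnd x.1) :=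
    (LocF.rnd (S := fun _ => Fin 3 → Bool)).map fun p => p.2
  obtain ⟨C, C', x, h1, h2⟩ := exists_pipeline (S := fun _ => Fin 3 → Bool) (k := k) hg True B
    (coin := fun I m => I.rnd m.1 (φ m.2) = true) (coin' := fun I m => I.rnd m.1 2 = true)
    (hrnd.map2 (fun r j => r (φ j) = true) LocF.idx) (hrnd.map fun r => r 2 = true)
  refine ⟨x, h1, fun I => ?_⟩
  set Ω := I.V → Fin 3 → Bool with hΩ
  set X : Ω → I.V × ℕ → Prop := fun ω =>
    (I.trailGraph g).orient I g True C C' (fun m => ω m.1 (φ m.2) = true) with hX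
  set F₁ : I.V × ℕ → Finset Ω := fun z => Finset.univ.filter fun ω =>
    (I.trailGraph g).Fails I g True B (fun m => ω m.1 (φ m.2) = true) z with hF₁
  set F₂ : I.V × ℕ → Finset Ω := fun z => Finset.univ.filter fun ω =>
    (I.chainGraph (X ω)).Cubic ∧
      (I.chainGraph (X ω)).Fails I g True B (fun m => ω m.1 2 = true) z with hF₂
  set Bad : Finset Ω := Finset.univ.filter fun ω => ¬ I.N.Good (x (I.withRnd ω)) with hBad
  have hsub : Bad ⊆ I.small.biUnion fun z => F₁ z ∪ F₂ z := by
    intro ω hω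
    simp only [hBad, Finset.mem_filter, Finset.mem_univ, true_and] at hω
    by_contra hn
    simp only [Finset.mem_biUnion, Finset.mem_union, hF₁, hF₂, Finset.mem_filter, Finset.mem_univ,
      true_and, not_exists, not_and, not_or] at hn
    have a1 : ∀ z, ¬ (I.trailGraph g).Fails I g True B (fun m => ω m.1 (φ m.2) = true) z :=
      fun z hz => (hn z (mem_small_of_isN (fun w => I.trailGraph_idx) hz.1)).1 hz
    obtain ⟨a2, a3⟩ := h2 (I.withRnd ω) (hgn _) a1
    refine hω (a3 fun z hz => (hn z (mem_small_of_isN (I := I) (G := I.chainGraph (X ω))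
      (fun w hw => ?_) hz.1)).2 a2 hz)
    rw [I.chainGraph_idx hw]; norm_num
  have hc1 : ∀ z, (F₁ z).card * 2 ^ (e * 2 ^ g I.size) ≤ Fintype.card Ω := by
    intro z
    refine card_fails_mul_le I (fun _ => I.trailGraph g) (fun _ w => I.trailGraph_idx) φ Fin.val ?_
      Set.univ (fun _ => trivial) (fun _ _ _ => rfl) (hgn _) hD (hB _) (F₁ z) z ?_
    · intro _ w hw
      have := I.trailGraph_idx hw
      simp only [hφ]
      split_ifs with h
      · exact h.symm
      · change 1 = _; omega
    · intro ω hω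
      simp only [hF₁, Finset.mem_filter, Finset.mem_univ, true_and] at hω
      exact ⟨I.trailGraph_cubic, hω⟩
  -- `X` is a function of coins 0 and 1, so once these are fixed, the second graph is fixed and coin
  -- 2 is still fair.
  have hc2 : ∀ z, (F₂ z).card * 2 ^ (e * 2 ^ g I.size) ≤ Fintype.card Ω := by
    intro z
    refine card_fails_mul_le I (fun ω => I.chainGraph (X ω))
      (fun _ w hw => by rw [I.chainGraph_idx hw]; norm_num) (fun _ => 2) (fun _ => 0)
      (fun _ w hw => (I.chainGraph_idx hw).symm) {2} (fun _ => rfl) ?_ (hgn _) hD (hB _) (F₂ z) z ?_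
    · intro ω ω' h
      have h3 : ∀ (v : I.V) j, ω v (φ j) = ω' v (φ j) := by
        intro v j
        refine h v _ ?_
        simp only [hφ, Set.mem_singleton_iff]
        split_ifs <;> decide
      have h4 : X ω = X ω' := by simp only [hX, h3]
      simp only [h4]
    · intro ω hω
      simp only [hF₂, Finset.mem_filter, Finset.mem_univ, true_and] at hω
      exact hω
  have hcard : Bad.card * 2 ^ (e * 2 ^ g I.size) ≤ 4 * I.size * Fintype.card Ω := by
    have h3 : Bad.card ≤ ∑ z ∈ I.small, ((F₁ z).card + (F₂ z).card) :=
      (Finset.card_le_card hsub).trans (Finset.card_biUnion_le.trans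
        (Finset.sum_le_sum fun z _ => Finset.card_union_le _ _))
    refine (Nat.mul_le_mul_right _ h3).trans ?_
    rw [Finset.sum_mul]
    have h4 : ∀ z ∈ I.small, ((F₁ z).card + (F₂ z).card) * 2 ^ (e * 2 ^ g I.size) ≤
        2 * Fintype.card Ω := by
      intro z _
      have := hc1 z
      have := hc2 z
      rw [add_mul]; omega
    refine (Finset.sum_le_card_nsmul _ _ _ h4).trans ?_
    rw [I.card_small, smul_eq_mul]
    exact (by ring : _ = _).le
  have hpow : 4 * I.size ^ (c + 1) ≤ 2 ^ (e * 2 ^ g I.size) := by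
    set M := 2 ^ 2 ^ g I.size with hM
    have h5 : 2 ≤ M := by
      have : 2 ^ 1 ≤ M := Nat.pow_le_pow_right (by norm_num) Nat.one_le_two_pow
      simpa using this
    have h6 : I.size ≤ M :=
      (Nat.lt_pow_succ_log_self (b := 2) (by norm_num) I.size).le.trans
        (Nat.pow_le_pow_right (by norm_num) (hgn I.size))
    have h7 : M ^ e = M ^ 2 * M ^ (c + 1) := by rw [← pow_add]; congr 1; omega
    rw [mul_comm e, pow_mul, ← hM, h7]
    exact Nat.mul_le_mul (by nlinarith) (Nat.pow_le_pow_left h6 _)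
  have hfin : Bad.card * I.size ^ c ≤ Fintype.card Ω ∨ I.size = 0 := by
    rcases Nat.eq_zero_or_pos I.size with h0 | h0
    · exact Or.inr h0
    · left
      have h7 := (Nat.mul_le_mul_left Bad.card hpow).trans hcard
      refine Nat.le_of_mul_le_mul_left (c := 4 * I.size) (le_trans (le_of_eq ?_) h7) (by omega)
      ring
  have hP : failureProb (fun ω : Ω => I.N.Good (x (I.withRnd ω))) =
      (Bad.card : ℝ) / Fintype.card Ω := by
    rw [failureProb, Nat.card_eq_fintype_card, Nat.card_eq_fintype_card, Fintype.card_subtype]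
  have hpos : (0 : ℝ) < Fintype.card Ω := by exact_mod_cast Fintype.card_pos
  rw [hP]
  rcases hfin with h | h
  · rcases Nat.eq_zero_or_pos (I.size ^ c) with h0 | h0
    · have hz : I.size = 0 := by
        by_contra hne
        exact absurd h0 (pow_ne_zero _ hne)
      rw [hz] at hcard
      have hb : Bad.card = 0 := by
        by_contra hne
        have := Nat.mul_pos (Nat.pos_of_ne_zero hne) (Nat.two_pow_pos (e * 2 ^ g 0))
        omega
      rw [hb]
      simp only [Nat.cast_zero, zero_div]
      positivity
    · have h0' : (0 : ℝ) < (Fintype.card I.V : ℝ) ^ c := by exact_mod_cast h0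
      rw [div_le_div_iff₀ hpos h0', one_mul]
      exact_mod_cast h
  · have hb : Bad.card = 0 := by
      by_contra hne
      have := Nat.mul_pos (Nat.pos_of_ne_zero hne) (Nat.two_pow_pos (e * 2 ^ g I.size))
      rw [h] at hcard this
      omega
    rw [hb]
    simp only [Nat.cast_zero, zero_div]
    positivity

end Random
end LocalModel

/-! ### Labellings of the ports, and round bounds -/

namespace LocalModel
open Filter Asymptotics

section
variable {V : Type} {N : Network V}

/-- The labels of the ports given by `x`. -/
noncomputable def portLabels (N : Network V) (x : V × ℕ → Prop) (p : N.Port) : Bool := by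
  classical exact decide (x (p.1, p.2))

theorem portLabels_eq {x : V × ℕ → Prop} {p : N.Port} :
    portLabels N x p = true ↔ x (p.1, p.2) := by
  simp [portLabels]

theorem mate_port (p : N.Port) : N.mate (p.1, p.2) = ((N.opp p).1, ((N.opp p).2 : ℕ)) := by
  simp [Network.mate, Network.nbr]

theorem Network.Good.isOrientation {x : V × ℕ → Prop} (h : N.Good x) :
    N.IsOrientation (portLabels N x) := by
  intro p
  have := h.1 (p.1, p.2)
  rw [mate_port] at this
  rw [Bool.eq_iff_iff, portLabels_eq, this, Bool.not_eq_true', ← Bool.not_eq_true, portLabels_eq]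

theorem two_le_count {x : N.Port → Bool} {v : V} {i j : Fin (N.deg v)} (hij : i ≠ j)
    (hi : x ⟨v, i⟩ = true) (hj : x ⟨v, j⟩ = true) : 2 ≤ N.count x v := by
  rw [Network.count, ← Finset.card_pair hij]
  refine Finset.card_le_card ?_
  intro a ha
  simp only [Finset.mem_insert, Finset.mem_singleton] at ha
  rcases ha with rfl | rfl <;> simpa

theorem Network.Good.two_le_outdeg {x : V × ℕ → Prop} (h : N.Good x) {v : V} (hv : 5 ≤ N.deg v) :
    2 ≤ N.outdeg (portLabels N x) v := by
  obtain ⟨i, j, hij, hi, hj, hxi, hxj⟩ := h.2 v hv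
  exact two_le_count (i := ⟨i, by omega⟩) (j := ⟨j, by omega⟩) (by simpa using hij)
    (portLabels_eq.2 hxi) (portLabels_eq.2 hxj)

theorem Network.Good.outdegreeTwo {x : V × ℕ → Prop} (h : N.Good x) :
    outdegreeTwo V N (portLabels N x) :=
  ⟨h.isOrientation, fun _ hv => h.two_le_outdeg hv⟩

theorem Network.Good.outdegreeTwoRegular {x : V × ℕ → Prop} (h : N.Good x) :
    outdegreeTwoRegular V N (portLabels N x) :=
  fun hr => ⟨h.isOrientation, fun v => h.two_le_outdeg (hr v).ge⟩

open Classical in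
/-- The first two outgoing ports of a node. -/
def firstTwo (x : V × ℕ → Prop) (z : V × ℕ) : Prop :=
  x z ∧ ((Finset.range z.2).filter fun i => x (z.1, i)).card < 2

/-- A red walk in which no edge has two red halves uses at most two half-edges. -/
theorem isHalfPathDecomposition_of_opp {red : N.Port → Bool} {k : ℕ} (hk : 2 ≤ k)
    (h : ∀ p, red p = true → red (N.opp p) = false) (h2 : ∀ v, N.count red v = 2) :
    N.IsHalfPathDecomposition k red := by
  have hlen : ∀ m w, N.IsRedWalk red m w → m ≤ 2 := by
    rintro m w ⟨hr, s, hs⟩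
    by_contra hm
    have key : ∀ i, i + 1 < m → ¬ Even (i + s) := by
      intro i hi he
      have := hs i hi
      rw [if_pos he] at this
      have h3 := hr (i + 1) hi
      rw [this, h _ (hr i (by omega))] at h3
      exact absurd h3 (by simp)
    have h0 := key 0 (by omega)
    have h1 := key 1 (by omega)
    rw [Nat.not_even_iff_odd] at h0 h1
    rcases h0 with ⟨a, ha⟩
    rcases h1 with ⟨b, hb⟩
    omega
  refine ⟨h2, fun m w hw => ?_, fun m w hw => (hlen m w hw).trans hk⟩
  have hm := hlen m w hw
  obtain ⟨hr, s, hs⟩ := hw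
  have hne : 1 < m → w 1 ≠ w 0 := by
    intro h1
    have := hs 0 h1
    split_ifs at this
    · rw [this]; exact N.opp_ne _
    · exact this.2
  intro i hi j hj hij
  simp only [Set.mem_Iio] at hi hj
  have hi' : i = 0 ∨ i = 1 := by omega
  have hj' : j = 0 ∨ j = 1 := by omega
  rcases hi' with rfl | rfl <;> rcases hj' with rfl | rfl
  · rfl
  · exact absurd hij.symm (hne hj)
  · exact absurd hij (hne hi)
  · rfl

open Classical in
theorem card_firstTwo (p : ℕ → Prop) (d : ℕ) :
    ((Finset.range d).filter fun i => p i ∧ ((Finset.range i).filter p).card < 2).card =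
      min 2 ((Finset.range d).filter p).card := by
  induction d with
  | zero => simp
  | succ d ih =>
    rw [Finset.range_add_one, Finset.filter_insert, Finset.filter_insert]
    by_cases hp : p d
    · by_cases hc : ((Finset.range d).filter p).card < 2
      · rw [if_pos ⟨hp, hc⟩, if_pos hp, Finset.card_insert_of_notMem (by simp),
          Finset.card_insert_of_notMem (by simp), ih]
        omega
      · rw [if_neg (fun h => hc h.2), if_pos hp, Finset.card_insert_of_notMem (by simp), ih]
        omega
    · rw [if_neg (fun h => hp h.1), if_neg hp, ih]

open Classical in
theorem count_portLabels (x : V × ℕ → Prop) (v : V) : N.count (portLabels N x) v =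
    ((Finset.range (N.deg v)).filter fun i => x (v, i)).card := by
  rw [Network.count]
  refine Finset.card_bij (fun i _ => i.val) ?_ ?_ ?_
  · intro i hi
    simp only [Finset.mem_filter, Finset.mem_univ, true_and, portLabels_eq] at hi
    simp [hi]
  · intro i _ j _ hij
    exact Fin.ext hij
  · intro i hi
    simp only [Finset.mem_filter, Finset.mem_range] at hi
    exact ⟨⟨i, hi.1⟩, by simpa [portLabels_eq] using hi.2, rfl⟩

/-- Red half-edges are outgoing and their mates are incoming, so red paths never cross an edge. They
stay at one node and have at most two half-edges, far below eight. -/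
theorem Network.Good.halfPathEight {x : V × ℕ → Prop} (h : N.Good x) :
    halfPathEight V N (portLabels N (firstTwo x)) := by
  classical
  intro hr
  refine isHalfPathDecomposition_of_opp (by norm_num) ?_ ?_
  · intro p hp
    rw [portLabels_eq] at hp
    rw [← Bool.not_eq_true, portLabels_eq]
    have := h.1 (p.1, p.2)
    rw [mate_port] at this
    exact fun h' => this.1 h'.1 hp.1
  · intro v
    have h1 := h.two_le_outdeg (hr v).ge
    rw [Network.outdeg, count_portLabels] at h1
    rw [count_portLabels]
    have h2 := card_firstTwo (fun i => x (v, i)) (N.deg v)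
    rw [min_eq_left h1] at h2
    rw [← h2]
    congr!

end

section
variable {S : ℕ → Type} {k : ℕ} {g : ℕ → ℕ}

theorem LocF.portLabel {x : ∀ I : Inst S k, I.V × ℕ → Prop} (h : LocF g x) :
    ∃ y : ∀ I : Inst S k, I.V × ℕ → Bool, LocF g y ∧
      ∀ I : Inst S k, (fun p : I.N.Port => y I (p.1, p.2)) = portLabels I.N (x I) := by
  classical
  exact ⟨_, h.map fun p => decide p, fun I => rfl⟩

theorem LocF.firstTwo {x : ∀ I : Inst S k, I.V × ℕ → Prop} (h : LocF g x) :
    LocF g (fun I => LocalModel.firstTwo (x I)) := by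
  classical
  have h1 : LocF g (fun I z => (fun i => x I (z.1, i) : ℕ → Prop)) := by
    obtain ⟨C, hC⟩ := h
    refine ⟨C, fun I J z y hs hi hv => funext fun i => ?_⟩
    exact hC I J (z.1, i) (y.1, i) hs rfl hv
  exact h.and ((h1.prod LocF.idx).map fun p : (ℕ → Prop) × ℕ =>
    ((Finset.range p.2).filter p.1).card < 2)

end

/-- The round bound of the deterministic algorithms. -/
def detRounds (n : ℕ) : ℕ := Nat.log 2 n + 1

/-- The round bound of the randomized algorithms. -/
def randRounds (n : ℕ) : ℕ := Nat.log 2 (Nat.log 2 n) + 1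

theorem log_le_two_pow_randRounds (n : ℕ) : Nat.log 2 n + 1 ≤ 2 ^ randRounds n :=
  Nat.lt_pow_succ_log_self (by norm_num) _

theorem natLog_add_one_le {n : ℕ} (hn : 3 ≤ n) : (Nat.log 2 n : ℝ) + 1 ≤ 3 * Real.log n := by
  have hn' : (3 : ℝ) ≤ n := by exact_mod_cast hn
  have h1 : (Nat.log 2 n : ℝ) ≤ Real.logb 2 n := Real.natLog_le_logb n 2
  have h2 := Real.log_two_gt_d9
  have h3 : Real.logb 2 n * Real.log 2 = Real.log n := by
    rw [Real.logb, div_mul_cancel₀]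
    linarith
  have h4 : 1 ≤ Real.log n := by
    rw [Real.le_log_iff_exp_le (by linarith)]
    exact Real.exp_one_lt_d9.le.trans (by linarith)
  nlinarith

theorem detRounds_isBigO (C : ℕ) :
    (fun n => ((C * detRounds n : ℕ) : ℝ)) =O[atTop] fun n : ℕ => Real.log n := by
  refine IsBigO.of_bound (C * 3) ?_
  filter_upwards [eventually_ge_atTop 3] with n hn
  have h1 := natLog_add_one_le hn
  have h2 : 0 ≤ Real.log n := Real.log_natCast_nonneg n
  rw [Real.norm_of_nonneg (by positivity), Real.norm_of_nonneg h2, Nat.cast_mul, mul_assoc]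
  refine mul_le_mul_of_nonneg_left ?_ (by positivity)
  rw [detRounds]
  push_cast
  exact h1

theorem randRounds_isBigO (C : ℕ) :
    (fun n => ((C * randRounds n : ℕ) : ℝ)) =O[atTop] fun n : ℕ => Real.log (Real.log n) := by
  have h1 : ∀ᶠ n : ℕ in atTop, (3 : ℝ) ≤ Real.log n :=
    (Real.tendsto_log_atTop.comp tendsto_natCast_atTop_atTop).eventually_ge_atTop 3
  refine IsBigO.of_bound (C * 9) ?_
  filter_upwards [h1, eventually_ge_atTop 8] with n h2 hn
  have h3 : 3 ≤ Nat.log 2 n := (Nat.le_log_iff_pow_le (by norm_num) (by omega)).2 (by simpa using hn)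
  have h4 := natLog_add_one_le h3
  have h5 := natLog_add_one_le (n := n) (by omega)
  have h6 : Real.log (Nat.log 2 n) ≤ Real.log (3 * Real.log n) := by
    refine Real.log_le_log ?_ (by linarith)
    exact_mod_cast (by omega : 0 < Nat.log 2 n)
  have h7 : Real.log (3 * Real.log n) = Real.log 3 + Real.log (Real.log n) :=
    Real.log_mul (by norm_num) (by linarith)
  have h8 : Real.log 3 ≤ Real.log (Real.log n) := Real.log_le_log (by norm_num) h2
  have h9 : 0 ≤ Real.log 3 := Real.log_nonneg (by norm_num)
  rw [Real.norm_of_nonneg (by positivity), Real.norm_of_nonneg (by linarith), Nat.cast_mul, mul_assoc]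
  refine mul_le_mul_of_nonneg_left ?_ (by positivity)
  rw [randRounds]
  push_cast
  linarith

theorem failureProb_mono {Ω : Type} [Finite Ω] {E F : Ω → Prop} (h : ∀ ω, E ω → F ω) :
    failureProb F ≤ failureProb E := by
  unfold failureProb
  refine div_le_div_of_nonneg_right ?_ (by positivity)
  have := Nat.card_le_card_of_injective
    (fun ω : {ω // ¬ F ω} => (⟨ω.1, fun hE => ω.2 (h _ hE)⟩ : {ω // ¬ E ω}))
    (fun a b hab => Subtype.ext (by simpa using hab))
  exact_mod_cast this

/-- Post-processing of a good orientation solves `P` both deterministically and at random. -/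
theorem solvable_of_good {P : Problem Bool} (F : ∀ {V : Type}, (V × ℕ → Prop) → V × ℕ → Prop)
    (hF : ∀ {S : ℕ → Type} {k : ℕ} {g : ℕ → ℕ} {x : ∀ I : Inst S k, I.V × ℕ → Prop},
      LocF g x → LocF g fun I => F (x I))
    (hP : ∀ (V : Type) (N : Network V) x, N.Good x → P V N (portLabels N (F x))) :
    DetSolvable P (fun n => Real.log n) ∧ RandSolvable P (fun n => Real.log (Real.log n)) := by
  constructor
  · intro k
    obtain ⟨x, h1, h2⟩ := exists_good_det (S := fun _ => Unit) (k := k) (g := detRounds)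
      fun n => le_rfl
    obtain ⟨y, h3, h4⟩ := (hF h1).portLabel
    obtain ⟨A, C, hA⟩ := realize h3
    refine ⟨A, fun n => C * detRounds n, detRounds_isBigO C, fun V _ N ident hid => ?_⟩
    have h5 := hA ⟨V, inferInstance, N, ident, hid, fun _ => ()⟩
    rw [h4] at h5
    exact h5 ▸ hP V N _ (h2 ⟨V, inferInstance, N, ident, hid, fun _ => ()⟩)
  · intro k c
    obtain ⟨x, h1, h2⟩ := exists_good_rand (k := k) (g := randRounds)
      (fun n => Nat.le_add_left _ _) log_le_two_pow_randRounds c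
    obtain ⟨y, h3, h4⟩ := (hF h1).portLabel
    obtain ⟨A, C, hA⟩ := realize h3
    refine ⟨fun _ => 3, A, fun n => C * randRounds n, randRounds_isBigO C,
      fun V _ N ident hid => ?_⟩
    have h6 := h2 ⟨V, inferInstance, N, ident, hid, fun _ _ => false⟩
    refine le_trans (failureProb_mono fun ω hω => ?_) h6
    have h5 := hA ⟨V, inferInstance, N, ident, hid, ω⟩
    rw [h4] at h5
    exact h5 ▸ hP V N _ hω

end LocalModel

theorem mainTheorem7 :
    (LocalModel.DetSolvable LocalModel.outdegreeTwo (fun n => Real.log n) ∧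
      LocalModel.RandSolvable LocalModel.outdegreeTwo (fun n => Real.log (Real.log n))) ∧
    (LocalModel.DetSolvable LocalModel.outdegreeTwoRegular (fun n => Real.log n) ∧
      LocalModel.RandSolvable LocalModel.outdegreeTwoRegular (fun n => Real.log (Real.log n))) ∧
    (LocalModel.DetSolvable LocalModel.halfPathEight (fun n => Real.log n) ∧
      LocalModel.RandSolvable LocalModel.halfPathEight (fun n => Real.log (Real.log n))) := by
  open LocalModel in
  exact ⟨solvable_of_good (fun x => x) (fun h => h) fun _ _ _ h => h.outdegreeTwo,
    solvable_of_good (fun x => x) (fun h => h) fun _ _ _ h => h.outdegreeTwoRegular,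
    solvable_of_good firstTwo (fun h => h.firstTwo) fun _ _ _ h => h.halfPathEight⟩
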